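/- Let $S$ be a compact connected surface without boundary, equipped with a flat Riemannian metric (i.e. locally isometric to the Euclidean plane). A triangulation $T$ of $S$ is a finite simplicial complex whose maximal simplices are triangles, in which every edge lies in exactly two triangles, and whose geometric realization $|T|$ is homeomorphic to $S$. For an edge $e=ab$ of $T$, the contraction $T/e$ is the simplicial complex obtained from $T$ by identifying the vertices $a$ and $b$ to one vertex $w$; the edge $e$ is contractible if $T/e$ is again a triangulation of $S$. A shortest path embedding with uniqueness of a triangulation $T$ into $S$ is a homeomorphism $g\colon |T|\to S$ such that for each edge $xy$ of $T$ the image $g(xy)$ is the unique (up to reparametrization) shortest path in $S$ between $g(x)$ and $g(y)$. Let $T$ be a triangulation of $S$ with a contractible edge $e=ab$. If $T/e$ admits a shortest path embedding with uniqueness into $S$, then $T$ admits a shortest path embedding with uniqueness into $S$ as well. Moreover, for every shortest path embedding with uniqueness $f\colon |T/e|\to S$ and every neighborhood $U$ of $f(w)$, there is a shortest path embedding with uniqueness $g\colon |T|\to S$ such that $g(e)\subseteq U$ and $g(x)=f(x)$ for every vertex $x\ne a,b$ of $T$. -/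

import Mathlib

open scoped Bundle Manifold ContDiff Topology ENNReal

noncomputable section

namespace FlatSurface

/-! ### Flat surfaces -/

/-- The Euclidean plane. -/
abbrev Plane : Type := EuclideanSpace ℝ (Fin 2)

/-- A Riemannian metric on a smooth surface `S` is flat if it is locally isometric to the Euclidean
plane: around each point there is a smooth chart of `S` into the plane whose differential at every
point of its domain preserves inner products of tangent vectors. -/
def IsFlat (S : Type*) [TopologicalSpace S] [ChartedSpace Plane S]
    [IsManifold (𝓡 2) ∞ S] [Bundle.RiemannianBundle (fun x : S => TangentSpace (𝓡 2) x)] : Prop :=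
  ∀ x : S, ∃ φ ∈ IsManifold.maximalAtlas (𝓡 2) ∞ S, x ∈ φ.source ∧
    ∀ y ∈ φ.source, ∀ v w : TangentSpace (𝓡 2) y,
      @inner ℝ Plane _ (mfderiv (𝓡 2) (𝓡 2) φ y v) (mfderiv (𝓡 2) (𝓡 2) φ y w) = inner ℝ v w

/-! ### Shortest paths -/

section ShortestPaths

variable {X : Type*} [PseudoEMetricSpace X]

/-- The length of a (continuous) path: the supremum, over all subdivisions of the parameter
interval, of the sum of the distances between consecutive points. -/
def pathLength {p q : X} (γ : Path p q) : ℝ≥0∞ :=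
  eVariationOn γ Set.univ

/-- A shortest path minimizes the length among all paths with the same endpoints. -/
def IsShortestPath {p q : X} (γ : Path p q) : Prop :=
  ∀ δ : Path p q, pathLength γ ≤ pathLength δ

/-- The set `A` is (the trace of) the unique shortest path from `p` to `q`. Paths are considered up
to reparametrization, so uniqueness means that all shortest paths have the same trace. -/
def IsUniqueShortestPathTrace (p q : X) (A : Set X) : Prop :=
  (∃ γ : Path p q, IsShortestPath γ ∧ Set.range γ = A) ∧
    ∀ γ : Path p q, IsShortestPath γ → Set.range γ = A

end ShortestPaths

/-! ### Triangulations -/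

section Triangulations

/-- The geometric realization of a finite simplicial complex `K`, in barycentric coordinates, as a
subspace of `V → ℝ`. -/
def Realization {V : Type*} [Fintype V] (K : PreAbstractSimplicialComplex V) : Type _ :=
  {x : V → ℝ // x ∈ stdSimplex ℝ V ∧ ∃ s ∈ K.faces, Function.support x ⊆ (s : Set V)}

instance {V : Type*} [Fintype V] (K : PreAbstractSimplicialComplex V) : TopologicalSpace (Realization K) :=
  instTopologicalSpaceSubtype

/-- The closed simplex of the realization of `K` that is spanned by the face `s`. -/
def closedFace {V : Type*} [Fintype V] (K : PreAbstractSimplicialComplex V) (s : Finset V) : Set (Realization K) :=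
  {x | Function.support x.1 ⊆ (s : Set V)}

variable {V : Type*} [DecidableEq V]

/-- The point of the realization of `K` that corresponds to the vertex `v`. -/
def vertexPoint [Fintype V] (K : PreAbstractSimplicialComplex V) (v : V) (hv : {v} ∈ K.faces) :
    Realization K :=
  ⟨Pi.single v 1, single_mem_stdSimplex ℝ v, {v}, hv, by
    intro x hx
    by_contra hne
    exact hx (Pi.single_eq_of_ne (by simpa using hne) _)⟩

/-- `T` is a triangulation of the closed surface `S`: it is a finite simplicial complex, all of whose
maximal faces are triangles, in which each edge is a side of exactly two triangles, and its
realization is homeomorphic to `S`. -/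
structure IsTriangulation [Fintype V] (T : PreAbstractSimplicialComplex V) (S : Type*) [TopologicalSpace S] :
    Prop where
  card_le : ∀ s ∈ T.faces, s.card ≤ 3
  pure : ∀ s ∈ T.faces, ∃ t ∈ T.faces, s ⊆ t ∧ t.card = 3
  two_triangles : ∀ s ∈ T.faces, s.card = 2 → {t ∈ T.faces | s ⊆ t ∧ t.card = 3}.ncard = 2
  homeomorphic : Nonempty (Realization T ≃ₜ S)

/-- The contraction `T/e` of the edge `e = {a, b}`: the vertices `a` and `b` are identified (the
resulting vertex is again called `a`). -/
def contract (T : PreAbstractSimplicialComplex V) (a b : V) : PreAbstractSimplicialComplex V :=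
  T.map (fun v => if v = b then a else v)

lemma singleton_mem_contract {T : PreAbstractSimplicialComplex V} {a b : V}
    (h : {a, b} ∈ T.faces) : {a} ∈ (contract T a b).faces := by
  refine ⟨{a, b}, h, ?_⟩
  ext x
  by_cases hab : a = b <;> simp [hab, eq_comm]

/-- `{a, b}` is a contractible edge of the triangulation `T` of `S`: it is an edge of `T` and its
contraction is again a triangulation of `S`. -/
structure IsContractibleEdge [Fintype V] (T : PreAbstractSimplicialComplex V) (S : Type*) [TopologicalSpace S]
    (a b : V) : Prop where
  ne : a ≠ b
  mem : {a, b} ∈ T.faces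
  contract : IsTriangulation (contract T a b) S

/-- A shortest path embedding with uniqueness of the triangulation `T` into `S`: an embedding of the
triangulation, that is, a homeomorphism `f` from the realization of `T` onto `S`, which draws every
edge as the unique shortest path between its endpoints. -/
def IsUniqueShortestPathEmbedding [Fintype V] (T : PreAbstractSimplicialComplex V) {S : Type*}
    [PseudoEMetricSpace S] (f : Realization T ≃ₜ S) : Prop :=
  ∀ (x y : V) (hx : {x} ∈ T.faces) (hy : {y} ∈ T.faces), x ≠ y → {x, y} ∈ T.faces →
    IsUniqueShortestPathTrace (f (vertexPoint T x hx)) (f (vertexPoint T y hy))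
      (f '' closedFace T {x, y})

end Triangulations

end FlatSurface

end

/-!
The contracted vertex is split locally. In a small neighbourhood of the edges at its image `f w`,
the homeomorphism `f` is changed so that `a` stays at `f w` and `b` is pushed off `f w` by a short
vector `β`; the other vertices do not move. The work is to find a neighbourhood in which this can be
done by an explicit formula, and to see that the new edges at `b` are unique shortest paths.

*Metric preliminaries.* A flat metric on a compact surface gives Euclidean disks of a uniform radius
(`exists_isFlatSpace`), and developing these along rays gives an exponential map `ψ`, a local
isometry from a disk of any prescribed radius in the plane with `ψ 0 = f w`
(`IsFlatSpace.exists_exp`). The shortest path from `p` to `q` is unique exactly if the distance to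
`p` is injective on the set of points `z` with `d(p, z) + d(z, q) = d(p, q)`
(`IsFlatSpace.isUniqueShortestPathTrace_iff`). Hence every edge at `w` lifts to a segment
`[0, v z]`, a spike, on which `ψ` is injective, and different edges have different directions. If
`β` is short, then a shortest path from `ψ β` to `ψ (v z)` stays by compactness near the unique
shortest path from `ψ 0` to `ψ (v z)`. It therefore lifts to the plane, so that it is the image of
the segment `[β, v z]` and is unique (`IsFlatSpace.eventually_isUniqueShortestPathTrace`).

*The neighbourhood.* There is a Lipschitz, positively homogeneous function `N` of the plane with
`N (v z) = 1` for each spike, such that `ψ` is injective near `{N ≤ 1}` and maps `{N < 1}` into the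
open star of `w` (`exists_starGauge`, `exists_isStarGauge`). The set `{N < 1}` is star-shaped, but
in general not convex: it consists of thin neighbourhoods of the spikes. To avoid
the link of `w` near the tip of a spike, it is needed that the edges of the link are shortest paths,
too: there, the link consists of straight rays, none of which runs back along the spike.

*The two sides.* Let `{a, b, c}` and `{a, b, d}` be the two triangles at `{a, b}`. Small punctured
disks are connected, so the link of `w` is connected (`IsFlatSpace.link_connected`). It follows that
`c` and `d` are the only common neighbours of `a` and `b`, and that a face at `w` that comes from
both a face at `a` and a face at `b` is contained in `{w, c}` or `{w, d}`
(`ContractionData.exists_apexes`). The rays through `v c` and `v d` thus separate the faces that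
come from `a` from those that come from `b`. The vector `β` is chosen to point into the side of `b`,
and transversally to both rays in the sense that each parallel to `β` meets their union exactly
once. So points have a height over the two rays, measured in the direction of `β`: in `{N < 1}`,
those of positive height lie only in faces that come from `b`, and those of negative height only in
faces that come from `a` (`IsStarGauge.exists_separating_height`).

*The new map.* A point `x` of `|T|` is collapsed to `|T/e|`; let `ψ p` be the image of the collapsed
point under `f`, and let `s = x b / (x a + x b)` be the share of `b`. Then
`g x = ψ (p + s * max (1 - N p) 0 • β)` near the spikes, and `g x = ψ p` elsewhere (`splitMap`).
Since `s` is `0` below and `1` above the two rays, and `1 - N` has a Lipschitz constant smaller than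
`1` with respect to `β`, the map is monotone along the parallels to `β`. It is therefore injective,
and it is surjective by the intermediate value theorem (`IsHeight.shift_injective`,
`IsHeight.shift_surjective`). As `N` is linear on each spike, the edge from `b` to `z` becomes the
image of the segment `[β, v z]`, the edge `{a, b}` becomes the image of `[0, β]`, and all other
edges remain where they are.
-/

/-! ### Isometric charts -/

namespace FlatSurface

open Set MeasureTheory Manifold

section Charts

variable {S : Type*} [MetricSpace S]
  [ChartedSpace Plane S]
  [Bundle.RiemannianBundle (fun x : S => TangentSpace (𝓡 2) x)]

/-- The differential of the chart `φ` preserves inner products of tangent vectors. -/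
def IsIsometricChart (φ : OpenPartialHomeomorph S Plane) : Prop :=
  φ ∈ IsManifold.maximalAtlas (𝓡 2) ∞ S ∧
    ∀ y ∈ φ.source, ∀ v w : TangentSpace (𝓡 2) y,
      @inner ℝ Plane _ (mfderiv (𝓡 2) (𝓡 2) φ y v) (mfderiv (𝓡 2) (𝓡 2) φ y w) = inner ℝ v w

lemma IsIsometricChart.enorm_mfderiv {φ : OpenPartialHomeomorph S Plane} (h : IsIsometricChart φ)
    {y : S} (hy : y ∈ φ.source) (v : TangentSpace (𝓡 2) y) :
    @enorm Plane _ (mfderiv (𝓡 2) (𝓡 2) φ y v) = ‖v‖ₑ := by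
  have h1 := h.2 y hy v v
  have h2 : @norm Plane _ (mfderiv (𝓡 2) (𝓡 2) φ y v) = ‖v‖ := by
    rw [norm_eq_sqrt_real_inner v, ← h1]
    exact norm_eq_sqrt_real_inner (F := Plane) _
  rw [← ofReal_norm v, ← h2]
  exact (ofReal_norm (E := Plane) _).symm

/-- Inside the domain of an isometric chart, the length of a path is the length of its image. -/
lemma IsIsometricChart.enorm_sub_le_pathELength [IsManifold (𝓡 2) ∞ S]
    {φ : OpenPartialHomeomorph S Plane}
    (h : IsIsometricChart φ) {γ : ℝ → S} (hγ : ContMDiff 𝓘(ℝ, ℝ) (𝓡 2) 1 γ) {t : ℝ} (ht : 0 ≤ t)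
    (hsrc : ∀ s ∈ Icc 0 t, γ s ∈ φ.source) :
    ‖φ (γ t) - φ (γ 0)‖ₑ ≤ pathELength (𝓡 2) γ 0 t := by
  rcases ht.eq_or_lt with rfl | h't
  · simp
  have hφ : ContMDiffOn (𝓡 2) (𝓡 2) ∞ φ φ.source := contMDiffOn_of_mem_maximalAtlas h.1
  set γ' : ℝ → Plane := φ ∘ γ
  have hC : ContMDiffOn 𝓘(ℝ, ℝ) 𝓘(ℝ, Plane) 1 γ' (Icc 0 t) :=
    (hφ.of_le (by simp)).comp hγ.contMDiffOn hsrc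
  calc ‖γ' t - γ' 0‖ₑ
    _ ≤ ∫⁻ t' in Icc 0 t, ‖derivWithin γ' (Icc 0 t) t'‖ₑ := by
      apply enorm_sub_le_lintegral_derivWithin_Icc_of_contDiffOn_Icc _ ht
      rwa [← contMDiffOn_iff_contDiffOn]
    _ = ∫⁻ t' in Icc 0 t, ‖mfderivWithin 𝓘(ℝ, ℝ) (𝓡 2) γ (Icc 0 t) t' 1‖ₑ := by
      apply setLIntegral_congr_fun measurableSet_Icc (fun t' ht' ↦ ?_)
      have h1 : mfderivWithin 𝓘(ℝ, ℝ) 𝓘(ℝ, Plane) γ' (Icc 0 t) t' =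
          (mfderiv (𝓡 2) (𝓡 2) φ (γ t')) ∘L (mfderivWithin 𝓘(ℝ, ℝ) (𝓡 2) γ (Icc 0 t) t') := by
        apply mfderiv_comp_mfderivWithin
        · exact ((hφ _ (hsrc t' ht')).contMDiffAt
            (φ.open_source.mem_nhds (hsrc t' ht'))).mdifferentiableAt (by simp)
        · exact (hγ.mdifferentiable one_ne_zero).mdifferentiableOn _ ht'
        · rw [uniqueMDiffWithinAt_iff_uniqueDiffWithinAt]
          exact uniqueDiffOn_Icc h't _ ht'
      have h2 : mfderivWithin 𝓘(ℝ, ℝ) 𝓘(ℝ, Plane) γ' (Icc 0 t) t' 1 =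
          (mfderiv (𝓡 2) (𝓡 2) φ (γ t')) (mfderivWithin 𝓘(ℝ, ℝ) (𝓡 2) γ (Icc 0 t) t' 1) :=
        congr($h1 1)
      have h3 : derivWithin γ' (Icc 0 t) t' =
          mfderivWithin 𝓘(ℝ, ℝ) 𝓘(ℝ, Plane) γ' (Icc 0 t) t' 1 := by
        rw [← fderivWithin_derivWithin, mfderivWithin_eq_fderivWithin]; rfl
      show ‖derivWithin γ' (Icc 0 t) t'‖ₑ = _
      rw [h3, h2]
      exact h.enorm_mfderiv (hsrc t' ht') _
    _ = pathELength (𝓡 2) γ 0 t := by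
      rw [pathELength_eq_lintegral_mfderivWithin_Icc]

/-- A path that is too short to leave the image of a disk under an isometric chart has its endpoint
in this image. -/
lemma IsIsometricChart.mem_source_of_pathELength_lt [IsManifold (𝓡 2) ∞ S]
    {φ : OpenPartialHomeomorph S Plane} (h : IsIsometricChart φ) {x : S} (hx : x ∈ φ.source)
    {ρ : ℝ} (hρ : 0 < ρ) (hball : Metric.closedBall (φ x) ρ ⊆ φ.target) {γ : ℝ → S}
    (hγ : ContMDiff 𝓘(ℝ, ℝ) (𝓡 2) 1 γ) (hγ0 : γ 0 = x)
    (hlen : pathELength (𝓡 2) γ 0 1 < ENNReal.ofReal ρ) :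
    γ 1 ∈ φ.source ∧ ‖φ (γ 1) - φ x‖ₑ ≤ pathELength (𝓡 2) γ 0 1 := by
  set u : Set S := φ.symm '' Metric.closedBall (φ x) ρ with hu
  have hu_closed : IsClosed u :=
    ((isCompact_closedBall (φ x) ρ).image_of_continuousOn
      (φ.continuousOn_symm.mono hball)).isClosed
  have hu_src : u ⊆ φ.source := by
    rintro _ ⟨p, hp, rfl⟩
    exact φ.map_target (hball hp)
  have key : Icc (0 : ℝ) 1 ⊆ γ ⁻¹' u := by
    have hclosed : IsClosed (γ ⁻¹' u ∩ Icc 0 1) :=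
      (hu_closed.preimage hγ.continuous).inter isClosed_Icc
    have h0 : (0 : ℝ) ∈ γ ⁻¹' u :=
      ⟨φ x, Metric.mem_closedBall_self hρ.le, by rw [φ.left_inv hx, hγ0]⟩
    apply hclosed.Icc_subset_of_forall_mem_nhdsGT_of_Icc_subset h0
    rintro t ⟨ht0, ht1⟩ ht
    have hsrc : ∀ s ∈ Icc 0 t, γ s ∈ φ.source := fun s hs => hu_src (ht hs)
    have h1 := h.enorm_sub_le_pathELength hγ ht0 hsrc
    have h2 : ‖φ (γ t) - φ (γ 0)‖ₑ < ENNReal.ofReal ρ :=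
      (h1.trans (pathELength_mono le_rfl ht1.le)).trans_lt hlen
    have h3 : φ (γ t) ∈ Metric.ball (φ x) ρ := by
      rw [hγ0, ← ofReal_norm, ENNReal.ofReal_lt_ofReal_iff hρ] at h2
      rwa [mem_ball_iff_norm]
    have h4 : ∀ᶠ s in 𝓝 t, φ (γ s) ∈ Metric.ball (φ x) ρ ∧ γ s ∈ φ.source := by
      have hsrct := hsrc t ⟨ht0, le_rfl⟩
      have hc : ContinuousAt (fun s => φ (γ s)) t :=
        (φ.continuousAt hsrct).comp hγ.continuous.continuousAt
      exact (hc.eventually (Metric.isOpen_ball.mem_nhds h3)).and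
        (hγ.continuous.continuousAt.eventually (φ.open_source.mem_nhds hsrct))
    refine mem_nhdsWithin_of_mem_nhds (h4.mono fun s hs => ?_)
    exact ⟨φ (γ s), Metric.ball_subset_closedBall hs.1, φ.left_inv hs.2⟩
  have hsrc : ∀ s ∈ Icc (0 : ℝ) 1, γ s ∈ φ.source := fun s hs => hu_src (key hs)
  refine ⟨hsrc 1 (by simp), ?_⟩
  have := h.enorm_sub_le_pathELength hγ zero_le_one hsrc
  rwa [hγ0] at this

/-- An isometric chart does not increase the distance between `x` and a point that is closer to `x`
than the boundary of the chart: nearly shortest paths between them stay inside the chart. -/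
lemma IsIsometricChart.mem_source_and_dist_le [IsManifold (𝓡 2) ∞ S] [IsRiemannianManifold (𝓡 2) S]
    {φ : OpenPartialHomeomorph S Plane} (h : IsIsometricChart φ) {x y : S} (hx : x ∈ φ.source)
    {ρ : ℝ} (hball : Metric.ball (φ x) ρ ⊆ φ.target) (hy : dist x y < ρ) :
    y ∈ φ.source ∧ dist (φ x) (φ y) ≤ dist x y := by
  have key : ∀ d, dist x y < d → d < ρ → y ∈ φ.source ∧ dist (φ x) (φ y) ≤ d := by
    intro d hd hdρ
    have hd0 : 0 < d := dist_nonneg.trans_lt hd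
    have h1 : riemannianEDist (𝓡 2) x y < ENNReal.ofReal d := by
      rw [← IsRiemannianManifold.out (I := 𝓡 2) x y, edist_dist]
      exact (ENNReal.ofReal_lt_ofReal_iff hd0).2 hd
    obtain ⟨γ, h0, h1', hγ, hlen, -⟩ :=
      exists_lt_locally_constant_of_riemannianEDist_lt h1 zero_lt_one
    obtain ⟨hs, hn⟩ := h.mem_source_of_pathELength_lt hx hd0
      ((Metric.closedBall_subset_ball hdρ).trans hball) hγ h0 hlen
    rw [h1'] at hs hn
    refine ⟨hs, ?_⟩
    have h2 := hn.trans hlen.le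
    rw [← ofReal_norm, ENNReal.ofReal_le_ofReal_iff hd0.le] at h2
    rwa [dist_comm, dist_eq_norm]
  obtain ⟨d, hd, hdρ⟩ := exists_between hy
  refine ⟨(key d hd hdρ).1, le_of_forall_gt_imp_ge_of_dense fun c hc => ?_⟩
  rcases lt_or_ge c ρ with hcρ | hcρ
  · exact (key c hc hcρ).2
  · exact (key d hd hdρ).2.trans (hdρ.le.trans hcρ)

/-- The inverse of an isometric chart does not increase distances along segments. -/
lemma IsIsometricChart.dist_symm_le [IsManifold (𝓡 2) ∞ S] [IsRiemannianManifold (𝓡 2) S]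
    {φ : OpenPartialHomeomorph S Plane} (h : IsIsometricChart φ) {p q : Plane}
    (hpq : segment ℝ p q ⊆ φ.target) :
    dist (φ.symm p) (φ.symm q) ≤ dist p q := by
  have hφ : ContMDiffOn (𝓡 2) (𝓡 2) ∞ φ φ.source := contMDiffOn_of_mem_maximalAtlas h.1
  have hφs : ContMDiffOn (𝓡 2) (𝓡 2) ∞ φ.symm φ.target :=
    contMDiffOn_symm_of_mem_maximalAtlas h.1
  let η := ContinuousAffineMap.lineMap (R := ℝ) p q
  set γ := φ.symm ∘ η
  have hη : ∀ t ∈ Icc (0 : ℝ) 1, η t ∈ φ.target := by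
    intro t ht
    apply hpq
    rw [segment_eq_image_lineMap]
    exact ⟨t, ht, by simp [η, ContinuousAffineMap.coe_lineMap_eq]⟩
  have η_smooth : ContMDiffOn 𝓘(ℝ, ℝ) (𝓡 2) 1 η (Icc 0 1) := by
    apply ContMDiff.contMDiffOn
    rw [contMDiff_iff_contDiff]
    exact ContinuousAffineMap.contDiff _
  have h1 : riemannianEDist (𝓡 2) (φ.symm p) (φ.symm q) ≤ pathELength (𝓡 2) γ 0 1 := by
    apply riemannianEDist_le_pathELength _ _ _ zero_le_one
    · exact (hφs.of_le (by simp)).comp η_smooth hη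
    · simp [γ, η, ContinuousAffineMap.coe_lineMap_eq]
    · simp [γ, η, ContinuousAffineMap.coe_lineMap_eq]
  have h2 : pathELength (𝓡 2) γ 0 1 = edist p q := by
    rw [← lintegral_fderiv_lineMap_eq_edist, pathELength_eq_lintegral_mfderivWithin_Icc]
    apply setLIntegral_congr_fun measurableSet_Icc (fun t ht ↦ ?_)
    have hsrc : φ.symm (η t) ∈ φ.source := φ.map_target (hη t ht)
    have hd : MDifferentiableAt (𝓡 2) (𝓡 2) φ (γ t) :=
      ((hφ _ hsrc).contMDiffAt (φ.open_source.mem_nhds hsrc)).mdifferentiableAt (by simp)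
    have hds : MDifferentiableAt (𝓡 2) (𝓡 2) φ.symm (η t) :=
      ((hφs _ (hη t ht)).contMDiffAt (φ.open_target.mem_nhds (hη t ht))).mdifferentiableAt (by simp)
    have hdη := η_smooth.mdifferentiableOn one_ne_zero t ht
    have hud : UniqueMDiffWithinAt 𝓘(ℝ, ℝ) (Icc (0 : ℝ) 1) t := by
      rw [uniqueMDiffWithinAt_iff_uniqueDiffWithinAt]
      exact uniqueDiffOn_Icc zero_lt_one t ht
    have hdγ : MDifferentiableWithinAt 𝓘(ℝ, ℝ) (𝓡 2) γ (Icc 0 1) t :=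
      hds.comp_mdifferentiableWithinAt t hdη
    have e1 : mfderivWithin 𝓘(ℝ, ℝ) (𝓡 2) (φ ∘ γ) (Icc 0 1) t =
        (mfderiv (𝓡 2) (𝓡 2) φ (γ t)) ∘L (mfderivWithin 𝓘(ℝ, ℝ) (𝓡 2) γ (Icc 0 1) t) :=
      mfderiv_comp_mfderivWithin t hd hdγ hud
    have e2 : mfderivWithin 𝓘(ℝ, ℝ) (𝓡 2) (φ ∘ γ) (Icc 0 1) t =
        mfderivWithin 𝓘(ℝ, ℝ) (𝓡 2) η (Icc 0 1) t := by
      apply mfderivWithin_congr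
      · intro s hs
        exact φ.right_inv (hη s hs)
      · exact φ.right_inv (hη t ht)
    have e3 : mfderivWithin 𝓘(ℝ, ℝ) (𝓡 2) η (Icc 0 1) t 1 =
        (mfderiv (𝓡 2) (𝓡 2) φ (γ t)) (mfderivWithin 𝓘(ℝ, ℝ) (𝓡 2) γ (Icc 0 1) t 1) := by
      rw [← e2]; exact congr($e1 1)
    have e4 := h.enorm_mfderiv hsrc (mfderivWithin 𝓘(ℝ, ℝ) (𝓡 2) γ (Icc 0 1) t 1)
    show ‖mfderivWithin 𝓘(ℝ, ℝ) (𝓡 2) γ (Icc 0 1) t 1‖ₑ = ‖fderivWithin ℝ η (Icc 0 1) t 1‖ₑ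
    rw [← e4, ← mfderivWithin_eq_fderivWithin]
    exact congrArg (fun v : Plane => ‖v‖ₑ) e3.symm
  rw [h2, ← IsRiemannianManifold.out (I := 𝓡 2)] at h1
  rwa [edist_dist, edist_dist, ENNReal.ofReal_le_ofReal_iff dist_nonneg] at h1

end Charts

/-- The map `ψ` sends the open disk of radius `r` about `p` isometrically onto the open ball of
radius `r` about `ψ p`. -/
structure IsIsometricDisk {S : Type*} [MetricSpace S] (ψ : Plane → S) (p : Plane) (r : ℝ) :
    Prop where
  dist_eq : ∀ x ∈ Metric.ball p r, ∀ y ∈ Metric.ball p r, dist (ψ x) (ψ y) = dist x y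
  image_eq : ψ '' Metric.ball p r = Metric.ball (ψ p) r

section

variable {S : Type*} [MetricSpace S] [ChartedSpace Plane S]
  [Bundle.RiemannianBundle (fun x : S => TangentSpace (𝓡 2) x)] [IsRiemannianManifold (𝓡 2) S]

/-- A surface with a flat Riemannian metric is locally isometric to the Euclidean plane as a metric
space. -/
lemma exists_isIsometricDisk [IsManifold (𝓡 2) ∞ S] (hflat : IsFlat S) (x : S) :
    ∃ r > 0, ∃ ψ : Plane → S, ∃ p, ψ p = x ∧ IsIsometricDisk ψ p r := by
  obtain ⟨φ, hφ, hx, hiso⟩ := hflat x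
  have h : IsIsometricChart φ := ⟨hφ, hiso⟩
  obtain ⟨R, hR, hball⟩ := Metric.isOpen_iff.1 φ.open_target _ (φ.map_source hx)
  have key : ∀ p ∈ Metric.ball (φ x) (R / 3), ∀ q ∈ Metric.ball (φ x) (R / 3),
      dist (φ.symm p) (φ.symm q) = dist p q := by
    intro p hp q hq
    have hsub : Metric.ball (φ x) (R / 3) ⊆ φ.target :=
      (Metric.ball_subset_ball (by linarith)).trans hball
    have hle : dist (φ.symm p) (φ.symm q) ≤ dist p q :=
      h.dist_symm_le (((convex_ball _ _).segment_subset hp hq).trans hsub)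
    have hpq : dist p q < 2 * (R / 3) := by
      have := dist_triangle_right p q (φ x)
      rw [Metric.mem_ball] at hp hq
      linarith
    have hb : Metric.ball (φ (φ.symm p)) (2 * (R / 3)) ⊆ φ.target := by
      rw [φ.right_inv (hsub hp)]
      refine (Metric.ball_subset_ball' ?_).trans hball
      rw [Metric.mem_ball] at hp
      linarith
    have := (h.mem_source_and_dist_le (φ.map_target (hsub hp)) hb (hle.trans_lt hpq)).2
    rw [φ.right_inv (hsub hp), φ.right_inv (hsub hq)] at this
    exact le_antisymm hle this
  have hc : φ x ∈ Metric.ball (φ x) (R / 3) := Metric.mem_ball_self (by linarith)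
  refine ⟨R / 3, by positivity, φ.symm, φ x, φ.left_inv hx, key, ?_⟩
  apply subset_antisymm
  · rintro _ ⟨p, hp, rfl⟩
    rw [Metric.mem_ball, key p hp _ hc]
    exact hp
  · intro y hy
    rw [φ.left_inv hx, Metric.mem_ball, dist_comm] at hy
    obtain ⟨h1, h2⟩ := h.mem_source_and_dist_le hx
      ((Metric.ball_subset_ball (by linarith)).trans hball) hy
    exact ⟨φ y, by rw [Metric.mem_ball, dist_comm]; exact h2.trans_lt hy, φ.left_inv h1⟩

/-- Points dividing the distance between `x` and `y` in a given way exist up to an arbitrarily small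
error. -/
lemma exists_dist_eq_and_dist_lt (x y : S) {δ ε : ℝ} (h0 : 0 ≤ δ) (h1 : δ ≤ dist x y)
    (hε : 0 < ε) : ∃ m : S, dist x m = δ ∧ dist m y < dist x y - δ + ε := by
  have hpos : 0 < dist x y + ε := by positivity
  have hr : riemannianEDist (𝓡 2) x y < ENNReal.ofReal (dist x y + ε) := by
    rw [← IsRiemannianManifold.out (I := 𝓡 2) x y, edist_dist]
    exact (ENNReal.ofReal_lt_ofReal_iff hpos).2 (by linarith)
  obtain ⟨γ, hγ0, hγ1, hγ, hlen, -⟩ :=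
    exists_lt_locally_constant_of_riemannianEDist_lt hr zero_lt_one
  have hc : ContinuousOn (fun t => dist x (γ t)) (Icc 0 1) :=
    (continuous_const.dist hγ.continuous).continuousOn
  obtain ⟨t, ht, hδ⟩ := intermediate_value_Icc zero_le_one hc
    (show δ ∈ Icc (dist x (γ 0)) (dist x (γ 1)) by rw [hγ0, hγ1, dist_self]; exact ⟨h0, h1⟩)
  refine ⟨γ t, hδ, ?_⟩
  have e1 : edist x (γ t) ≤ pathELength (𝓡 2) γ 0 t := by
    rw [IsRiemannianManifold.out (I := 𝓡 2)]
    exact riemannianEDist_le_pathELength hγ.contMDiffOn hγ0 rfl ht.1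
  have e2 : edist (γ t) y ≤ pathELength (𝓡 2) γ t 1 := by
    rw [IsRiemannianManifold.out (I := 𝓡 2)]
    exact riemannianEDist_le_pathELength hγ.contMDiffOn rfl hγ1 ht.2
  have e3 := (add_le_add e1 e2).trans_eq (pathELength_add ht.1 ht.2)
  have e4 := e3.trans_lt hlen
  rw [edist_dist, edist_dist, ← ENNReal.ofReal_add dist_nonneg dist_nonneg,
    ENNReal.ofReal_lt_ofReal_iff hpos] at e4
  simp only at hδ
  linarith

end
end FlatSurface

/-! ### Distance preserving maps of the plane -/

namespace FlatSurface

open Set Metric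

section PlaneIsometries

/-- A distance preserving map from a disk into the plane is the restriction of a rigid motion. -/
lemma exists_linearIsometryEquiv_of_dist_eq {θ : Plane → Plane} {p : Plane} {r : ℝ} (hr : 0 < r)
    (h : ∀ x ∈ ball p r, ∀ y ∈ ball p r, dist (θ x) (θ y) = dist x y) :
    ∃ L : Plane ≃ₗᵢ[ℝ] Plane, ∀ x ∈ ball p r, θ x = L (x - p) + θ p := by
  have hp : p ∈ ball p r := mem_ball_self hr
  have hin : ∀ x ∈ ball p r, ∀ y ∈ ball p r,
      inner ℝ (θ x - θ p) (θ y - θ p) = inner ℝ (x - p) (y - p) := by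
    intro x hx y hy
    rw [real_inner_eq_norm_mul_self_add_norm_mul_self_sub_norm_sub_mul_self_div_two,
      real_inner_eq_norm_mul_self_add_norm_mul_self_sub_norm_sub_mul_self_div_two,
      sub_sub_sub_cancel_right, sub_sub_sub_cancel_right]
    simp only [← dist_eq_norm, h x hx y hy, h x hx p hp, h y hy p hp]
  set e := EuclideanSpace.basisFun (Fin 2) ℝ
  have hs : (r / 2) ≠ 0 := by positivity
  have hmem : ∀ i, p + (r / 2) • e i ∈ ball p r := by
    intro i
    rw [mem_ball_iff_norm, add_sub_cancel_left, norm_smul, e.orthonormal.1 i, mul_one,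
      Real.norm_of_nonneg (by positivity)]
    linarith
  set f : Fin 2 → Plane := fun i => (r / 2)⁻¹ • (θ (p + (r / 2) • e i) - θ p)
  have hfin : ∀ x ∈ ball p r, ∀ i, inner ℝ (f i) (θ x - θ p) = inner ℝ (e i) (x - p) := by
    intro x hx i
    simp only [f]
    rw [real_inner_smul_left, hin _ (hmem i) x hx, add_sub_cancel_left, real_inner_smul_left,
      ← mul_assoc, inv_mul_cancel₀ hs, one_mul]
  have hf : Orthonormal ℝ f := by
    rw [orthonormal_iff_ite]
    intro i j
    have h1 := hfin _ (hmem j) i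
    rw [add_sub_cancel_left, real_inner_smul_right, orthonormal_iff_ite.1 e.orthonormal i j] at h1
    simp only [f] at h1 ⊢
    rw [real_inner_smul_right, h1, ← mul_assoc, inv_mul_cancel₀ hs, one_mul]
  have hcard : Fintype.card (Fin 2) = Module.finrank ℝ Plane := by simp
  set b := basisOfOrthonormalOfCardEqFinrank hf hcard with hb
  have hbf : ⇑b = f := coe_basisOfOrthonormalOfCardEqFinrank hf hcard
  set f' : OrthonormalBasis (Fin 2) ℝ Plane := b.toOrthonormalBasis (by rw [hbf]; exact hf)
  have hf' : ∀ i, f' i = f i := fun i => by simp [f', hbf]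
  refine ⟨e.equiv f' (Equiv.refl _), fun x hx => ?_⟩
  rw [← sub_eq_iff_eq_add]
  apply f'.repr.injective
  ext i
  rw [f'.repr_apply_apply, f'.repr_apply_apply, hf', hfin x hx i, ← hf',
    show f' i = e.equiv f' (Equiv.refl _) (e i) by simp,
    LinearIsometryEquiv.inner_map_map]

/-- A distance preserving map from a set of real numbers to the plane is affine. -/
lemma dist_eq_affine_of_dist_eq {J : Set ℝ} {σ : ℝ → Plane} {T : ℝ}
    (h : ∀ s ∈ J, ∀ t ∈ J, dist (σ s) (σ t) = |s - t|) (hT : T ∈ J) :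
    ∃ e : Plane, ‖e‖ = 1 ∧ ∀ t ∈ J, σ t = σ T + (t - T) • e := by
  by_cases hJ : ∃ t₁ ∈ J, t₁ ≠ T
  · obtain ⟨t₁, ht₁, hne⟩ := hJ
    have hne' : t₁ - T ≠ 0 := sub_ne_zero.2 hne
    have hn : ∀ t ∈ J, ‖σ t - σ T‖ = |t - T| := fun t ht => by
      rw [← dist_eq_norm, h t ht T hT]
    refine ⟨(t₁ - T)⁻¹ • (σ t₁ - σ T), ?_, fun t ht => ?_⟩
    · rw [norm_smul, hn t₁ ht₁, Real.norm_eq_abs, abs_inv, inv_mul_cancel₀ (abs_ne_zero.2 hne')]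
    · have h1 : inner ℝ (σ t - σ T) (σ t₁ - σ T) = (t - T) * (t₁ - T) := by
        rw [real_inner_eq_norm_mul_self_add_norm_mul_self_sub_norm_sub_mul_self_div_two,
          sub_sub_sub_cancel_right, hn t ht, hn t₁ ht₁, ← dist_eq_norm, h t ht t₁ ht₁,
          abs_mul_abs_self, abs_mul_abs_self, abs_mul_abs_self]
        ring
      have h2 : ‖(σ t - σ T) - (t - T) • ((t₁ - T)⁻¹ • (σ t₁ - σ T))‖ ^ 2 = 0 := by
        rw [norm_sub_sq_real, real_inner_smul_right, real_inner_smul_right, h1, norm_smul,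
          norm_smul, hn t ht, hn t₁ ht₁, Real.norm_eq_abs, Real.norm_eq_abs, abs_inv,
          inv_mul_cancel₀ (abs_ne_zero.2 hne'), mul_one, sq_abs, inv_mul_eq_div]
        field_simp
        ring
      have h3 := sub_eq_zero.1 (norm_eq_zero.1 (pow_eq_zero_iff two_ne_zero |>.1 h2))
      rw [← h3]; abel
  · push Not at hJ
    obtain ⟨e, he⟩ := exists_norm_eq Plane (zero_le_one (α := ℝ))
    exact ⟨e, he, fun t ht => by rw [hJ t ht]; simp⟩

/-- A Lipschitz bound for a curve that holds locally at every parameter holds globally. -/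
lemma dist_le_of_locally_dist_le {X : Type*} [PseudoMetricSpace X] {σ : ℝ → X} {a b C : ℝ}
    (hab : a ≤ b) (hC : 0 ≤ C)
    (h : ∀ t ∈ Icc a b, ∃ ε > 0, ∀ s ∈ Icc a b, |s - t| < ε → dist (σ t) (σ s) ≤ C * |s - t|) :
    dist (σ a) (σ b) ≤ C * (b - a) := by
  have hcont : ContinuousOn σ (Icc a b) := by
    intro t ht
    obtain ⟨ε, hε, hs⟩ := h t ht
    rw [Metric.continuousWithinAt_iff]
    intro η hη
    refine ⟨min ε (η / (C + 1)), by positivity, fun s hsI hd => ?_⟩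
    rw [Real.dist_eq] at hd
    have h1 := hs s hsI (hd.trans_le (min_le_left _ _))
    have h2 : |s - t| * (C + 1) < η := by
      rw [← lt_div_iff₀ (by positivity)]
      exact hd.trans_le (min_le_right _ _)
    rw [dist_comm]
    nlinarith [abs_nonneg (s - t)]
  set A : Set ℝ := {t | dist (σ a) (σ t) ≤ C * (t - a)}
  have hclosed : IsClosed (A ∩ Icc a b) := by
    have : A ∩ Icc a b = {t ∈ Icc a b | dist (σ a) (σ t) ≤ C * (t - a)} := by
      ext t; exact and_comm
    rw [this]
    exact isClosed_Icc.isClosed_le (by fun_prop) (by fun_prop)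
  have hsub : Icc a b ⊆ A := by
    apply hclosed.Icc_subset_of_forall_mem_nhdsWithin (by simp [A])
    rintro t ⟨htA, hta, htb⟩
    obtain ⟨ε, hε, hs⟩ := h t ⟨hta, htb.le⟩
    have : Ioo t (min b (t + ε)) ∈ 𝓝[>] t :=
      Ioo_mem_nhdsGT (lt_min htb (by linarith))
    refine Filter.mem_of_superset this fun s hs' => ?_
    have h1 : s < b := hs'.2.trans_le (min_le_left _ _)
    have h2 : s < t + ε := hs'.2.trans_le (min_le_right _ _)
    have h3 := hs s ⟨hta.trans hs'.1.le, h1.le⟩ (by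
      rw [abs_of_pos (by linarith [hs'.1])]; linarith)
    rw [abs_of_pos (by linarith [hs'.1])] at h3
    have h4 := dist_triangle (σ a) (σ t) (σ s)
    simp only [A, mem_ofPred_eq] at htA ⊢
    linarith
  exact hsub ⟨hab, le_rfl⟩

end PlaneIsometries

end FlatSurface

/-! ### Flat spaces -/

namespace FlatSurface

open Set Metric

section FlatSpaces

variable {S : Type*} [MetricSpace S]

/-- A curve that is parametrized by arc length and realizes the distance between its points. -/
def IsGeodesic (c : ℝ → S) (D : ℝ) : Prop :=
  ∀ s ∈ Icc 0 D, ∀ t ∈ Icc 0 D, dist (c s) (c t) = |s - t|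

/-- The map `ψ` is isometric near the point `p`. -/
def IsLocallyIsometricAt (ψ : Plane → S) (p : Plane) : Prop :=
  ∃ ε > 0, ∀ x ∈ ball p ε, ∀ y ∈ ball p ε, dist (ψ x) (ψ y) = dist x y

/-- A metric space whose balls of some fixed radius `r` are Euclidean disks, and in which distances
can be divided in any given way. These are the properties of compact flat surfaces that matter. -/
structure IsFlatSpace (S : Type*) [MetricSpace S] (r : ℝ) : Prop where
  pos : 0 < r
  disk : ∀ x : S, ∃ ψ : Plane → S, ∃ p, ψ p = x ∧ IsIsometricDisk ψ p r
  between : ∀ (x y : S) (δ : ℝ), 0 ≤ δ → δ ≤ dist x y → ∃ m, dist x m = δ ∧ dist m y = dist x y - δ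

lemma IsIsometricDisk.mono {ψ : Plane → S} {p q : Plane} {r s : ℝ} (h : IsIsometricDisk ψ p r)
    (hs : 0 < s) (hq : dist q p + s ≤ r) : IsIsometricDisk ψ q s := by
  have hsub : ball q s ⊆ ball p r := ball_subset_ball' (by linarith)
  have hqp : q ∈ ball p r := hsub (mem_ball_self hs)
  refine ⟨fun x hx y hy => h.dist_eq x (hsub hx) y (hsub hy), subset_antisymm ?_ ?_⟩
  · rintro _ ⟨x, hx, rfl⟩
    rw [mem_ball, h.dist_eq x (hsub hx) q hqp]
    exact hx
  · intro y hy
    have hpr : p ∈ ball p r := mem_ball_self (by linarith [dist_nonneg (x := q) (y := p)])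
    have hyp : y ∈ ball (ψ p) r := by
      rw [mem_ball] at hy ⊢
      have := dist_triangle y (ψ q) (ψ p)
      rw [h.dist_eq q hqp p hpr] at this
      linarith
    rw [← h.image_eq] at hyp
    obtain ⟨x, hx, rfl⟩ := hyp
    rw [mem_ball, h.dist_eq x hx q hqp] at hy
    exact ⟨x, hy, rfl⟩

lemma IsIsometricDisk.injOn {ψ : Plane → S} {p : Plane} {r : ℝ} (h : IsIsometricDisk ψ p r) :
    InjOn ψ (ball p r) := by
  intro x hx y hy hxy
  rw [← dist_eq_zero, ← h.dist_eq x hx y hy, hxy, dist_self]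

lemma IsIsometricDisk.isLocallyIsometricAt {ψ : Plane → S} {p q : Plane} {r : ℝ}
    (h : IsIsometricDisk ψ p r) (hq : q ∈ ball p r) : IsLocallyIsometricAt ψ q := by
  obtain ⟨ε, hε, hsub⟩ := Metric.isOpen_iff.1 isOpen_ball q hq
  exact ⟨ε, hε, fun x hx y hy => h.dist_eq x (hsub hx) y (hsub hy)⟩

/-- An isometric disk may be reparametrized by a rigid motion of the plane. -/
lemma IsIsometricDisk.comp_affine {ψ : Plane → S} {p q : Plane} {r : ℝ}
    (h : IsIsometricDisk ψ p r) (L : Plane ≃ₗᵢ[ℝ] Plane) :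
    IsIsometricDisk (fun x => ψ (L (x - q) + p)) q r := by
  have hmem : ∀ x, L (x - q) + p ∈ ball p r ↔ x ∈ ball q r := fun x => by
    rw [mem_ball_iff_norm, mem_ball_iff_norm, add_sub_cancel_right, LinearIsometryEquiv.norm_map]
  refine ⟨fun x hx y hy => ?_, ?_⟩
  · rw [h.dist_eq _ ((hmem x).2 hx) _ ((hmem y).2 hy), dist_add_right, LinearIsometryEquiv.dist_map,
      dist_sub_right]
  · simp only [sub_self, map_zero, zero_add]
    rw [← h.image_eq]
    ext y
    constructor
    · rintro ⟨x, hx, rfl⟩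
      exact ⟨_, (hmem x).2 hx, rfl⟩
    · rintro ⟨x, hx, rfl⟩
      have he : L (L.symm (x - p) + q - q) + p = x := by simp
      exact ⟨L.symm (x - p) + q, (hmem _).1 (by rwa [he]), congrArg ψ he⟩

lemma IsLocallyIsometricAt.continuousAt {ψ : Plane → S} {p : Plane}
    (h : IsLocallyIsometricAt ψ p) : ContinuousAt ψ p := by
  obtain ⟨ε, hε, h⟩ := h
  rw [Metric.continuousAt_iff]
  intro η hη
  refine ⟨min ε η, by positivity, fun x hx => ?_⟩
  rw [h x (hx.trans_le (min_le_left _ _)) p (mem_ball_self hε)]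
  exact hx.trans_le (min_le_right _ _)

lemma IsLocallyIsometricAt.congr {ψ φ : Plane → S} {p : Plane}
    (h : IsLocallyIsometricAt ψ p) (he : φ =ᶠ[𝓝 p] ψ) : IsLocallyIsometricAt φ p := by
  obtain ⟨ε, hε, h⟩ := h
  obtain ⟨η, hη, he⟩ := Metric.eventually_nhds_iff_ball.1 he
  refine ⟨min ε η, by positivity, fun x hx y hy => ?_⟩
  rw [he x (ball_subset_ball (min_le_right _ _) hx), he y (ball_subset_ball (min_le_right _ _) hy),
    h x (ball_subset_ball (min_le_left _ _) hx) y (ball_subset_ball (min_le_left _ _) hy)]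

/-- In the coordinates of a disk, a map that is isometric near `q` is a rigid motion near `q`. -/
lemma IsIsometricDisk.exists_eq_comp_affine {χ ψ : Plane → S} {p q : Plane} {r ε : ℝ}
    (hχ : IsIsometricDisk χ p r) (hε : 0 < ε) (hεr : ε ≤ r)
    (hψ : ∀ x ∈ ball q ε, ∀ y ∈ ball q ε, dist (ψ x) (ψ y) = dist x y) (hq : ψ q = χ p) :
    ∃ L : Plane ≃ₗᵢ[ℝ] Plane, ∀ x ∈ ball q ε, ψ x = χ (L (x - q) + p) := by
  have hqq := mem_ball_self (x := q) hε
  have hex : ∀ x ∈ ball q ε, ∃ y ∈ ball p r, χ y = ψ x := by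
    intro x hx
    have : ψ x ∈ ball (χ p) r := by
      rw [mem_ball, ← hq, hψ x hx q hqq]
      exact lt_of_lt_of_le hx hεr
    rwa [← hχ.image_eq] at this
  choose! θ hθ hχθ using hex
  obtain ⟨L, hL⟩ := exists_linearIsometryEquiv_of_dist_eq (θ := θ) hε (fun x hx y hy => by
    rw [← hχ.dist_eq _ (hθ x hx) _ (hθ y hy), hχθ x hx, hχθ y hy, hψ x hx y hy])
  have hp : θ q = p := hχ.injOn (hθ q hqq) (mem_ball_self (hε.trans_le hεr)) (by rw [hχθ q hqq, hq])
  exact ⟨L, fun x hx => by rw [← hp, ← hL x hx, hχθ x hx]⟩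

variable {r : ℝ}

/-- A local isometry near `q` extends to the disk of radius `r` about `q`. -/
lemma IsFlatSpace.exists_extension (hS : IsFlatSpace S r) {ψ : Plane → S} {q : Plane}
    (hψ : IsLocallyIsometricAt ψ q) :
    ∃ φ : Plane → S, IsIsometricDisk φ q r ∧ φ =ᶠ[𝓝 q] ψ := by
  obtain ⟨ε, hε, h⟩ := hψ
  obtain ⟨χ, p, hp, hχ⟩ := hS.disk (ψ q)
  obtain ⟨L, hL⟩ := hχ.exists_eq_comp_affine (lt_min hε hS.pos) (min_le_right _ _)
    (fun x hx y hy => h x (ball_subset_ball (min_le_left _ _) hx) y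
      (ball_subset_ball (min_le_left _ _) hy)) hp.symm
  refine ⟨_, hχ.comp_affine L, ?_⟩
  filter_upwards [ball_mem_nhds q (lt_min hε hS.pos)] with x hx
  exact (hL x hx).symm

/-- Two local isometries that agree near a point agree on connected open sets containing it. -/
lemma IsFlatSpace.eqOn_of_isPreconnected (hS : IsFlatSpace S r) {ψ φ : Plane → S} {W : Set Plane}
    (hW : IsPreconnected W) (hψ : ∀ x ∈ W, IsLocallyIsometricAt ψ x)
    (hφ : ∀ x ∈ W, IsLocallyIsometricAt φ x) {x₀ : Plane} (hx₀ : x₀ ∈ W) (heq : ψ =ᶠ[𝓝 x₀] φ) :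
    EqOn ψ φ W := by
  set u : Set Plane := {x | ψ =ᶠ[𝓝 x] φ}
  have hu : IsOpen u := isOpen_setOfPred_eventually_nhds
  have hsub : W ⊆ u := by
    refine hW.subset_of_closure_inter_subset hu ⟨x₀, hx₀, heq⟩ ?_
    rintro x ⟨hxc, hxW⟩
    have hx : ψ x = φ x := by
      by_contra hne
      have h1 : ∀ᶠ y in 𝓝 x, ψ y ≠ φ y :=
        ((hψ x hxW).continuousAt.prodMk (hφ x hxW).continuousAt).eventually
          ((isOpen_ne_fun continuous_fst continuous_snd).mem_nhds hne)
      obtain ⟨y, hy, hyu⟩ := mem_closure_iff_nhds.1 hxc _ h1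
      exact hy (Filter.EventuallyEq.eq_of_nhds hyu)
    obtain ⟨ε₁, hε₁, h₁⟩ := hψ x hxW
    obtain ⟨ε₂, hε₂, h₂⟩ := hφ x hxW
    obtain ⟨χ, p, hp, hχ⟩ := hS.disk (ψ x)
    set ε := min (min ε₁ ε₂) r
    have hε : 0 < ε := lt_min (lt_min hε₁ hε₂) hS.pos
    have s1 : ball x ε ⊆ ball x ε₁ := ball_subset_ball ((min_le_left _ _).trans (min_le_left _ _))
    have s2 : ball x ε ⊆ ball x ε₂ := ball_subset_ball ((min_le_left _ _).trans (min_le_right _ _))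
    obtain ⟨L₁, hL₁⟩ := hχ.exists_eq_comp_affine hε (min_le_right _ _)
      (fun a ha b hb => h₁ a (s1 ha) b (s1 hb)) hp.symm
    obtain ⟨L₂, hL₂⟩ := hχ.exists_eq_comp_affine hε (min_le_right _ _)
      (fun a ha b hb => h₂ a (s2 ha) b (s2 hb)) (hx ▸ hp.symm)
    obtain ⟨y, hy, hyu⟩ := mem_closure_iff_nhds.1 hxc _ (ball_mem_nhds x hε)
    have hev : (fun z => L₁ (z - x) + p) =ᶠ[𝓝 y] fun z => L₂ (z - x) + p := by
      have hyu' : ∀ᶠ z in 𝓝 y, ψ z = φ z := hyu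
      filter_upwards [hyu', isOpen_ball.mem_nhds hy] with z hz hzb
      have hzr : ∀ L : Plane ≃ₗᵢ[ℝ] Plane, L (z - x) + p ∈ ball p r := fun L => by
        rw [mem_ball_iff_norm, add_sub_cancel_right, LinearIsometryEquiv.norm_map,
          ← mem_ball_iff_norm]
        exact ball_subset_ball (min_le_right _ _) hzb
      apply hχ.injOn (hzr _) (hzr _)
      rw [← hL₁ z hzb, ← hL₂ z hzb, hz]
    have han : ∀ L : Plane ≃ₗᵢ[ℝ] Plane, AnalyticOnNhd ℝ (fun z => L (z - x) + p) univ :=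
      fun L z _ => (((L.toContinuousLinearEquiv : Plane →L[ℝ] Plane).analyticAt _).comp
        (analyticAt_id.sub analyticAt_const)).add analyticAt_const
    have hall := (han L₁).eq_of_eventuallyEq (han L₂) hev
    filter_upwards [ball_mem_nhds x hε] with z hz
    rw [hL₁ z hz, hL₂ z hz]
    exact congrArg χ (congrFun hall z)
  exact fun x hx => Filter.EventuallyEq.eq_of_nhds (hsub hx)

end FlatSpaces

end FlatSurface

/-! ### The exponential map -/

namespace FlatSurface

open Set Metric

section ExponentialMap

variable {S : Type*} [MetricSpace S] {r : ℝ}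

/-- One step in the construction of the exponential map: a local isometry that is defined on a disk
extends to a larger concentric disk. -/
lemma IsFlatSpace.exists_extension_ball (hS : IsFlatSpace S r) {R : ℝ} (hR : 0 < R)
    {ψ : Plane → S} (hψ : ∀ p ∈ ball (0 : Plane) R, IsLocallyIsometricAt ψ p) :
    ∃ φ : Plane → S, φ 0 = ψ 0 ∧ ∀ p ∈ ball (0 : Plane) (R + r / 2), IsLocallyIsometricAt φ p := by
  have hr := hS.pos
  have hex : ∀ p ∈ ball (0 : Plane) R, ∃ φ : Plane → S, IsIsometricDisk φ p r ∧ φ =ᶠ[𝓝 p] ψ :=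
    fun p hp => hS.exists_extension (hψ p hp)
  have : Nonempty (Plane → S) := ⟨ψ⟩
  choose! Φ hΦ hΦψ using hex
  -- The germs of `ψ` at the points `c • x` with `‖x‖ < R + r / 2` are extended to disks which
  -- contain `x`.
  set c : ℝ := R / (R + r / 2)
  have hc0 : 0 ≤ c := by positivity
  have hc1 : 1 - c = (r / 2) / (R + r / 2) := by simp only [c]; field_simp; ring
  have hcmem : ∀ x ∈ ball (0 : Plane) (R + r / 2),
      c • x ∈ ball (0 : Plane) R ∧ x ∈ ball (c • x) r := by
    intro x hx
    rw [mem_ball_zero_iff] at hx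
    constructor
    · rw [mem_ball_zero_iff, norm_smul, Real.norm_of_nonneg hc0]
      calc c * ‖x‖ < c * (R + r / 2) := by gcongr
        _ = R := by simp only [c]; field_simp
    · rw [mem_ball_iff_norm]
      have : x - c • x = (1 - c) • x := by rw [sub_smul, one_smul]
      rw [this, norm_smul, hc1, Real.norm_of_nonneg (by positivity)]
      calc (r / 2) / (R + r / 2) * ‖x‖ ≤ (r / 2) / (R + r / 2) * (R + r / 2) := by gcongr
        _ = r / 2 := by field_simp
        _ < r := by linarith
  have hloc : ∀ p ∈ ball (0 : Plane) R, ∀ x ∈ ball p r, IsLocallyIsometricAt (Φ p) x :=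
    fun p hp x hx => (hΦ p hp).isLocallyIsometricAt hx
  have hagree : ∀ p ∈ ball (0 : Plane) R, EqOn (Φ p) ψ (ball p r ∩ ball 0 R) := fun p hp =>
    hS.eqOn_of_isPreconnected ((convex_ball p r).inter (convex_ball 0 R)).isPreconnected
      (fun x hx => hloc p hp x hx.1) (fun x hx => hψ x hx.2) ⟨mem_ball_self hr, hp⟩ (hΦψ p hp)
  refine ⟨fun x => Φ (c • x) x, ?_, fun x₀ hx₀ => ?_⟩
  · have h0 : (0 : Plane) ∈ ball (0 : Plane) R := mem_ball_self hR
    simpa using hagree 0 h0 ⟨mem_ball_self hr, h0⟩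
  · obtain ⟨hx₀R, hx₀r⟩ := hcmem x₀ hx₀
    refine (hloc _ hx₀R x₀ hx₀r).congr ?_
    have hcont : ContinuousAt (fun x : Plane => c • x) x₀ := by fun_prop
    filter_upwards [isOpen_ball.mem_nhds hx₀, isOpen_ball.mem_nhds hx₀r,
      hcont.eventually (ball_mem_nhds (c • x₀) hr)] with x hx hxr hxc
    obtain ⟨hxR', hxr'⟩ := hcmem x hx
    refine hS.eqOn_of_isPreconnected (W := ball (c • x) r ∩ ball (c • x₀) r)
      ((convex_ball _ r).inter (convex_ball _ r)).isPreconnected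
      (fun y hy => hloc _ hxR' y hy.1) (fun y hy => hloc _ hx₀R y hy.2)
      (x₀ := c • x) ⟨mem_ball_self hr, hxc⟩ ?_ ⟨hxr', hxr⟩
    filter_upwards [ball_mem_nhds (c • x) hr, isOpen_ball.mem_nhds hxc, isOpen_ball.mem_nhds hxR']
      with y h1 h2 h3
    rw [hagree _ hxR' ⟨h1, h3⟩, hagree _ hx₀R ⟨h2, h3⟩]

/-- The exponential map at `w`, on a disk of arbitrary size. -/
lemma IsFlatSpace.exists_exp (hS : IsFlatSpace S r) (w : S) (R : ℝ) :
    ∃ ψ : Plane → S, ψ 0 = w ∧ ∀ p ∈ ball (0 : Plane) R, IsIsometricDisk ψ p r := by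
  have hr := hS.pos
  have hloc : ∀ n : ℕ, ∃ ψ : Plane → S, ψ 0 = w ∧
      ∀ p ∈ ball (0 : Plane) (r + n * (r / 2)), IsLocallyIsometricAt ψ p := by
    intro n
    induction n with
    | zero =>
      obtain ⟨χ, p, hp, hχ⟩ := hS.disk w
      refine ⟨_, ?_, fun q hq => (hχ.comp_affine (q := 0)
        (LinearIsometryEquiv.refl ℝ Plane)).isLocallyIsometricAt (by simpa using hq)⟩
      simpa using hp
    | succ n ih =>
      obtain ⟨ψ, h0, hψ⟩ := ih
      obtain ⟨φ, hφ0, hφ⟩ := hS.exists_extension_ball (by positivity) hψ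
      refine ⟨φ, hφ0.trans h0, fun p hp => hφ p ?_⟩
      convert! hp using 2
      push_cast; ring
  obtain ⟨n, hn⟩ := exists_nat_gt (R / (r / 2))
  rw [div_lt_iff₀ (by positivity)] at hn
  obtain ⟨ψ, h0, hψ⟩ := hloc n
  refine ⟨ψ, h0, fun p hp => ?_⟩
  have hsub : ball p r ⊆ ball (0 : Plane) (r + n * (r / 2)) := by
    refine ball_subset_ball' ?_
    rw [mem_ball] at hp
    linarith
  obtain ⟨φ, hφ, heq⟩ := hS.exists_extension (hψ p (hsub (mem_ball_self hr)))
  have heqOn : EqOn φ ψ (ball p r) := hS.eqOn_of_isPreconnected (convex_ball p r).isPreconnected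
    (fun x hx => hφ.isLocallyIsometricAt hx) (fun x hx => hψ x (hsub hx)) (mem_ball_self hr) heq
  refine ⟨fun x hx y hy => ?_, ?_⟩
  · rw [← heqOn hx, ← heqOn hy, hφ.dist_eq x hx y hy]
  · rw [← heqOn (mem_ball_self hr), ← hφ.image_eq]
    exact (heqOn.image_eq).symm

/-- A geodesic through the centre of a disk is a straight segment in this disk. -/
lemma IsIsometricDisk.exists_eq_of_isGeodesic {ψ : Plane → S} {p : Plane} {c : ℝ → S} {D T : ℝ}
    (h : IsIsometricDisk ψ p r) (hc : IsGeodesic c D) (hT : T ∈ Icc 0 D) (hcT : c T = ψ p)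
    (hr : 0 < r) :
    ∃ e : Plane, ‖e‖ = 1 ∧ ∀ t ∈ Icc 0 D, |t - T| < r → c t = ψ (p + (t - T) • e) := by
  set J : Set ℝ := {t | t ∈ Icc 0 D ∧ |t - T| < r}
  have hex : ∀ t ∈ J, ∃ x ∈ ball p r, ψ x = c t := by
    rintro t ⟨ht, htr⟩
    have : c t ∈ ball (ψ p) r := by
      rw [mem_ball, ← hcT, hc t ht T hT]; exact htr
    rwa [← h.image_eq] at this
  choose! σ hσ hψσ using hex
  have hTJ : T ∈ J := ⟨hT, by simpa using hr⟩
  obtain ⟨e, he, heq⟩ := dist_eq_affine_of_dist_eq (J := J) (σ := σ) (T := T) (fun s hs t ht => by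
    rw [← h.dist_eq _ (hσ s hs) _ (hσ t ht), hψσ s hs, hψσ t ht, hc s hs.1 t ht.1]) hTJ
  have hσT : σ T = p := h.injOn (hσ T hTJ) (mem_ball_self hr) (by rw [hψσ T hTJ, hcT])
  refine ⟨e, he, fun t ht htr => ?_⟩
  rw [← hψσ t ⟨ht, htr⟩, heq t ⟨ht, htr⟩, hσT]

/-- Geodesics that start at `ψ 0` are the images under the exponential map `ψ` of segments that
start at the origin. -/
lemma exists_eq_exp_of_isGeodesic {ψ : Plane → S} {R D : ℝ} {c : ℝ → S} (hr : 0 < r)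
    (hψ : ∀ p ∈ ball (0 : Plane) R, IsIsometricDisk ψ p r) (hc : IsGeodesic c D) (hD : 0 ≤ D)
    (hDR : D < R) (hc0 : c 0 = ψ 0) :
    ∃ e : Plane, ‖e‖ = 1 ∧ ∀ t ∈ Icc 0 D, c t = ψ (t • e) := by
  have hstep : ∀ n : ℕ, ∃ e : Plane, ‖e‖ = 1 ∧ ∀ t ∈ Icc 0 D, t < (n + 1) * (r / 2) →
      c t = ψ (t • e) := by
    intro n
    induction n with
    | zero =>
      obtain ⟨e, he, h⟩ := (hψ 0 (mem_ball_self (hD.trans_lt hDR))).exists_eq_of_isGeodesic hc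
        ⟨le_rfl, hD⟩ hc0 hr
      refine ⟨e, he, fun t ht htr => ?_⟩
      have := h t ht (by rw [sub_zero, abs_of_nonneg ht.1]; norm_num at htr; linarith)
      simpa using this
    | succ n ih =>
      obtain ⟨e, he, h⟩ := ih
      set s : ℝ := (n + 1 / 2 : ℝ) * (r / 2)
      have hs0 : 0 < s := by positivity
      by_cases hsD : s ≤ D
      · have hsI : s ∈ Icc 0 D := ⟨hs0.le, hsD⟩
        have hball : s • e ∈ ball (0 : Plane) R := by
          rw [mem_ball_zero_iff, norm_smul, he, mul_one, Real.norm_of_nonneg hs0.le]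
          linarith
        have hcs : c s = ψ (s • e) := h s hsI (by simp only [s]; nlinarith)
        obtain ⟨e', he', h'⟩ := (hψ _ hball).exists_eq_of_isGeodesic hc hsI hcs hr
        have hee : e' = e := by
          -- Compare both descriptions of `c` at a point shortly before `s`.
          have hpI : s - r / 4 ∈ Icc 0 D := by
            constructor
            · have : (0 : ℝ) ≤ n := n.cast_nonneg
              simp only [s]; nlinarith
            · linarith
          have h1 := h _ hpI (by simp only [s]; nlinarith)
          have hlt : |s - r / 4 - s| < r := by
            rw [sub_sub_cancel_left, abs_neg, abs_of_pos (by positivity)]; linarith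
          rw [h' _ hpI hlt] at h1
          have hn : ∀ e'' : Plane, ‖e''‖ = 1 → s • e + (s - r / 4 - s) • e'' ∈ ball (s • e) r := by
            intro e'' he''
            rw [mem_ball_iff_norm, add_sub_cancel_left, norm_smul, he'', mul_one]
            exact hlt
          have h2 : (s - r / 4) • e = s • e + (s - r / 4 - s) • e := by
            rw [← add_smul]; congr 1; ring
          rw [h2] at h1
          have h3 := add_left_cancel ((hψ _ hball).injOn (hn e' he') (hn e he) h1)
          exact smul_right_injective Plane (by linarith : s - r / 4 - s ≠ 0) h3
        refine ⟨e, he, fun t ht htr => ?_⟩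
        rcases lt_or_ge t s with hts | hts
        · exact h t ht (by simp only [s] at hts; nlinarith)
        · rw [h' t ht (by
            rw [abs_of_nonneg (by linarith)]; push_cast at htr; simp only [s]; nlinarith), hee,
            ← add_smul]
          congr 2; ring
      · refine ⟨e, he, fun t ht _ => h t ht ?_⟩
        have := ht.2
        simp only [s] at hsD
        nlinarith
  obtain ⟨n, hn⟩ := exists_nat_gt (D / (r / 2))
  rw [div_lt_iff₀ (by positivity)] at hn
  obtain ⟨e, he, h⟩ := hstep n
  exact ⟨e, he, fun t ht => h t ht (by nlinarith [ht.2])⟩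

end ExponentialMap

end FlatSurface

/-! ### Geodesics and shortest paths -/

namespace FlatSurface

open Set Metric

section Geodesics

variable {S : Type*} [MetricSpace S] {r : ℝ}

lemma IsGeodesic.continuousOn {c : ℝ → S} {D : ℝ} (hc : IsGeodesic c D) :
    ContinuousOn c (Icc 0 D) := by
  rw [Metric.continuousOn_iff]
  intro b hb ε hε
  exact ⟨ε, hε, fun a ha hab => by rwa [hc a ha b hb]⟩

/-- Two geodesics that fit together and whose lengths add up to the distance of the endpoints can be
concatenated. -/
lemma exists_isGeodesic_trans {x m y : S} (hm : dist x m + dist m y = dist x y)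
    {c₁ c₂ : ℝ → S} (h₁ : IsGeodesic c₁ (dist x m)) (h₂ : IsGeodesic c₂ (dist m y))
    (h₁0 : c₁ 0 = x) (h₁1 : c₁ (dist x m) = m) (h₂0 : c₂ 0 = m) (h₂1 : c₂ (dist m y) = y) :
    ∃ c : ℝ → S, c 0 = x ∧ c (dist x y) = y ∧ IsGeodesic c (dist x y) ∧ c (dist x m) = m := by
  set δ := dist x m with hδ
  have hδ0 : 0 ≤ δ := dist_nonneg
  have hD0 : 0 ≤ dist m y := dist_nonneg
  set c : ℝ → S := fun t => if t ≤ δ then c₁ t else c₂ (t - δ) with hc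
  have hc1 : ∀ t, t ≤ δ → c t = c₁ t := fun t ht => if_pos ht
  have hc2 : ∀ t, δ ≤ t → c t = c₂ (t - δ) := by
    intro t ht
    rcases ht.eq_or_lt with rfl | ht
    · rw [hc1 _ le_rfl, h₁1, sub_self, h₂0]
    · exact if_neg (not_le.2 ht)
  have hx : c 0 = x := by rw [hc1 0 hδ0, h₁0]
  have hy : c (dist x y) = y := by rw [hc2 _ (by linarith), ← hm, add_sub_cancel_left, h₂1]
  have key : ∀ s ∈ Icc 0 (dist x y), ∀ t ∈ Icc 0 (dist x y), s ≤ t → dist (c s) (c t) = t - s := by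
    intro s hs t ht hst
    rcases le_total t δ with htδ | htδ
    · rw [hc1 s (hst.trans htδ), hc1 t htδ, h₁ s ⟨hs.1, hst.trans htδ⟩ t ⟨ht.1, htδ⟩, abs_sub_comm,
        abs_of_nonneg (by linarith)]
    · have htI : t - δ ∈ Icc 0 (dist m y) := ⟨by linarith, by linarith [ht.2]⟩
      rcases le_total δ s with hsδ | hsδ
      · rw [hc2 s hsδ, hc2 t htδ, h₂ _ ⟨by linarith, by linarith [hs.2]⟩ _ htI, abs_sub_comm,
          abs_of_nonneg (by linarith)]
        ring
      · -- The points lie on different pieces: compare with the distances from `x` and to `y`.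
        have e1 : dist x (c s) = s := by
          rw [← h₁0, hc1 s hsδ, h₁ 0 ⟨le_rfl, hδ0⟩ s ⟨hs.1, hsδ⟩, zero_sub, abs_neg,
            abs_of_nonneg hs.1]
        have e2 : dist (c s) m = δ - s := by
          rw [← h₁1, hc1 s hsδ, h₁ s ⟨hs.1, hsδ⟩ δ ⟨hδ0, le_rfl⟩, abs_sub_comm,
            abs_of_nonneg (by linarith)]
        have e3 : dist m (c t) = t - δ := by
          rw [← h₂0, hc2 t htδ, h₂ 0 ⟨le_rfl, hD0⟩ _ htI, zero_sub, abs_neg,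
            abs_of_nonneg htI.1]
        have e4 : dist (c t) y = dist x y - t := by
          have h := h₂ _ htI _ ⟨hD0, le_rfl⟩
          rw [h₂1, abs_sub_comm, abs_of_nonneg (by linarith [htI.2])] at h
          rw [hc2 t htδ, h]
          linarith
        have t1 := dist_triangle (c s) m (c t)
        have t2 := dist_triangle4 x (c s) (c t) y
        linarith
  refine ⟨c, hx, hy, fun s hs t ht => ?_, by rw [hc1 _ le_rfl, h₁1]⟩
  rcases le_total s t with hst | hst
  · rw [key s hs t ht hst, abs_sub_comm, abs_of_nonneg (by linarith)]
  · rw [dist_comm, key t ht s hs hst, abs_of_nonneg (by linarith)]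

lemma IsFlatSpace.exists_isGeodesic_of_lt (hS : IsFlatSpace S r) {x y : S} (hxy : dist x y < r) :
    ∃ c : ℝ → S, c 0 = x ∧ c (dist x y) = y ∧ IsGeodesic c (dist x y) := by
  rcases eq_or_ne x y with rfl | hne
  · refine ⟨fun _ => x, rfl, rfl, fun s hs t ht => ?_⟩
    rw [dist_self] at hs ht
    rw [dist_self, le_antisymm hs.2 hs.1, le_antisymm ht.2 ht.1, sub_self, abs_zero]
  obtain ⟨χ, p, rfl, hχ⟩ := hS.disk x
  have hy : y ∈ ball (χ p) r := by rwa [mem_ball, dist_comm]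
  rw [← hχ.image_eq] at hy
  obtain ⟨q, hq, rfl⟩ := hy
  have hp := mem_ball_self (x := p) hS.pos
  have hpq : p ≠ q := fun h => hne (by rw [h])
  rw [hχ.dist_eq p hp q hq] at hxy ⊢
  have hD : 0 < dist p q := dist_pos.2 hpq
  refine ⟨fun t => χ (AffineMap.lineMap p q (t / dist p q)), by simp, by simp [hD.ne'],
    fun s hs t ht => ?_⟩
  have hmem : ∀ t ∈ Icc 0 (dist p q), AffineMap.lineMap p q (t / dist p q) ∈ ball p r := by
    intro t ht
    rw [mem_ball, dist_lineMap_left, Real.norm_of_nonneg (div_nonneg ht.1 hD.le),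
      div_mul_cancel₀ _ hD.ne']
    exact ht.2.trans_lt hxy
  rw [hχ.dist_eq _ (hmem s hs) _ (hmem t ht), dist_lineMap_lineMap, Real.dist_eq, ← sub_div,
    abs_div, abs_of_pos hD, div_mul_cancel₀ _ hD.ne']

/-- Any two points are joined by a geodesic. -/
lemma IsFlatSpace.exists_isGeodesic (hS : IsFlatSpace S r) (x y : S) :
    ∃ c : ℝ → S, c 0 = x ∧ c (dist x y) = y ∧ IsGeodesic c (dist x y) := by
  have hr := hS.pos
  have key : ∀ n : ℕ, ∀ x y : S, dist x y < (n + 1) * (r / 2) →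
      ∃ c : ℝ → S, c 0 = x ∧ c (dist x y) = y ∧ IsGeodesic c (dist x y) := by
    intro n
    induction n with
    | zero =>
      intro x y h
      exact hS.exists_isGeodesic_of_lt (by norm_num at h; linarith)
    | succ n ih =>
      intro x y h
      rcases lt_or_ge (dist x y) r with hlt | hge
      · exact hS.exists_isGeodesic_of_lt hlt
      · obtain ⟨m, hm1, hm2⟩ := hS.between x y (r / 2) (by positivity) (by linarith)
        obtain ⟨c₁, h10, h11, h1⟩ := hS.exists_isGeodesic_of_lt (x := x) (y := m) (by linarith)
        obtain ⟨c₂, h20, h21, h2⟩ := ih m y (by push_cast at h; linarith)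
        obtain ⟨c, h0, h1, hc, -⟩ := exists_isGeodesic_trans (by linarith) h1 h2 h10 h11 h20 h21
        exact ⟨c, h0, h1, hc⟩
  obtain ⟨n, hn⟩ := exists_nat_gt (dist x y / (r / 2))
  rw [div_lt_iff₀ (by positivity)] at hn
  exact key n x y (by nlinarith)

/-- The points that lie on shortest paths from `p` to `q`. -/
def metricInterval (p q : S) : Set S := {z | dist p z + dist z q = dist p q}

lemma IsGeodesic.mem_metricInterval {p q : S} {c : ℝ → S} (hc : IsGeodesic c (dist p q))
    (h0 : c 0 = p) (h1 : c (dist p q) = q) {t : ℝ} (ht : t ∈ Icc 0 (dist p q)) :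
    c t ∈ metricInterval p q := by
  have e1 := hc 0 ⟨le_rfl, dist_nonneg⟩ t ht
  have e2 := hc t ht _ ⟨dist_nonneg, le_rfl⟩
  rw [h0, zero_sub, abs_neg, abs_of_nonneg ht.1] at e1
  rw [h1, abs_sub_comm, abs_of_nonneg (by linarith [ht.2])] at e2
  simp only [metricInterval, mem_ofPred_eq]
  linarith

/-- Every point of the metric interval from `p` to `q` lies on a geodesic from `p` to `q`. -/
lemma IsFlatSpace.exists_isGeodesic_through (hS : IsFlatSpace S r) {p q z : S}
    (hz : z ∈ metricInterval p q) :
    ∃ c : ℝ → S, c 0 = p ∧ c (dist p q) = q ∧ IsGeodesic c (dist p q) ∧ c (dist p z) = z := by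
  obtain ⟨c₁, h10, h11, h1⟩ := hS.exists_isGeodesic p z
  obtain ⟨c₂, h20, h21, h2⟩ := hS.exists_isGeodesic z q
  exact exists_isGeodesic_trans hz h1 h2 h10 h11 h20 h21

lemma edist_le_pathLength {p q : S} (γ : Path p q) : edist p q ≤ pathLength γ := by
  have := eVariationOn.edist_le (γ : unitInterval → S) (mem_univ 0) (mem_univ 1)
  rwa [γ.source, γ.target] at this

lemma exists_path_of_isGeodesic {p q : S} {c : ℝ → S} (hc : IsGeodesic c (dist p q))
    (h0 : c 0 = p) (h1 : c (dist p q) = q) :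
    ∃ γ : Path p q, pathLength γ = edist p q ∧ ∀ t, γ t = c (t * dist p q) := by
  have hmem : ∀ t : unitInterval, (t : ℝ) * dist p q ∈ Icc 0 (dist p q) := fun t =>
    ⟨mul_nonneg t.2.1 dist_nonneg, mul_le_of_le_one_left dist_nonneg t.2.2⟩
  let γ : Path p q :=
    { toFun := fun t => c (t * dist p q)
      continuous_toFun := hc.continuousOn.comp_continuous (by fun_prop) hmem
      source' := by simp [h0]
      target' := by simp [h1] }
  refine ⟨γ, le_antisymm ?_ (edist_le_pathLength γ), fun t => rfl⟩
  have hlip : LipschitzOnWith 1 c (Icc 0 (dist p q)) :=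
    LipschitzOnWith.of_dist_le_mul fun s hs t ht => by
      rw [hc s hs t ht, Real.dist_eq]; simp
  have hmaps : MapsTo (fun t : unitInterval => (t : ℝ) * dist p q) univ (Icc 0 (dist p q)) :=
    fun t _ => hmem t
  have h2 := hlip.comp_eVariationOn_le hmaps
  have hmono : MonotoneOn (fun t : unitInterval => (t : ℝ) * dist p q) univ :=
    fun s _ t _ hst => mul_le_mul_of_nonneg_right hst dist_nonneg
  have h3 := (hmono.eVariationOn_eq (mem_univ 0) (mem_univ 1)).le
  have h4 : (univ ∩ Icc 0 1 : Set unitInterval) = univ :=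
    eq_univ_of_forall fun t => ⟨mem_univ _, t.2.1, t.2.2⟩
  rw [h4] at h3
  refine h2.trans ?_
  rw [ENNReal.coe_one, one_mul]
  refine h3.trans ?_
  rw [edist_dist]
  simp

/-- Since every two points are joined by a geodesic, the shortest paths are the paths whose length
is the distance of their endpoints. -/
lemma IsFlatSpace.isShortestPath_iff (hS : IsFlatSpace S r) {p q : S} (γ : Path p q) :
    IsShortestPath γ ↔ pathLength γ = edist p q := by
  constructor
  · intro h
    obtain ⟨c, h0, h1, hc⟩ := hS.exists_isGeodesic p q
    obtain ⟨γ', hγ', -⟩ := exists_path_of_isGeodesic hc h0 h1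
    exact le_antisymm ((h γ').trans_eq hγ') (edist_le_pathLength γ)
  · intro h δ
    rw [h]
    exact edist_le_pathLength δ

lemma mem_metricInterval_of_pathLength_eq {p q : S} {γ : Path p q} (h : pathLength γ = edist p q)
    (t : unitInterval) : γ t ∈ metricInterval p q := by
  have h1 := eVariationOn.edist_le (γ : unitInterval → S) (s := Iic t) (x := 0) (y := t)
    t.2.1 (mem_Iic.2 le_rfl)
  have h2 := eVariationOn.edist_le (γ : unitInterval → S) (s := Ici t) (x := t) (y := 1)
    (mem_Ici.2 le_rfl) t.2.2
  have h3 := eVariationOn.union (γ : unitInterval → S) (isGreatest_Iic (a := t))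
    (isLeast_Ici (a := t))
  rw [Iic_union_Ici] at h3
  rw [γ.source] at h1
  rw [γ.target] at h2
  have h4 : edist p (γ t) + edist (γ t) q ≤ edist p q := by
    rw [← h]
    exact (add_le_add h1 h2).trans_eq h3.symm
  rw [edist_dist, edist_dist, edist_dist, ← ENNReal.ofReal_add dist_nonneg dist_nonneg,
    ENNReal.ofReal_le_ofReal_iff dist_nonneg] at h4
  exact le_antisymm h4 (dist_triangle _ _ _)

/-- The shortest path from `p` to `q` is unique if and only if a point on a shortest path from `p`
to `q` is determined by its distance to `p`. -/
lemma IsFlatSpace.isUniqueShortestPathTrace_iff (hS : IsFlatSpace S r) {p q : S} {A : Set S} :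
    IsUniqueShortestPathTrace p q A ↔
      A = metricInterval p q ∧ InjOn (dist p) (metricInterval p q) := by
  constructor
  · rintro ⟨⟨γ, hγ, hγA⟩, huniq⟩
    have hgeo : ∀ z ∈ metricInterval p q, ∃ c : ℝ → S, IsGeodesic c (dist p q) ∧ c 0 = p ∧
        c (dist p z) = z ∧ A = (fun t : unitInterval => c (t * dist p q)) '' univ := by
      intro z hz
      obtain ⟨c, h0, h1, hc, hcz⟩ := hS.exists_isGeodesic_through hz
      obtain ⟨γ', hγ', hγc⟩ := exists_path_of_isGeodesic hc h0 h1
      refine ⟨c, hc, h0, hcz, ?_⟩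
      rw [← huniq γ' ((hS.isShortestPath_iff _).2 hγ'), image_univ]
      congr 1
      exact funext hγc
    have hle : ∀ z ∈ metricInterval p q, dist p z ∈ Icc 0 (dist p q) := fun z hz =>
      ⟨dist_nonneg, by have : dist p z + dist z q = dist p q := hz
                       linarith [dist_nonneg (x := z) (y := q)]⟩
    have hsub : metricInterval p q ⊆ A := by
      intro z hz
      obtain ⟨c, hc, h0, hcz, hA⟩ := hgeo z hz
      obtain ⟨h1, h2⟩ := hle z hz
      rw [hA]
      refine ⟨⟨dist p z / dist p q, div_nonneg h1 dist_nonneg, div_le_one_of_le₀ h2 dist_nonneg⟩,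
        mem_univ _, ?_⟩
      rcases eq_or_ne (dist p q) 0 with h | h
      · have : dist p z = 0 := le_antisymm (h ▸ h2) h1
        rw [this] at hcz
        simpa [h] using hcz
      · simpa [h] using hcz
    refine ⟨subset_antisymm ?_ hsub, ?_⟩
    · rw [← hγA]
      rintro _ ⟨t, rfl⟩
      exact mem_metricInterval_of_pathLength_eq ((hS.isShortestPath_iff _).1 hγ) t
    · intro z hz z' hz' hzz'
      obtain ⟨c, hc, h0, hcz, hA⟩ := hgeo z hz
      obtain ⟨⟨t, ht⟩, -, hzt⟩ := hA ▸ hsub hz'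
      have htI : t * dist p q ∈ Icc 0 (dist p q) :=
        ⟨mul_nonneg ht.1 dist_nonneg, mul_le_of_le_one_left dist_nonneg ht.2⟩
      have := hc 0 ⟨le_rfl, dist_nonneg⟩ _ htI
      simp only at hzt
      rw [h0, hzt, zero_sub, abs_neg, abs_of_nonneg htI.1, ← hzz'] at this
      rw [← hzt, ← this, hcz]
  · rintro ⟨rfl, hinj⟩
    have hrange : ∀ γ : Path p q, IsShortestPath γ → range γ = metricInterval p q := by
      intro γ hγ
      rw [hS.isShortestPath_iff] at hγ
      apply subset_antisymm
      · rintro _ ⟨t, rfl⟩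
        exact mem_metricInterval_of_pathLength_eq hγ t
      · intro z hz
        have hz' : dist p z + dist z q = dist p q := hz
        have hcont : Continuous fun t => dist p (γ t) := by fun_prop
        have : dist p z ∈ range fun t => dist p (γ t) := by
          refine mem_range_of_exists_le_of_exists_ge hcont ⟨0, by simp⟩ ⟨1, ?_⟩
          rw [γ.target]; linarith [dist_nonneg (x := z) (y := q)]
        obtain ⟨t, ht⟩ := this
        exact ⟨t, hinj (mem_metricInterval_of_pathLength_eq hγ t) hz ht⟩
    obtain ⟨c, h0, h1, hc⟩ := hS.exists_isGeodesic p q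
    obtain ⟨γ, hγ, -⟩ := exists_path_of_isGeodesic hc h0 h1
    have hγ' := (hS.isShortestPath_iff γ).2 hγ
    exact ⟨⟨γ, hγ', hrange γ hγ'⟩, hrange⟩

end Geodesics

end FlatSurface

/-! ### Stability of unique shortest paths -/

namespace FlatSurface

open Set Metric

section FlatSurfaces

/-- By compactness, the isometric disks can be chosen with the same radius. -/
lemma exists_uniform_isIsometricDisk {S : Type*} [MetricSpace S] [CompactSpace S]
    (h : ∀ x : S, ∃ r > 0, ∃ ψ : Plane → S, ∃ p, ψ p = x ∧ IsIsometricDisk ψ p r) :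
    ∃ r > 0, ∀ x : S, ∃ ψ : Plane → S, ∃ p, ψ p = x ∧ IsIsometricDisk ψ p r := by
  have key : ∃ r > 0, ∀ x ∈ (univ : Set S), ∃ ψ : Plane → S, ∃ p, ψ p = x ∧
      IsIsometricDisk ψ p r := by
    refine isCompact_univ.induction_on (p := fun s => ∃ r > 0, ∀ x ∈ s, ∃ ψ : Plane → S, ∃ p,
      ψ p = x ∧ IsIsometricDisk ψ p r) ⟨1, one_pos, by simp⟩ ?_ ?_ ?_
    · rintro s t hst ⟨r, hr, ht⟩
      exact ⟨r, hr, fun x hx => ht x (hst hx)⟩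
    · rintro s t ⟨r₁, hr₁, hs⟩ ⟨r₂, hr₂, ht⟩
      refine ⟨min r₁ r₂, lt_min hr₁ hr₂, fun x hx => ?_⟩
      rcases hx with hx | hx
      · obtain ⟨ψ, p, hp, hψ⟩ := hs x hx
        exact ⟨ψ, p, hp, hψ.mono (lt_min hr₁ hr₂) (by simp)⟩
      · obtain ⟨ψ, p, hp, hψ⟩ := ht x hx
        exact ⟨ψ, p, hp, hψ.mono (lt_min hr₁ hr₂) (by simp)⟩
    · intro x _
      obtain ⟨r, hr, ψ, p, rfl, hψ⟩ := h x
      refine ⟨ball (ψ p) (r / 2), mem_nhdsWithin_of_mem_nhds (ball_mem_nhds _ (by positivity)),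
        r / 2, by positivity, fun y hy => ?_⟩
      have hp := mem_ball_self (x := p) hr
      have hy' : y ∈ ball (ψ p) r := ball_subset_ball (by linarith) hy
      rw [← hψ.image_eq] at hy'
      obtain ⟨q, hq, rfl⟩ := hy'
      rw [mem_ball, hψ.dist_eq q hq p hp] at hy
      exact ⟨ψ, q, rfl, hψ.mono (by positivity) (by linarith)⟩
  simpa using key

/-- A compact flat surface is a flat space. Points that divide distances exactly are limits of
points that divide them up to a small error. -/
lemma exists_isFlatSpace {S : Type*} [MetricSpace S] [CompactSpace S] [ChartedSpace Plane S]
    [IsManifold (𝓡 2) ∞ S] [Bundle.RiemannianBundle (fun x : S => TangentSpace (𝓡 2) x)]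
    [IsRiemannianManifold (𝓡 2) S] (hflat : IsFlat S) : ∃ r, IsFlatSpace S r := by
  obtain ⟨r, hr, hdisk⟩ := exists_uniform_isIsometricDisk (exists_isIsometricDisk hflat)
  refine ⟨r, hr, hdisk, fun x y δ h0 h1 => ?_⟩
  set K : Set S := {m | dist x m = δ}
  have hK : IsCompact K := (isClosed_eq (by fun_prop) continuous_const).isCompact
  have hne : K.Nonempty := by
    obtain ⟨m, hm, -⟩ := exists_dist_eq_and_dist_lt x y h0 h1 one_pos
    exact ⟨m, hm⟩
  obtain ⟨m, hm, hmin⟩ := hK.exists_isMinOn hne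
    (show Continuous fun m => dist m y by fun_prop).continuousOn
  refine ⟨m, hm, le_antisymm (le_of_forall_pos_le_add fun ε hε => ?_) ?_⟩
  · obtain ⟨m', hm', hlt⟩ := exists_dist_eq_and_dist_lt x y h0 h1 hε
    exact (hmin hm').trans hlt.le
  · have := dist_triangle x m y
    have hm' : dist x m = δ := hm
    linarith

end FlatSurfaces

section Stability

variable {S : Type*} [MetricSpace S] {r R : ℝ} {ψ : Plane → S}

/-- The exponential map does not increase distances. -/
lemma dist_exp_le (hr : 0 < r) (hψ : ∀ p ∈ ball (0 : Plane) R, IsIsometricDisk ψ p r)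
    {x y : Plane} (hx : x ∈ ball (0 : Plane) R) (hy : y ∈ ball (0 : Plane) R) :
    dist (ψ x) (ψ y) ≤ dist x y := by
  have h := dist_le_of_locally_dist_le (σ := fun t : ℝ => ψ (AffineMap.lineMap x y t))
    (C := dist x y) zero_le_one dist_nonneg (fun t ht => by
      have hmem : AffineMap.lineMap x y t ∈ ball (0 : Plane) R :=
        (convex_ball (0 : Plane) R).lineMap_mem hx hy ht
      refine ⟨r / (dist x y + 1), by positivity, fun s _ hst => ?_⟩
      rw [lt_div_iff₀ (by positivity)] at hst
      have hd : dist (AffineMap.lineMap x y s) (AffineMap.lineMap x y t) = |s - t| * dist x y := by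
        rw [dist_lineMap_lineMap, Real.dist_eq]
      have hs : AffineMap.lineMap x y s ∈ ball (AffineMap.lineMap x y t) r := by
        rw [mem_ball, hd]
        nlinarith [abs_nonneg (s - t)]
      rw [dist_comm, (hψ _ hmem).dist_eq _ hs _ (mem_ball_self hr), hd, mul_comm])
  simpa using h

lemma isOpen_image_exp (hψ : ∀ p ∈ ball (0 : Plane) R, IsIsometricDisk ψ p r) (hr : 0 < r)
    {E : Set Plane} (hE : IsOpen E) (hER : E ⊆ ball 0 R) : IsOpen (ψ '' E) := by
  rw [Metric.isOpen_iff]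
  rintro _ ⟨p, hp, rfl⟩
  obtain ⟨ε, hε, hsub⟩ := Metric.isOpen_iff.1 hE p hp
  have h := (hψ p (hER hp)).mono (q := p) (lt_min hε hr) (by simp)
  exact ⟨min ε r, lt_min hε hr, by
    rw [← h.image_eq]; exact image_mono ((ball_subset_ball (min_le_left _ _)).trans hsub)⟩

lemma continuousOn_exp (hψ : ∀ p ∈ ball (0 : Plane) R, IsIsometricDisk ψ p r) (hr : 0 < r) :
    ContinuousOn ψ (ball 0 R) := fun p hp =>
  ((hψ p hp).isLocallyIsometricAt (mem_ball_self hr)).continuousAt.continuousWithinAt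

lemma injOn_dist_image_segment {β v : Plane}
    (h : ∀ y ∈ segment ℝ β v, dist (ψ β) (ψ y) = dist β y) :
    InjOn (dist (ψ β)) (ψ '' segment ℝ β v) := by
  rintro _ ⟨y, hy, rfl⟩ _ ⟨y', hy', rfl⟩ heq
  rw [h y hy, h y' hy'] at heq
  rw [segment_eq_image_lineMap] at hy hy'
  obtain ⟨t, ht, rfl⟩ := hy
  obtain ⟨t', ht', rfl⟩ := hy'
  rw [dist_left_lineMap, dist_left_lineMap, Real.norm_of_nonneg ht.1,
    Real.norm_of_nonneg ht'.1] at heq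
  rcases eq_or_ne (dist β v) 0 with h0 | h0
  · rw [dist_eq_zero] at h0
    subst h0
    simp
  · rw [mul_right_cancel₀ h0 heq]

/-- Unique shortest paths are stable: if the segment from `0` to `v` is sent to the unique shortest
path between its endpoints, then so is the segment from `β` to `v` for `β` close to `0`. A shortest
path from `ψ β` to `ψ v` stays close to the one from `ψ 0` to `ψ v`, so that it lifts to the plane,
where the segment is the only shortest path. -/
lemma IsFlatSpace.eventually_isUniqueShortestPathTrace [CompactSpace S] (hS : IsFlatSpace S r)
    (hψ : ∀ p ∈ ball (0 : Plane) R, IsIsometricDisk ψ p r)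
    {E : Set Plane} (hE : IsOpen E) (hER : E ⊆ ball 0 R) (hinj : InjOn ψ E) {v : Plane}
    (hvE : segment ℝ 0 v ⊆ E)
    (hv : IsUniqueShortestPathTrace (ψ 0) (ψ v) (ψ '' segment ℝ 0 v)) :
    ∀ᶠ β in 𝓝 (0 : Plane), IsUniqueShortestPathTrace (ψ β) (ψ v) (ψ '' segment ℝ β v) := by
  have hr := hS.pos
  have hI := (hS.isUniqueShortestPathTrace_iff.1 hv).1
  have h0E : (0 : Plane) ∈ E := hvE (left_mem_segment ℝ 0 v)
  have hvE' : v ∈ E := hvE (right_mem_segment ℝ 0 v)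
  have hseg : ∀ᶠ β in 𝓝 (0 : Plane), segment ℝ β v ⊆ E := by
    have h : ∀ᶠ β in 𝓝 (0 : Plane), ∀ t ∈ Icc (0 : ℝ) 1, AffineMap.lineMap β v t ∈ E := by
      apply isCompact_Icc.eventually_forall_of_forall_eventually
      intro t ht
      have hc : Continuous fun z : Plane × ℝ => AffineMap.lineMap z.1 v z.2 := by
        simp only [AffineMap.lineMap_apply_module]; fun_prop
      refine hc.continuousAt.eventually (hE.mem_nhds (hvE ?_))
      rw [segment_eq_image_lineMap]
      exact ⟨t, ht, rfl⟩
    filter_upwards [h] with β hβ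
    rw [segment_eq_image_lineMap]
    rintro _ ⟨t, ht, rfl⟩
    exact hβ t ht
  have hint : ∀ᶠ β in 𝓝 (0 : Plane), metricInterval (ψ β) (ψ v) ⊆ ψ '' E := by
    have h : ∀ᶠ x in 𝓝 (ψ 0), ∀ z ∈ (ψ '' E)ᶜ, dist x z + dist z (ψ v) ≠ dist x (ψ v) := by
      have hK : IsCompact (ψ '' E)ᶜ :=
        (isOpen_image_exp hψ hr hE hER).isClosed_compl.isCompact
      apply hK.eventually_forall_of_forall_eventually
      intro z hz
      have h1 : dist (ψ 0) z + dist z (ψ v) ≠ dist (ψ 0) (ψ v) := by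
        intro hz'
        have : z ∈ metricInterval (ψ 0) (ψ v) := hz'
        rw [← hI] at this
        exact hz (image_mono hvE this)
      have hc1 : Continuous fun z : S × S => dist z.1 z.2 + dist z.2 (ψ v) := by fun_prop
      have hc2 : Continuous fun z : S × S => dist z.1 (ψ v) := by fun_prop
      exact (isOpen_ne_fun hc1 hc2).mem_nhds h1
    have hc := ((hψ 0 (hER h0E)).isLocallyIsometricAt (mem_ball_self hr)).continuousAt
    filter_upwards [hc.eventually h] with β hβ z hz
    by_contra hcon
    exact hβ z hcon hz
  filter_upwards [hseg, hint] with β hβ hβI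
  have hβE : β ∈ E := hβ (left_mem_segment ℝ β v)
  set D := dist (ψ β) (ψ v) with hD
  -- A geodesic between the two points lifts to the plane.
  have hlift : ∀ c : ℝ → S, c 0 = ψ β → c D = ψ v → IsGeodesic c D →
      dist β v ≤ D ∧ ∀ t ∈ Icc 0 D, ∃ x ∈ E, ψ x = c t ∧ dist β x ≤ t ∧ dist x v ≤ D - t := by
    intro c hc0 hc1 hc
    have hex : ∀ t ∈ Icc 0 D, ∃ x ∈ E, ψ x = c t := fun t ht =>
      hβI (hc.mem_metricInterval hc0 hc1 ht)
    choose! σ hσE hσ using hex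
    have hloc : ∀ t ∈ Icc 0 D, ∃ ε > 0, ∀ s ∈ Icc 0 D, |s - t| < ε →
        dist (σ t) (σ s) ≤ 1 * |s - t| := by
      intro t ht
      obtain ⟨ε, hε, hsub⟩ := Metric.isOpen_iff.1 hE _ (hσE t ht)
      have h := (hψ _ (hER (hσE t ht))).mono (q := σ t) (lt_min hε hr) (by simp)
      have hself := mem_ball_self (x := σ t) (lt_min hε hr)
      refine ⟨min ε r, lt_min hε hr, fun s hs hst => ?_⟩
      have hcs : c s ∈ ball (ψ (σ t)) (min ε r) := by
        rw [mem_ball, hσ t ht, hc s hs t ht]; exact hst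
      rw [← h.image_eq] at hcs
      obtain ⟨x, hx, hxs⟩ := hcs
      have hxσ : x = σ s := hinj (hsub (ball_subset_ball (min_le_left _ _) hx)) (hσE s hs)
        (by rw [hxs, hσ s hs])
      rw [hxσ] at hx
      rw [← h.dist_eq _ hself _ hx, hσ t ht, hσ s hs, hc t ht s hs, abs_sub_comm, one_mul]
    have hlip : ∀ s ∈ Icc 0 D, ∀ t ∈ Icc 0 D, s ≤ t → dist (σ s) (σ t) ≤ t - s := by
      intro s hs t ht hst
      have := dist_le_of_locally_dist_le hst zero_le_one (fun u hu => by
        obtain ⟨ε, hε, h⟩ := hloc u ⟨hs.1.trans hu.1, hu.2.trans ht.2⟩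
        exact ⟨ε, hε, fun u' hu' => h u' ⟨hs.1.trans hu'.1, hu'.2.trans ht.2⟩⟩)
      rwa [one_mul] at this
    have h0I : (0 : ℝ) ∈ Icc 0 D := ⟨le_rfl, dist_nonneg⟩
    have hDI : D ∈ Icc 0 D := ⟨dist_nonneg, le_rfl⟩
    have hσ0 : σ 0 = β := hinj (hσE 0 h0I) hβE (by rw [hσ 0 h0I, hc0])
    have hσD : σ D = v := hinj (hσE D hDI) hvE' (by rw [hσ D hDI, hc1])
    refine ⟨by simpa [hσ0, hσD] using hlip 0 h0I D hDI dist_nonneg, fun t ht =>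
      ⟨σ t, hσE t ht, hσ t ht, ?_, ?_⟩⟩
    · simpa [hσ0] using hlip 0 h0I t ht ht.1
    · simpa [hσD] using hlip t ht D hDI ht.2
  have hDeq : D = dist β v := by
    obtain ⟨c, hc0, hc1, hc⟩ := hS.exists_isGeodesic (ψ β) (ψ v)
    exact le_antisymm (dist_exp_le hr hψ (hER hβE) (hER hvE')) (hlift c hc0 hc1 hc).1
  have hdist : ∀ y ∈ segment ℝ β v, dist (ψ β) (ψ y) = dist β y ∧
      dist (ψ β) (ψ y) + dist (ψ y) (ψ v) = D := by
    intro y hy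
    have h1 := dist_exp_le hr hψ (hER hβE) (hER (hβ hy))
    have h2 := dist_exp_le hr hψ (hER (hβ hy)) (hER hvE')
    have h3 := dist_triangle (ψ β) (ψ y) (ψ v)
    have h4 := dist_add_dist_of_mem_segment hy
    constructor <;> linarith
  have hIeq : ψ '' segment ℝ β v = metricInterval (ψ β) (ψ v) := by
    apply subset_antisymm
    · rintro _ ⟨y, hy, rfl⟩
      exact (hdist y hy).2
    · intro z hz
      obtain ⟨c, hc0, hc1, hc, hcz⟩ := hS.exists_isGeodesic_through hz
      have hz' : dist (ψ β) z + dist z (ψ v) = D := hz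
      obtain ⟨x, -, hx, h1, h2⟩ := (hlift c hc0 hc1 hc).2 (dist (ψ β) z)
        ⟨dist_nonneg, by linarith [dist_nonneg (x := z) (y := ψ v)]⟩
      refine ⟨x, ?_, by rw [hx, hcz]⟩
      rw [mem_segment_iff_wbtw, ← dist_add_dist_eq_iff]
      exact le_antisymm (by linarith) (dist_triangle _ _ _)
  rw [hS.isUniqueShortestPathTrace_iff]
  refine ⟨hIeq, ?_⟩
  rw [← hIeq]
  exact injOn_dist_image_segment fun y hy => (hdist y hy).1

/-- Radial segments in an isometric disk are unique shortest paths. -/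
lemma IsFlatSpace.isUniqueShortestPathTrace_of_norm_lt (hS : IsFlatSpace S r)
    (hψ : IsIsometricDisk ψ 0 r) {β : Plane} (hβ : ‖β‖ < r) :
    IsUniqueShortestPathTrace (ψ 0) (ψ β) (ψ '' segment ℝ 0 β) := by
  have h0 : (0 : Plane) ∈ ball (0 : Plane) r := mem_ball_self hS.pos
  have hβ' : β ∈ ball (0 : Plane) r := by rwa [mem_ball_zero_iff]
  have hsub : segment ℝ 0 β ⊆ ball (0 : Plane) r := (convex_ball _ _).segment_subset h0 hβ'
  have hIeq : ψ '' segment ℝ 0 β = metricInterval (ψ 0) (ψ β) := by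
    apply subset_antisymm
    · rintro _ ⟨y, hy, rfl⟩
      show dist _ _ + dist _ _ = dist _ _
      rw [hψ.dist_eq _ h0 _ (hsub hy), hψ.dist_eq _ (hsub hy) _ hβ', hψ.dist_eq _ h0 _ hβ']
      exact dist_add_dist_of_mem_segment hy
    · intro z hz
      have hz' : dist (ψ 0) z + dist z (ψ β) = dist (ψ 0) (ψ β) := hz
      have hzb : z ∈ ball (ψ 0) r := by
        rw [mem_ball, dist_comm]
        rw [hψ.dist_eq _ h0 _ hβ', dist_zero_left] at hz'
        linarith [dist_nonneg (x := z) (y := ψ β)]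
      rw [← hψ.image_eq] at hzb
      obtain ⟨x, hx, rfl⟩ := hzb
      rw [hψ.dist_eq _ h0 _ hx, hψ.dist_eq _ hx _ hβ', hψ.dist_eq _ h0 _ hβ'] at hz'
      exact ⟨x, by rwa [mem_segment_iff_wbtw, ← dist_add_dist_eq_iff], rfl⟩
  rw [hS.isUniqueShortestPathTrace_iff]
  refine ⟨hIeq, ?_⟩
  rw [← hIeq]
  exact injOn_dist_image_segment fun y hy => hψ.dist_eq _ h0 _ (hsub hy)

end Stability

end FlatSurface

/-! ### Gauges of thin stars -/

namespace FlatSurface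

open Set Metric Filter

section StarGauge

/-- The gauge of a thin spike with axis from `0` to `v`: the larger `M`, the thinner the spike
`{p | spikeGauge v M p ≤ 1}`. -/
noncomputable def spikeGauge (v : Plane) (M : ℝ) (p : Plane) : ℝ :=
  ‖p‖ / ‖v‖ + M * ‖p - (‖p‖ / ‖v‖) • v‖

lemma spikeGauge_smul (v : Plane) (M : ℝ) (p : Plane) {t : ℝ} (ht : 0 ≤ t) :
    spikeGauge v M (t • p) = t * spikeGauge v M p := by
  have : t • p - (‖t • p‖ / ‖v‖) • v = t • (p - (‖p‖ / ‖v‖) • v) := by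
    rw [norm_smul, Real.norm_of_nonneg ht, smul_sub, smul_smul, mul_div_assoc]
  rw [spikeGauge, this, spikeGauge, norm_smul, norm_smul, Real.norm_of_nonneg ht]
  ring

lemma spikeGauge_self {v : Plane} (hv : v ≠ 0) (M : ℝ) : spikeGauge v M v = 1 := by
  simp [spikeGauge, div_self (norm_ne_zero_iff.2 hv)]

lemma spikeGauge_le_add {v : Plane} (hv : v ≠ 0) {M : ℝ} (hM : 0 ≤ M) (p q : Plane) :
    spikeGauge v M p ≤ spikeGauge v M q + (1 / ‖v‖ + 2 * M) * ‖p - q‖ := by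
  have hv' := norm_pos_iff.2 hv
  have h1 : ‖p‖ - ‖q‖ ≤ ‖p - q‖ := norm_sub_norm_le p q
  have h2 : ‖p - (‖p‖ / ‖v‖) • v‖ ≤ ‖q - (‖q‖ / ‖v‖) • v‖ + 2 * ‖p - q‖ := by
    have e : p - (‖p‖ / ‖v‖) • v =
        (q - (‖q‖ / ‖v‖) • v) + ((p - q) - ((‖p‖ - ‖q‖) / ‖v‖) • v) := by
      rw [sub_div, sub_smul]; abel
    have h3 : ‖((‖p‖ - ‖q‖) / ‖v‖) • v‖ ≤ ‖p - q‖ := by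
      rw [norm_smul, norm_div, norm_norm, div_mul_cancel₀ _ hv'.ne']
      exact abs_norm_sub_norm_le p q
    rw [e]
    have := norm_add_le (q - (‖q‖ / ‖v‖) • v) ((p - q) - ((‖p‖ - ‖q‖) / ‖v‖) • v)
    have := norm_sub_le (p - q) (((‖p‖ - ‖q‖) / ‖v‖) • v)
    linarith
  have h4 : ‖p‖ / ‖v‖ ≤ ‖q‖ / ‖v‖ + 1 / ‖v‖ * ‖p - q‖ := by
    rw [div_add' _ _ _ hv'.ne', div_le_div_iff_of_pos_right hv']
    field_simp
    linarith
  have h5 := mul_le_mul_of_nonneg_left h2 hM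
  simp only [spikeGauge]
  linarith

variable {ι : Type*} [Finite ι] [Nonempty ι]

/-- A gauge whose unit ball is a thin neighbourhood of the union of the segments from `0` to the
points `v i`, and which touches a given set `F` only at the points `v i`. Near `v i` the set `F` has
to stay outside of a cone about the segment from `v i` to `0`. -/
lemma exists_starGauge {v : ι → Plane} (hv : ∀ i, v i ≠ 0)
    (hdir : ∀ i j, i ≠ j → v j ≠ (‖v j‖ / ‖v i‖) • v i) {E F : Set Plane} (hE : IsOpen E)
    (hvE : ∀ i, segment ℝ 0 (v i) ⊆ E)
    (hF : ∀ i, ∀ y ∈ segment ℝ 0 (v i), y ≠ v i → Fᶜ ∈ 𝓝 y)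
    (hcone : ∀ i, ∃ ρ > 0, ∃ κ > 0, ∀ p ∈ F ∩ ball (v i) ρ, p ≠ v i → ∀ t ∈ Icc (0 : ℝ) 1,
      κ * t ≤ ‖p - (1 - t) • v i‖) :
    ∃ (N : Plane → ℝ) (C : ℝ), 0 < C ∧ (∀ p, ∀ t : ℝ, 0 ≤ t → N (t • p) = t * N p) ∧
      (∀ p q, N p ≤ N q + C * ‖p - q‖) ∧ (∀ i, N (v i) = 1) ∧ (∀ p, N p ≤ 1 → p ∈ E) ∧
      ∀ p, N p ≤ 1 → p ∈ F → ∃ i, p = v i := by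
  -- Each of the three requirements on the thinness `M` holds for large `M`.
  have hthick : ∀ {K U : Set Plane}, IsCompact K → IsOpen U → K ⊆ U →
      ∀ᶠ M : ℝ in atTop, ∀ q ∈ K, ∀ p, ‖p - q‖ ≤ 1 / M → p ∈ U := by
    intro K U hK hU hKU
    obtain ⟨δ, hδ, hsub⟩ := hK.exists_thickening_subset_open hU hKU
    filter_upwards [eventually_gt_atTop (1 / δ)] with M hM q hq p hp
    refine hsub (mem_thickening_iff.2 ⟨q, hq, ?_⟩)
    rw [dist_eq_norm]
    refine hp.trans_lt ?_
    have hM0 : 0 < M := (by positivity : 0 < 1 / δ).trans hM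
    rw [div_lt_iff₀ hδ] at hM
    rw [div_lt_iff₀ hM0]
    linarith
  have hseg : ∀ i, IsCompact (segment ℝ 0 (v i)) := fun i => by
    rw [segment_eq_image_lineMap]
    exact isCompact_Icc.image (by
      simp only [AffineMap.coe_lineMap]; fun_prop)
  have hone : ∀ᶠ M : ℝ in atTop, ∀ i j, i ≠ j → 1 ≤ M * ‖v j - (‖v j‖ / ‖v i‖) • v i‖ := by
    refine eventually_all.2 fun i => eventually_all.2 fun j => ?_
    by_cases hij : i = j
    · exact Eventually.of_forall fun _ h => absurd hij h
    · have hpos : 0 < ‖v j - (‖v j‖ / ‖v i‖) • v i‖ :=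
        norm_pos_iff.2 (sub_ne_zero.2 (hdir i j hij))
      filter_upwards [eventually_ge_atTop (1 / ‖v j - (‖v j‖ / ‖v i‖) • v i‖)] with M hM _
      rwa [div_le_iff₀ hpos] at hM
  have hin : ∀ᶠ M : ℝ in atTop, ∀ i, ∀ q ∈ segment ℝ 0 (v i), ∀ p, ‖p - q‖ ≤ 1 / M → p ∈ E :=
    eventually_all.2 fun i => hthick (hseg i) hE (hvE i)
  have hmeet : ∀ᶠ M : ℝ in atTop, ∀ i, ∀ t ∈ Icc (0 : ℝ) 1, ∀ p,
      M * ‖p - (1 - t) • v i‖ ≤ t → p ∈ F → p = v i := by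
    refine eventually_all.2 fun i => ?_
    obtain ⟨ρ, hρ, κ, hκ, hc⟩ := hcone i
    have hK : IsCompact (segment ℝ 0 (v i) \ ball (v i) (ρ / 2)) := (hseg i).diff isOpen_ball
    have h1 := hthick hK isOpen_interior (U := interior Fᶜ) (fun y hy => by
      rw [mem_interior_iff_mem_nhds]
      refine hF i y hy.1 fun h => hy.2 ?_
      rw [h]; exact mem_ball_self (by positivity))
    filter_upwards [h1, eventually_gt_atTop (2 / ρ), eventually_gt_atTop (1 / κ),
      eventually_gt_atTop 0] with M hM1 hM2 hM3 hM0 t ht p hp hpF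
    have hnorm : ‖p - (1 - t) • v i‖ ≤ t / M := by rw [le_div_iff₀ hM0]; linarith
    have hq : (1 - t) • v i ∈ segment ℝ 0 (v i) := by
      rw [segment_eq_image_lineMap]
      exact ⟨1 - t, ⟨by linarith [ht.2], by linarith [ht.1]⟩, by simp [AffineMap.lineMap_apply]⟩
    by_contra hpv
    have hball : (1 - t) • v i ∈ ball (v i) (ρ / 2) := by
      by_contra hnot
      have h2 := hM1 _ ⟨hq, hnot⟩ p
        (hnorm.trans (div_le_div_of_nonneg_right ht.2 hM0.le))
      exact interior_subset h2 hpF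
    have hpball : p ∈ ball (v i) ρ := by
      rw [mem_ball] at hball ⊢
      have h3 := dist_triangle p ((1 - t) • v i) (v i)
      rw [dist_eq_norm p ((1 - t) • v i)] at h3
      have h4 : t / M < ρ / 2 := by
        rw [div_lt_iff₀ hρ] at hM2
        rw [div_lt_iff₀ hM0]
        nlinarith [ht.2]
      linarith
    rw [div_lt_iff₀ hκ] at hM3
    have h5 := hc p ⟨hpF, hpball⟩ hpv t ht
    rcases ht.1.eq_or_lt with rfl | ht0
    · refine hpv ?_
      have h7 : ‖p - (1 - 0 : ℝ) • v i‖ = 0 := le_antisymm (by simpa using hnorm) (norm_nonneg _)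
      simpa [sub_eq_zero] using h7
    · have h6 : κ * t * M ≤ M * ‖p - (1 - t) • v i‖ := by nlinarith
      nlinarith
  obtain ⟨M, hM1, hM2, hM3, hM0⟩ := (hone.and (hin.and (hmeet.and (eventually_gt_atTop 0)))).exists
  set N : Plane → ℝ := fun p => ⨅ i, spikeGauge (v i) M p with hN
  have hle : ∀ p i, N p ≤ spikeGauge (v i) M p := fun p i =>
    ciInf_le (Set.finite_range _).bddBelow i
  have hex : ∀ p, ∃ i, spikeGauge (v i) M p = N p := fun p => exists_eq_ciInf_of_finite
  obtain ⟨i₀, hi₀⟩ := exists_eq_ciSup_of_finite (f := fun i => 1 / ‖v i‖ + 2 * M)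
  have hC : ∀ i, 1 / ‖v i‖ + 2 * M ≤ 1 / ‖v i₀‖ + 2 * M := fun i => by
    have := le_ciSup (f := fun i => 1 / ‖v i‖ + 2 * M) (Set.finite_range _).bddAbove i
    rwa [← hi₀] at this
  -- A point of the spike about `v i` is close to the point of the axis at the same distance
  -- from `0`.
  have hspike : ∀ p i, spikeGauge (v i) M p ≤ 1 → ∃ t ∈ Icc (0 : ℝ) 1,
      M * ‖p - (1 - t) • v i‖ ≤ t := by
    intro p i h
    have h0 : 0 ≤ ‖p‖ / ‖v i‖ := by positivity
    have h1 : 0 ≤ M * ‖p - (‖p‖ / ‖v i‖) • v i‖ := by positivity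
    simp only [spikeGauge] at h
    refine ⟨1 - ‖p‖ / ‖v i‖, ⟨by linarith, by linarith⟩, ?_⟩
    rw [sub_sub_cancel]
    linarith
  refine ⟨N, 1 / ‖v i₀‖ + 2 * M, by positivity, fun p t ht => ?_, fun p q => ?_, fun i => ?_,
    fun p hp => ?_, fun p hp hpF => ?_⟩
  · simp only [hN, spikeGauge_smul _ _ _ ht]
    exact (Real.mul_iInf_of_nonneg ht _).symm
  · obtain ⟨i, hi⟩ := hex q
    have h1 := spikeGauge_le_add (hv i) hM0.le p q
    have h2 := mul_le_mul_of_nonneg_right (hC i) (norm_nonneg (p - q))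
    linarith [hle p i]
  · apply le_antisymm ((hle _ i).trans_eq (spikeGauge_self (hv i) M))
    obtain ⟨j, hj⟩ := hex (v i)
    rw [← hj]
    by_cases hji : j = i
    · rw [hji, spikeGauge_self (hv i)]
    · have := hM1 j i hji
      have h0 : 0 ≤ ‖v i‖ / ‖v j‖ := by positivity
      simp only [spikeGauge]
      linarith
  · obtain ⟨i, hi⟩ := hex p
    obtain ⟨t, ht, h⟩ := hspike p i (hi.trans_le hp)
    refine hM2 i ((1 - t) • v i) ?_ p ?_
    · rw [segment_eq_image_lineMap]
      exact ⟨1 - t, ⟨by linarith [ht.2], by linarith [ht.1]⟩, by simp [AffineMap.lineMap_apply]⟩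
    · rw [le_div_iff₀ hM0]
      linarith [ht.2]
  · obtain ⟨i, hi⟩ := hex p
    obtain ⟨t, ht, h⟩ := hspike p i (hi.trans_le hp)
    exact ⟨i, hM3 i t ht p h hpF⟩

/-- A ray that does not point in the direction of `-v` stays outside of a cone about `-v`. -/
lemma exists_lt_norm_ray_sub {e v : Plane} (he : ‖e‖ = 1) (hv : v ≠ 0) (hev : ‖v‖ • e ≠ -v) :
    ∃ κ > 0, ∀ s : ℝ, 0 ≤ s → ∀ t : ℝ, 0 ≤ t →
      κ * t ≤ ‖(v + s • e) - (1 - t) • v‖ := by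
  have hv' := norm_pos_iff.2 hv
  set c := inner ℝ e v with hc
  have hcs : -‖v‖ < c := by
    have h1 : ‖‖v‖ • e + v‖ ^ 2 = 2 * ‖v‖ * (‖v‖ + c) := by
      rw [norm_add_sq_real, norm_smul, he, real_inner_smul_left, norm_norm, ← hc]; ring
    have h2 : 0 < ‖‖v‖ • e + v‖ :=
      norm_pos_iff.2 fun h => hev (eq_neg_of_add_eq_zero_left h)
    have h3 : 0 < 2 * ‖v‖ * (‖v‖ + c) := by rw [← h1]; positivity
    by_contra hcon
    push Not at hcon
    nlinarith
  have hcv : c ≤ ‖v‖ := by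
    have := real_inner_le_norm e v
    rwa [he, one_mul] at this
  set m := ‖v‖ * (‖v‖ + c) / 2 with hm
  have hm0 : 0 < m := by rw [hm]; have : 0 < ‖v‖ + c := by linarith
                         positivity
  refine ⟨√(m / 2), by positivity, fun s hs t ht => ?_⟩
  have e1 : v + s • e - (1 - t) • v = s • e + t • v := by module
  have e2 : ‖s • e + t • v‖ ^ 2 = s ^ 2 + 2 * s * t * c + t ^ 2 * ‖v‖ ^ 2 := by
    rw [norm_add_sq_real, norm_smul, norm_smul, he, real_inner_smul_left, real_inner_smul_right,
      ← hc, Real.norm_of_nonneg hs, Real.norm_of_nonneg ht]; ring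
  rw [e1]
  apply (sq_le_sq₀ (by positivity) (norm_nonneg _)).1
  rw [e2, mul_pow, Real.sq_sqrt (by positivity)]
  have h3 : m * t ^ 2 ≤ s ^ 2 + 2 * s * t * c + t ^ 2 * ‖v‖ ^ 2 := by
    rw [hm]
    rcases le_total 0 c with h | h
    · have : 0 ≤ s * t * c := by positivity
      have h5 : ‖v‖ * (‖v‖ + c) / 2 ≤ ‖v‖ ^ 2 := by nlinarith
      nlinarith [sq_nonneg s, sq_nonneg t]
    · have h5 : 2 * s * t * c * ‖v‖ ≥ c * (s ^ 2 + t ^ 2 * ‖v‖ ^ 2) := by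
        nlinarith [sq_nonneg (s - t * ‖v‖)]
      have h6 : s ^ 2 + 2 * s * t * c + t ^ 2 * ‖v‖ ^ 2 ≥ (1 + c / ‖v‖) * (t ^ 2 * ‖v‖ ^ 2) := by
        have h7 : (s ^ 2 + 2 * s * t * c + t ^ 2 * ‖v‖ ^ 2) * ‖v‖ ≥
            (‖v‖ + c) * (s ^ 2 + t ^ 2 * ‖v‖ ^ 2) := by nlinarith
        have h8 : (‖v‖ + c) * (s ^ 2 + t ^ 2 * ‖v‖ ^ 2) ≥ (‖v‖ + c) * (t ^ 2 * ‖v‖ ^ 2) := by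
          apply mul_le_mul_of_nonneg_left _ (by linarith)
          nlinarith [sq_nonneg s]
        have h9 : (1 + c / ‖v‖) * (t ^ 2 * ‖v‖ ^ 2) * ‖v‖ = (‖v‖ + c) * (t ^ 2 * ‖v‖ ^ 2) := by
          field_simp
        exact le_of_mul_le_mul_right (by linarith) hv'
      have h10 : (1 + c / ‖v‖) * (t ^ 2 * ‖v‖ ^ 2) = ‖v‖ * (‖v‖ + c) * t ^ 2 := by
        field_simp
      have : 0 ≤ ‖v‖ * (‖v‖ + c) * t ^ 2 := by
        have : 0 < ‖v‖ + c := by linarith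
        positivity
      nlinarith
  have : 0 ≤ m * t ^ 2 := by positivity
  linarith

end StarGauge

end FlatSurface

/-! ### Heights over a pair of rays -/

namespace FlatSurface

open Set Metric

section HeightFunctions

/-- Height of a point over the union of the rays spanned by `v` and `w`, measured in the direction
of `b`: points on the two rays have height `0`. -/
structure IsHeight (b v w : Plane) (l : Plane → ℝ) : Prop where
  ne_zero : b ≠ 0
  continuous : Continuous l
  smul : ∀ p, ∀ t : ℝ, 0 ≤ t → l (t • p) = t * l p
  add : ∀ p (s : ℝ), l (p + s • b) = l p + s
  eq_zero_iff : ∀ p, l p = 0 ↔ ∃ t : ℝ, 0 ≤ t ∧ (p = t • v ∨ p = t • w)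

lemma IsHeight.neg {b v w : Plane} {l : Plane → ℝ} (h : IsHeight b v w l) :
    IsHeight (-b) v w (fun p => -l p) := by
  refine ⟨neg_ne_zero.2 h.ne_zero, h.continuous.neg, fun p t ht => ?_, fun p s => ?_, fun p => ?_⟩
  · simp only [h.smul p t ht]; ring
  · rw [smul_neg, ← neg_smul, h.add]; ring
  · rw [neg_eq_zero, h.eq_zero_iff]

lemma IsHeight.const_smul {b v w : Plane} {l : Plane → ℝ} (h : IsHeight b v w l) {c : ℝ}
    (hc : 0 < c) : IsHeight (c • b) v w (fun p => l p / c) := by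
  refine ⟨smul_ne_zero hc.ne' h.ne_zero, h.continuous.div_const _, fun p t ht => ?_, fun p s => ?_,
    fun p => ?_⟩
  · simp only [h.smul p t ht]; ring
  · rw [smul_smul, h.add]; field_simp
  · rw [div_eq_zero_iff, or_iff_left hc.ne', h.eq_zero_iff]

/-- The part of a disk that lies above the two rays is connected. -/
lemma IsHeight.isPreconnected {b v w : Plane} {l : Plane → ℝ} (h : IsHeight b v w l) {ρ : ℝ}
    (hρ : 0 < ρ) : IsPreconnected (ball (0 : Plane) ρ ∩ {p | 0 < l p}) := by
  -- The set is star-shaped about a small multiple of `b`.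
  have hb := norm_pos_iff.2 h.ne_zero
  set c := ρ / (2 * ‖b‖)
  have hc : 0 < c := by positivity
  have h0 : l 0 = 0 := by simpa using h.smul 0 0 le_rfl
  have hcb : c • b ∈ ball (0 : Plane) ρ ∩ {p | 0 < l p} := by
    constructor
    · rw [mem_ball_zero_iff, norm_smul, Real.norm_of_nonneg hc.le]
      simp only [c]
      field_simp
      linarith
    · show 0 < l (c • b)
      rw [← zero_add (c • b), h.add, h0, zero_add]
      exact hc
  have hstar : StarConvex ℝ (c • b) (ball (0 : Plane) ρ ∩ {p | 0 < l p}) := by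
    rintro p ⟨hp1, hp2⟩ s t hs ht hst
    refine ⟨(convex_ball (0 : Plane) ρ) hcb.1 hp1 hs ht hst, ?_⟩
    have hp2' : 0 < l p := hp2
    show 0 < l (s • c • b + t • p)
    rw [add_comm, smul_smul, h.add, h.smul p t ht]
    rcases ht.eq_or_lt with rfl | ht'
    · have : s = 1 := by linarith
      simp [this, hc]
    · positivity
  exact (hstar.isPathConnected hcb).isConnected.isPreconnected

/-- Two different rays have a height function: take for `b` a vector that spans a line separating
the rays, and for the height of a point its signed distance, in units of `b`, to the point of the
two rays on its parallel to this line. -/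
lemma exists_isHeight {v w : Plane} (hv : v ≠ 0) (hw : w ≠ 0) (hvw : w ≠ (‖w‖ / ‖v‖) • v) :
    ∃ b l, IsHeight b v w l := by
  have hv' := norm_pos_iff.2 hv
  have hw' := norm_pos_iff.2 hw
  -- `n` is normal to a line that separates the two rays.
  set n : Plane := ‖v‖⁻¹ • v - ‖w‖⁻¹ • w with hn
  have hn0 : n ≠ 0 := by
    intro h
    apply hvw
    rw [hn, sub_eq_zero] at h
    rw [div_eq_mul_inv, ← smul_smul, h, smul_smul, mul_inv_cancel₀ hw'.ne', one_smul]
  have hlt : inner ℝ v w < ‖v‖ * ‖w‖ := by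
    refine lt_of_le_of_ne (real_inner_le_norm v w) fun h => hn0 ?_
    rw [inner_eq_norm_mul_iff_real] at h
    rw [hn, sub_eq_zero]
    have h2 : (‖v‖⁻¹ * ‖w‖⁻¹) • ‖w‖ • v = (‖v‖⁻¹ * ‖w‖⁻¹) • ‖v‖ • w := by rw [h]
    rw [smul_smul, smul_smul, mul_assoc, inv_mul_cancel₀ hw'.ne', mul_one, mul_comm ‖v‖⁻¹,
      mul_assoc, inv_mul_cancel₀ hv'.ne', mul_one] at h2
    exact h2
  set ξ : Plane → ℝ := fun p => inner ℝ n p with hξ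
  have hξv : 0 < ξ v := by
    simp only [hξ, hn, inner_sub_left, real_inner_smul_left, real_inner_self_eq_norm_sq]
    rw [real_inner_comm]
    have : ‖v‖⁻¹ * ‖v‖ ^ 2 - ‖w‖⁻¹ * inner ℝ v w = (‖v‖ * ‖w‖ - inner ℝ v w) / ‖w‖ := by
      field_simp
    rw [this]
    exact div_pos (by linarith) hw'
  have hξw : ξ w < 0 := by
    simp only [hξ, hn, inner_sub_left, real_inner_smul_left, real_inner_self_eq_norm_sq]
    have : ‖v‖⁻¹ * inner ℝ v w - ‖w‖⁻¹ * ‖w‖ ^ 2 = (inner ℝ v w - ‖v‖ * ‖w‖) / ‖v‖ := by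
      field_simp
    rw [this]
    exact div_neg_of_neg_of_pos (by linarith) hv'
  -- `b` spans the separating line, `ξ` and `ζ` are the coordinates with respect to `n` and `b`.
  set b : Plane := !₂[-n 1, n 0] with hb
  have hb0 : b ≠ 0 := by
    intro h
    apply hn0
    have h0 := congrArg (fun x : Plane => x 0) h
    have h1 := congrArg (fun x : Plane => x 1) h
    simp [hb] at h0 h1
    ext i
    fin_cases i <;> simp [h0, h1]
  have hξb : ξ b = 0 := by
    simp [hξ, hb, PiLp.inner_apply, Fin.sum_univ_two]; ring
  have hbb : inner ℝ b b ≠ 0 := inner_self_ne_zero.2 hb0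
  set ζ : Plane → ℝ := fun p => inner ℝ b p / inner ℝ b b with hζ
  have hζb : ζ b = 1 := div_self hbb
  have hξadd : ∀ p q, ξ (p + q) = ξ p + ξ q := fun p q => inner_add_right _ _ _
  have hξsmul : ∀ (t : ℝ) p, ξ (t • p) = t * ξ p := fun t p => real_inner_smul_right _ _ _
  have hζadd : ∀ p q, ζ (p + q) = ζ p + ζ q := fun p q => by
    simp only [hζ, inner_add_right, add_div]
  have hζsmul : ∀ (t : ℝ) p, ζ (t • p) = t * ζ p := fun t p => by
    simp only [hζ, real_inner_smul_right, mul_div_assoc]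
  have hsep : ∀ p, ξ p = 0 → ζ p = 0 → p = 0 := by
    intro p h1 h2
    have h2' : inner ℝ b p = (0 : ℝ) := by
      simpa only [hζ, div_eq_zero_iff, hbb, or_false] using h2
    have h1' : inner ℝ n p = (0 : ℝ) := h1
    simp [hb, PiLp.inner_apply, Fin.sum_univ_two] at h1' h2'
    have hnn : n 0 ^ 2 + n 1 ^ 2 ≠ 0 := by
      intro h
      apply hn0
      have e0 : n 0 = 0 := by nlinarith [sq_nonneg (n 0), sq_nonneg (n 1)]
      have e1 : n 1 = 0 := by nlinarith [sq_nonneg (n 0), sq_nonneg (n 1)]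
      ext i
      fin_cases i <;> simp [e0, e1]
    have e0 : (n 0 ^ 2 + n 1 ^ 2) * p 0 = 0 := by linear_combination n 0 * h1' - n 1 * h2'
    have e1 : (n 0 ^ 2 + n 1 ^ 2) * p 1 = 0 := by linear_combination n 1 * h1' + n 0 * h2'
    have e0' := (mul_eq_zero.1 e0).resolve_left hnn
    have e1' := (mul_eq_zero.1 e1).resolve_left hnn
    ext i
    fin_cases i <;> simp [e0', e1']
  set l : Plane → ℝ := fun p =>
    ζ p - max (ξ p) 0 * (ζ v / ξ v) - max (-ξ p) 0 * (ζ w / -ξ w) with hl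
  have hlpos : ∀ p, 0 ≤ ξ p → l p = ζ (p + (-(ξ p / ξ v)) • v) := fun p hp => by
    simp only [hl]
    rw [max_eq_left hp, max_eq_right (by linarith), hζadd, hζsmul]
    field_simp; ring
  have hlneg : ∀ p, ξ p ≤ 0 → l p = ζ (p + (-(ξ p / ξ w)) • w) := fun p hp => by
    simp only [hl]
    rw [max_eq_right hp, max_eq_left (by linarith), hζadd, hζsmul]
    have := hξw.ne
    field_simp; ring
  refine ⟨b, l, hb0, ?_, fun p t ht => ?_, fun p s => ?_, fun p => ⟨fun h => ?_, ?_⟩⟩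
  · simp only [hl, hζ, hξ]; fun_prop
  · have h1 : max (t * ξ p) 0 = t * max (ξ p) 0 := by rw [mul_max_of_nonneg _ _ ht, mul_zero]
    have h2 : max (-(t * ξ p)) 0 = t * max (-ξ p) 0 := by
      rw [mul_max_of_nonneg _ _ ht, mul_zero, mul_neg]
    simp only [hl, hξsmul, hζsmul, h1, h2]; ring
  · simp only [hl, hξadd, hζadd, hξsmul, hζsmul, hξb, hζb]; ring_nf
  · rcases le_total 0 (ξ p) with hp | hp
    · rw [hlpos p hp] at h
      have h3 := hsep _ (by rw [hξadd, hξsmul]; field_simp; ring) h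
      refine ⟨ξ p / ξ v, div_nonneg hp hξv.le, Or.inl ?_⟩
      rwa [neg_smul, ← sub_eq_add_neg, sub_eq_zero] at h3
    · rw [hlneg p hp] at h
      have h3 := hsep _ (by rw [hξadd, hξsmul]; have := hξw.ne; field_simp; ring) h
      refine ⟨ξ p / ξ w, div_nonneg_of_nonpos hp hξw.le, Or.inr ?_⟩
      rwa [neg_smul, ← sub_eq_add_neg, sub_eq_zero] at h3
  · rintro ⟨t, ht, rfl | rfl⟩
    · rw [hlpos _ (by rw [hξsmul]; positivity), hξsmul, mul_div_assoc, div_self hξv.ne', mul_one,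
        hζadd, hζsmul, hζsmul]
      ring
    · rw [hlneg _ (by rw [hξsmul]; nlinarith), hξsmul, mul_div_assoc, div_self hξw.ne, mul_one,
        hζadd, hζsmul, hζsmul]
      ring

variable {b v w : Plane} {l η : Plane → ℝ} {κ : ℝ}

/-- The map `(p, s) ↦ p + (s * η p) • b` is injective up to pairs that describe the same
displacement of the same point, when `s` is `1` above and `0` below the rays. -/
lemma IsHeight.shift_injective (h : IsHeight b v w l) (hκ : κ < 1) (hη0 : ∀ p, 0 ≤ η p)
    (hη : ∀ p t, 0 ≤ t → η p ≤ η (p + t • b) + κ * t) {p₁ p₂ : Plane} {s₁ s₂ : ℝ}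
    (hs₁ : s₁ ∈ Icc (0 : ℝ) 1) (hs₂ : s₂ ∈ Icc (0 : ℝ) 1)
    (h₁p : 0 < l p₁ → s₁ = 1) (h₁n : l p₁ < 0 → s₁ = 0)
    (h₂p : 0 < l p₂ → s₂ = 1) (h₂n : l p₂ < 0 → s₂ = 0)
    (heq : p₁ + (s₁ * η p₁) • b = p₂ + (s₂ * η p₂) • b) :
    p₁ = p₂ ∧ s₁ * η p₁ = s₂ * η p₂ := by
  have key : ∀ {p₁ p₂ : Plane} {s₁ s₂ : ℝ}, s₁ ∈ Icc (0 : ℝ) 1 → s₂ ∈ Icc (0 : ℝ) 1 →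
      (l p₁ < 0 → s₁ = 0) → (0 < l p₂ → s₂ = 1) →
      p₁ + (s₁ * η p₁) • b = p₂ + (s₂ * η p₂) • b → s₁ * η p₁ ≤ s₂ * η p₂ := by
    intro p₁ p₂ s₁ s₂ hs₁ hs₂ h₁ h₂ heq
    by_contra hcon
    push Not at hcon
    set δ := s₁ * η p₁ - s₂ * η p₂ with hδ
    have hδ0 : 0 < δ := by linarith
    have hp : p₂ = p₁ + δ • b := by
      rw [hδ, sub_smul, ← add_sub_assoc, heq, add_sub_cancel_right]
    have h2 : 0 ≤ s₂ * η p₂ := mul_nonneg hs₂.1 (hη0 _)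
    have hl1 : 0 ≤ l p₁ := by
      by_contra hneg
      push Not at hneg
      rw [h₁ hneg] at hδ
      linarith
    have hl2 : 0 < l p₂ := by rw [hp, h.add]; linarith
    have h3 := hη p₁ δ hδ0.le
    rw [← hp] at h3
    have h4 : s₁ * η p₁ ≤ η p₁ := mul_le_of_le_one_left (hη0 _) hs₁.2
    rw [h₂ hl2, one_mul] at hδ
    nlinarith
  have e := le_antisymm (key hs₁ hs₂ h₁n h₂p heq) (key hs₂ hs₁ h₂n h₁p heq.symm)
  rw [e] at heq
  exact ⟨add_right_cancel heq, e⟩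

/-- The map `(p, s) ↦ p + (s * η p) • b` is surjective, even if `s` has to be `1` above and `0`
below the rays: on each parallel to `b` this is the intermediate value theorem. -/
lemma IsHeight.shift_surjective (h : IsHeight b v w l) (hη0 : ∀ p, 0 ≤ η p)
    (hηc : Continuous η) (q : Plane) :
    ∃ p, ∃ s ∈ Icc (0 : ℝ) 1, (0 < l p → s = 1) ∧ (l p < 0 → s = 0) ∧
      p + (s * η p) • b = q := by
  rcases le_or_gt (l q) 0 with hq | hq
  · exact ⟨q, 0, by simp, fun h => absurd h (not_lt.2 hq), fun _ => rfl, by simp⟩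
  -- `x` is the point of the two rays below `q`.
  set x := q + (-l q) • b with hx
  have hlx : l x = 0 := by rw [hx, h.add]; ring
  have hqx : x + l q • b = q := by rw [hx, neg_smul]; abel
  rcases le_or_gt (l q) (η x) with hle | hgt
  · have hpos : 0 < η x := hq.trans_le hle
    refine ⟨x, l q / η x, ⟨by positivity, div_le_one_of_le₀ hle hpos.le⟩, by simp [hlx],
      by simp [hlx], ?_⟩
    rw [div_mul_cancel₀ _ hpos.ne', hqx]
  · have hc : ContinuousOn (fun t : ℝ => t + η (x + t • b)) (Icc 0 (l q)) := by fun_prop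
    obtain ⟨t, ht, hteq⟩ := intermediate_value_Icc hq.le hc
      (show l q ∈ Icc _ _ from ⟨by simpa using hgt.le, by simpa using hη0 _⟩)
    simp only at hteq
    have ht0 : t ≠ 0 := by
      rintro rfl
      simp at hteq
      linarith
    have htpos : 0 < t := lt_of_le_of_ne ht.1 ht0.symm
    have hlt : l (x + t • b) = t := by rw [h.add, hlx, zero_add]
    refine ⟨x + t • b, 1, by simp, fun _ => rfl, fun hneg => by linarith, ?_⟩
    rw [one_mul, add_assoc, ← add_smul, hteq, hqx]

end HeightFunctions

end FlatSurface

/-! ### The combinatorics of contractible edges -/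

namespace FlatSurface

open Set

section Contraction

lemma mem_faces_of_subset {V : Type*} (T : PreAbstractSimplicialComplex V) {s t : Finset V}
    (ht : t ∈ T.faces) (hst : s ⊆ t) (hs : s.Nonempty) : s ∈ T.faces :=
  (T.isRelLowerSet_faces ht).2 hst hs

variable {V : Type*} [DecidableEq V] {T : PreAbstractSimplicialComplex V} {a b : V}

lemma image_contract_of_notMem {s : Finset V} (hb : b ∉ s) :
    s.image (fun v => if v = b then a else v) = s := by
  ext x
  simp only [Finset.mem_image]
  constructor
  · rintro ⟨y, hy, rfl⟩
    rwa [if_neg (fun h => hb (by rwa [h] at hy))]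
  · intro hx
    exact ⟨x, hx, if_neg (fun h => hb (by rwa [h] at hx))⟩

lemma mem_contract_of_notMem {s : Finset V} (hs : s ∈ T.faces) (hb : b ∉ s) :
    s ∈ (contract T a b).faces :=
  ⟨s, hs, image_contract_of_notMem hb⟩

lemma notMem_of_mem_contract (hab : a ≠ b) {s : Finset V} (hs : s ∈ (contract T a b).faces) :
    b ∉ s := by
  obtain ⟨t, -, rfl⟩ := hs
  intro hb
  obtain ⟨x, -, hx⟩ := Finset.mem_image.1 hb
  split_ifs at hx with h
  · exact hab hx
  · exact h hx

lemma mem_of_mem_contract_of_notMem {s : Finset V} (hs : s ∈ (contract T a b).faces)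
    (ha : a ∉ s) : s ∈ T.faces := by
  obtain ⟨t, ht, rfl⟩ := hs
  have hb : b ∉ t := fun hb => ha (Finset.mem_image.2 ⟨b, hb, if_pos rfl⟩)
  change t.image (fun v => if v = b then a else v) ∈ T.faces
  rwa [image_contract_of_notMem hb]

/-- A face of the contraction that contains `a` comes from a face of `T` that contains `a` or from
one that contains `b`. -/
lemma mem_or_mem_of_mem_contract {s : Finset V} (hs : s ∈ (contract T a b).faces)
    (ha : a ∈ s) : s ∈ T.faces ∨ insert b (s.erase a) ∈ T.faces := by
  obtain ⟨t, ht, rfl⟩ := hs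
  by_cases hb : b ∈ t
  · right
    refine mem_faces_of_subset T ht ?_ ⟨b, Finset.mem_insert_self _ _⟩
    intro x hx
    rcases Finset.mem_insert.1 hx with rfl | hx
    · exact hb
    · obtain ⟨hxa, hx⟩ := Finset.mem_erase.1 hx
      obtain ⟨y, hy, hyx⟩ := Finset.mem_image.1 hx
      split_ifs at hyx with h
      · exact absurd hyx.symm hxa
      · rwa [← hyx]
  · left
    change t.image (fun v => if v = b then a else v) ∈ T.faces
    rwa [image_contract_of_notMem hb]

lemma insert_mem_contract {s : Finset V} (hs : insert b s ∈ T.faces) (hb : b ∉ s) :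
    insert a s ∈ (contract T a b).faces := by
  refine ⟨insert b s, hs, ?_⟩
  change (insert b s).image (fun v => if v = b then a else v) = _
  rw [Finset.image_insert, if_pos rfl, image_contract_of_notMem hb]

/-- The vertices that span a triangle together with the edge `{u, v}`. -/
def apexes (T : PreAbstractSimplicialComplex V) (u v : V) : Set V :=
  {y | {u, v, y} ∈ T.faces ∧ y ≠ u ∧ y ≠ v}

lemma ncard_apexes {T : PreAbstractSimplicialComplex V}
    (h2 : ∀ s ∈ T.faces, s.card = 2 → {t ∈ T.faces | s ⊆ t ∧ t.card = 3}.ncard = 2)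
    {u v : V} (huv : u ≠ v) (h : {u, v} ∈ T.faces) : (apexes T u v).ncard = 2 := by
  rw [← h2 _ h (Finset.card_pair huv)]
  have hinj : InjOn (fun y => ({u, v, y} : Finset V)) (apexes T u v) := by
    intro y hy y' hy' heq
    have : y ∈ ({u, v, y'} : Finset V) := by
      rw [← show ({u, v, y} : Finset V) = {u, v, y'} from heq]; simp
    simp only [Finset.mem_insert, Finset.mem_singleton] at this
    exact (this.resolve_left hy.2.1).resolve_left hy.2.2
  rw [← hinj.ncard_image]
  congr 1
  ext t
  constructor
  · rintro ⟨y, ⟨hy, hyu, hyv⟩, rfl⟩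
    refine ⟨hy, ?_, Finset.card_eq_three.2 ⟨u, v, y, huv, hyu.symm, hyv.symm, rfl⟩⟩
    intro x hx
    simp only [Finset.mem_insert, Finset.mem_singleton] at hx ⊢
    tauto
  · rintro ⟨ht, hst, hc⟩
    have hcard : (t \ {u, v}).card = 1 := by
      rw [Finset.card_sdiff_of_subset hst, hc, Finset.card_pair huv]
    obtain ⟨y, hy⟩ := Finset.card_eq_one.1 hcard
    have hyt : y ∈ t \ {u, v} := by rw [hy]; simp
    simp only [Finset.mem_sdiff, Finset.mem_insert, Finset.mem_singleton, not_or] at hyt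
    have hteq : ({u, v, y} : Finset V) = t := by
      rw [← Finset.sdiff_union_of_subset hst, hy]
      ext x; simp; tauto
    exact ⟨y, ⟨hteq ▸ ht, hyt.2.1, hyt.2.2⟩, hteq⟩

lemma eq_pair_of_ncard_eq_two {α : Type*} {s : Set α} (h : s.ncard = 2) {p q : α} (hp : p ∈ s)
    (hq : q ∈ s) (hpq : p ≠ q) : s = {p, q} := by
  have hfin : s.Finite := Set.finite_of_ncard_pos (by omega)
  refine (Set.eq_of_subset_of_ncard_le ?_ ?_ hfin).symm
  · rintro x (rfl | rfl) <;> assumption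
  · rw [h, Set.ncard_pair hpq]

/-- The part of the hypotheses on the triangulations `T` and `T/e` that is purely combinatorial. -/
structure ContractionData (T : PreAbstractSimplicialComplex V) (a b : V) : Prop where
  ne : a ≠ b
  mem : {a, b} ∈ T.faces
  two : ∀ s ∈ T.faces, s.card = 2 → {t ∈ T.faces | s ⊆ t ∧ t.card = 3}.ncard = 2
  two' : ∀ s ∈ (contract T a b).faces, s.card = 2 →
    {t ∈ (contract T a b).faces | s ⊆ t ∧ t.card = 3}.ncard = 2
  /-- The link of the vertex `a` of the contraction is connected. -/
  link : ∀ X : Set V, (∀ x ∈ X, ∀ y, y ≠ a → {a, x, y} ∈ (contract T a b).faces → y ∈ X) →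
    ∀ x ∈ X, x ≠ a → {a, x} ∈ (contract T a b).faces →
    ∀ y, y ≠ a → {a, y} ∈ (contract T a b).faces → y ∈ X

namespace ContractionData

lemma edge_mem_contract {x : V} (hxb : x ≠ b) (h : {a, x} ∈ T.faces) (hab : a ≠ b) :
    {a, x} ∈ (contract T a b).faces :=
  mem_contract_of_notMem h (by simp [hab.symm, hxb.symm])

lemma apexes_contract_subset (hab : a ≠ b) (x : V) (hxa : x ≠ a) :
    apexes (contract T a b) a x ⊆ {y | (y ∈ apexes T a x ∨ y ∈ apexes T b x) ∧ y ≠ a ∧ y ≠ b} := by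
  rintro y ⟨hy, hya, hyx⟩
  have hb := notMem_of_mem_contract hab hy
  simp only [Finset.mem_insert, Finset.mem_singleton, not_or] at hb
  refine ⟨?_, hya, (Ne.symm hb.2.2)⟩
  rcases mem_or_mem_of_mem_contract hy (by simp) with h | h
  · exact Or.inl ⟨h, hya, hyx⟩
  · right
    have he : insert b (({a, x, y} : Finset V).erase a) = {b, x, y} := by
      rw [Finset.erase_insert]
      simp [hxa.symm, hya.symm]
    rw [he] at h
    exact ⟨h, (Ne.symm hb.2.2), hyx⟩

lemma subset_apexes_contract (hab : a ≠ b) (x : V) (hxb : x ≠ b) {y : V}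
    (hy : y ∈ apexes T a x ∨ y ∈ apexes T b x) (hya : y ≠ a) (hyb : y ≠ b) :
    y ∈ apexes (contract T a b) a x := by
  rcases hy with ⟨h, -, hyx⟩ | ⟨h, -, hyx⟩
  · exact ⟨mem_contract_of_notMem h (by simp [hab.symm, hxb.symm, hyb.symm]), hya, hyx⟩
  · exact ⟨insert_mem_contract h (by simp [hxb.symm, hyb.symm]), hya, hyx⟩

variable (h : ContractionData T a b)
include h

/-- The link condition: a common neighbour of the two ends of a contractible edge spans a triangle
with this edge. The exceptions would form a union of components of the link of the contracted
vertex. -/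
lemma triangle_mem {x : V} (hxa : x ≠ a) (hxb : x ≠ b) (h1 : {a, x} ∈ T.faces)
    (h2 : {b, x} ∈ T.faces) : {a, b, x} ∈ T.faces := by
  by_contra hx
  set X : Set V := {x | x ≠ a ∧ x ≠ b ∧ {a, x} ∈ T.faces ∧ {b, x} ∈ T.faces ∧ {a, b, x} ∉ T.faces}
  have hfin : ∀ {s : Set V}, s.ncard = 2 → s.Finite := fun hs =>
    Set.finite_of_ncard_pos (by omega)
  have hclosed : ∀ x ∈ X, ∀ y, y ≠ a → {a, x, y} ∈ (contract T a b).faces → y ∈ X := by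
    rintro x ⟨hxa, hxb, h1, h2, h3⟩ y hya hy
    by_cases hyx : y = x
    · rw [hyx]; exact ⟨hxa, hxb, h1, h2, h3⟩
    have hA := ncard_apexes h.two hxa.symm h1
    have hB := ncard_apexes h.two hxb.symm h2
    have hK := ncard_apexes h.two' hxa.symm (edge_mem_contract hxb h1 h.ne)
    have hAb : b ∉ apexes T a x := fun hb => h3 (by
      have := hb.1
      rwa [Finset.pair_comm x b] at this)
    have hBa : a ∉ apexes T b x := fun ha => h3 (by
      have := ha.1
      rwa [show ({b, x, a} : Finset V) = {a, b, x} by ext; simp; tauto] at this)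
    have hAK : apexes T a x = apexes (contract T a b) a x :=
      Set.eq_of_subset_of_ncard_le (fun y hy => subset_apexes_contract h.ne x hxb (Or.inl hy) hy.2.1
        (fun hyb => hAb (hyb ▸ hy))) (by rw [hA, hK]) (hfin hK)
    have hBK : apexes T b x = apexes (contract T a b) a x :=
      Set.eq_of_subset_of_ncard_le (fun y hy => subset_apexes_contract h.ne x hxb (Or.inr hy)
        (fun hya => hBa (hya ▸ hy)) hy.2.1) (by rw [hB, hK]) (hfin hK)
    have hyK : y ∈ apexes (contract T a b) a x := ⟨hy, hya, hyx⟩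
    have hyA : y ∈ apexes T a x := hAK ▸ hyK
    have hyB : y ∈ apexes T b x := hBK ▸ hyK
    have hyb : y ≠ b := hyB.2.1
    have hay : {a, y} ∈ T.faces := mem_faces_of_subset T hyA.1 (by intro z; simp; tauto) (by simp)
    have hby : {b, y} ∈ T.faces := mem_faces_of_subset T hyB.1 (by intro z; simp; tauto) (by simp)
    refine ⟨hya, hyb, hay, hby, fun haby => ?_⟩
    -- Otherwise `x` would be the only apex over the edge `{a, y}` of the contraction.
    have hA' : apexes T a y = {x, b} := eq_pair_of_ncard_eq_two
      (ncard_apexes h.two hya.symm hay)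
      ⟨by have := hyA.1; rwa [Finset.pair_comm x y] at this, hxa, Ne.symm hyx⟩
      ⟨by rwa [Finset.pair_comm y b], h.ne.symm, hyb.symm⟩ hxb
    have hB' : apexes T b y = {x, a} := eq_pair_of_ncard_eq_two
      (ncard_apexes h.two hyb.symm hby)
      ⟨by have := hyB.1; rwa [Finset.pair_comm x y] at this, hxb, Ne.symm hyx⟩
      ⟨by rwa [show ({b, y, a} : Finset V) = {a, b, y} by ext; simp; tauto], h.ne, hya.symm⟩ hxa
    have hK' := ncard_apexes h.two' hya.symm (edge_mem_contract hyb hay h.ne)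
    have hsub : apexes (contract T a b) a y ⊆ {x} := by
      intro z hz
      obtain ⟨hz, hza, hzb⟩ := apexes_contract_subset h.ne y hya hz
      rw [hA', hB'] at hz
      rcases hz with (hz | hz) | (hz | hz)
      · exact hz
      · exact absurd hz hzb
      · exact hz
      · exact absurd hz hza
    have := Set.ncard_le_ncard hsub
    rw [hK', Set.ncard_singleton] at this
    omega
  obtain ⟨c, d, -, hcd⟩ := Set.ncard_eq_two.1 (ncard_apexes h.two h.ne h.mem)
  have hc : c ∈ apexes T a b := by rw [hcd]; simp
  have hac : {a, c} ∈ T.faces := mem_faces_of_subset T hc.1 (by intro z; simp; tauto) (by simp)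
  have hcX : c ∈ X := h.link X hclosed x ⟨hxa, hxb, h1, h2, hx⟩ hxa
    (edge_mem_contract hxb h1 h.ne) c hc.2.1 (edge_mem_contract hc.2.2 hac h.ne)
  exact hcX.2.2.2.2 hc.1

/-- The two triangles at a contractible edge, and how the faces of the contraction that come from
faces at `a` and from faces at `b` meet. -/
lemma exists_apexes : ∃ c d, c ≠ d ∧ c ≠ a ∧ c ≠ b ∧ d ≠ a ∧ d ≠ b ∧
    {a, b, c} ∈ T.faces ∧ {a, b, d} ∈ T.faces ∧
    (∀ x, x ≠ a → x ≠ b → {a, b, x} ∈ T.faces → x = c ∨ x = d) ∧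
    (∀ s ∈ T.faces, a ∈ s → b ∉ s → insert b (s.erase a) ∈ T.faces → s ⊆ {a, c} ∨ s ⊆ {a, d}) ∧
    (∃ s ∈ (contract T a b).faces, a ∈ s ∧ s ∉ T.faces) ∧
    (∃ s ∈ (contract T a b).faces, a ∈ s ∧ insert b (s.erase a) ∉ T.faces) := by
  obtain ⟨c, d, hcd, hapex⟩ := Set.ncard_eq_two.1 (ncard_apexes h.two h.ne h.mem)
  have hc : c ∈ apexes T a b := by rw [hapex]; simp
  have hd : d ∈ apexes T a b := by rw [hapex]; simp
  obtain ⟨hc1, hca, hcb⟩ := hc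
  obtain ⟨hd1, hda, hdb⟩ := hd
  have honly : ∀ x, x ≠ a → x ≠ b → {a, b, x} ∈ T.faces → x = c ∨ x = d := by
    intro x hxa hxb hx
    have : x ∈ apexes T a b := ⟨hx, hxa, hxb⟩
    rwa [hapex] at this
  have hac : {a, c} ∈ T.faces := mem_faces_of_subset T hc1 (by intro z; simp; tauto) (by simp)
  have hbc : {b, c} ∈ T.faces := mem_faces_of_subset T hc1 (by intro z; simp; tauto) (by simp)
  have hba : a ∈ apexes T b c :=
    ⟨by rwa [show ({b, c, a} : Finset V) = {a, b, c} by ext; simp; tauto], h.ne, hca.symm⟩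
  have hab : b ∈ apexes T a c :=
    ⟨by rwa [show ({a, c, b} : Finset V) = {a, b, c} by ext; simp; tauto], h.ne.symm, hcb.symm⟩
  have hnot : ¬ ({a, c, d} ∈ T.faces ∧ {b, c, d} ∈ T.faces) := by
    rintro ⟨h1, h2⟩
    have hA := eq_pair_of_ncard_eq_two (ncard_apexes h.two hca.symm hac) hab
      ⟨h1, hda, hcd.symm⟩ hdb.symm
    have hB := eq_pair_of_ncard_eq_two (ncard_apexes h.two hcb.symm hbc) hba
      ⟨h2, hdb, hcd.symm⟩ hda.symm
    have hsub : apexes (contract T a b) a c ⊆ {d} := by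
      intro z hz
      obtain ⟨hz, hza, hzb⟩ := apexes_contract_subset h.ne c hca hz
      rw [hA, hB] at hz
      rcases hz with (hz | hz) | (hz | hz)
      · exact absurd hz hzb
      · exact hz
      · exact absurd hz hza
      · exact hz
    have := Set.ncard_le_ncard hsub
    rw [ncard_apexes h.two' hca.symm (edge_mem_contract hcb hac h.ne), Set.ncard_singleton] at this
    omega
  have hmeet : ∀ s ∈ T.faces, a ∈ s → b ∉ s → insert b (s.erase a) ∈ T.faces →
      s ⊆ {a, c} ∨ s ⊆ {a, d} := by
    intro s hs has hbs hs'
    have hsub : ∀ z ∈ s, z = a ∨ z = c ∨ z = d := by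
      intro z hz
      by_cases hza : z = a
      · exact Or.inl hza
      have hzb : z ≠ b := fun h => hbs (h ▸ hz)
      refine Or.inr (honly z hza hzb (h.triangle_mem hza hzb ?_ ?_))
      · refine mem_faces_of_subset T hs ?_ (by simp)
        intro y hy
        rcases Finset.mem_insert.1 hy with rfl | hy
        · exact has
        · rw [Finset.mem_singleton.1 hy]; exact hz
      · refine mem_faces_of_subset T hs' ?_ (by simp)
        intro y hy
        rcases Finset.mem_insert.1 hy with rfl | hy
        · simp
        · rw [Finset.mem_singleton.1 hy]; simp [hza, hz]
    by_cases hcs : c ∈ s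
    · by_cases hds : d ∈ s
      · exfalso
        apply hnot
        constructor
        · refine mem_faces_of_subset T hs ?_ (by simp)
          intro y hy
          simp only [Finset.mem_insert, Finset.mem_singleton] at hy
          rcases hy with rfl | rfl | rfl <;> assumption
        · refine mem_faces_of_subset T hs' ?_ (by simp)
          intro y hy
          simp only [Finset.mem_insert, Finset.mem_singleton] at hy
          rcases hy with rfl | rfl | rfl
          · simp
          · simp [hca, hcs]
          · simp [hda, hds]
      · left
        intro z hz
        rcases hsub z hz with rfl | rfl | rfl
        · simp
        · simp
        · exact absurd hz hds
    · right
      intro z hz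
      rcases hsub z hz with rfl | rfl | rfl
      · simp
      · exact absurd hz hcs
      · simp
  -- The triangle on the other side of `{b, c}` does not come from a triangle at `a`, and the
  -- triangle on the other side of `{a, c}` does not come from a triangle at `b`.
  obtain ⟨x, hx, hxa⟩ := Set.exists_ne_of_one_lt_ncard
    (show 1 < (apexes T b c).ncard by rw [ncard_apexes h.two hcb.symm hbc]; omega) a
  obtain ⟨y, hy, hyb⟩ := Set.exists_ne_of_one_lt_ncard
    (show 1 < (apexes T a c).ncard by rw [ncard_apexes h.two hca.symm hac]; omega) b
  have hno : ∀ z, z ≠ a → z ≠ b → z ≠ c → {a, c, z} ∈ T.faces → {b, c, z} ∈ T.faces → False := by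
    intro z hza hzb hzc h1 h2
    have hz : z = c ∨ z = d := honly z hza hzb (h.triangle_mem hza hzb
      (mem_faces_of_subset T h1 (by intro z; simp; tauto) (by simp))
      (mem_faces_of_subset T h2 (by intro z; simp; tauto) (by simp)))
    rcases hz with rfl | rfl
    · exact hzc rfl
    · exact hnot ⟨h1, h2⟩
  refine ⟨c, d, hcd, hca, hcb, hda, hdb, hc1, hd1, honly, hmeet, ⟨{a, c, x}, ?_, by simp, ?_⟩,
    ⟨{a, c, y}, ?_, by simp, ?_⟩⟩
  · exact insert_mem_contract hx.1 (by simp [hcb.symm, hx.2.1.symm])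
  · exact fun h1 => hno x hxa hx.2.1 hx.2.2 h1 hx.1
  · exact mem_contract_of_notMem hy.1 (by simp [h.ne.symm, hcb.symm, hyb.symm])
  · intro h1
    rw [Finset.erase_insert (by simp [hca.symm, hy.2.1.symm])] at h1
    exact hno y hy.2.1 hyb hy.2.2 hy.1 h1

end ContractionData
end Contraction

end FlatSurface

/-! ### Realizations and links of vertices -/

namespace FlatSurface

open Set Metric

section Realizations

variable {V : Type*} [Fintype V] {K : PreAbstractSimplicialComplex V}

lemma Realization.nonneg (p : Realization K) (v : V) : 0 ≤ p.1 v := p.2.1.1 v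

lemma Realization.sum_eq_one (p : Realization K) : ∑ v, p.1 v = 1 := p.2.1.2

lemma Realization.continuous_apply (v : V) : Continuous fun p : Realization K => p.1 v :=
  (_root_.continuous_apply v).comp continuous_subtype_val

lemma mem_closedFace_iff {p : Realization K} {s : Finset V} :
    p ∈ closedFace K s ↔ ∀ v, v ∉ s → p.1 v = 0 := by
  constructor
  · intro h v hv
    by_contra hne
    exact hv (h hne)
  · intro h v hv
    by_contra hvs
    exact hv (h v hvs)

lemma isClosed_closedFace (s : Finset V) : IsClosed (closedFace K s) := by
  have : closedFace K s = ⋂ v, ⋂ (_ : v ∉ s), {p : Realization K | p.1 v = 0} := by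
    ext p
    simp [mem_closedFace_iff]
  rw [this]
  exact isClosed_iInter fun v => isClosed_iInter fun _ =>
    isClosed_eq (Realization.continuous_apply v) continuous_const

/-- The union of the closed faces with a given property is closed. -/
lemma isClosed_setOf_exists_closedFace (P : Finset V → Prop) :
    IsClosed {p : Realization K | ∃ s, P s ∧ p ∈ closedFace K s} := by
  have : {p : Realization K | ∃ s, P s ∧ p ∈ closedFace K s} = ⋃ s ∈ {s | P s}, closedFace K s := by
    ext p; simp
  rw [this]
  exact (Set.toFinite _).isClosed_biUnion fun s _ => isClosed_closedFace s

lemma closedFace_mono {s t : Finset V} (hst : s ⊆ t) : closedFace K s ⊆ closedFace K t :=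
  fun _ hp _ hv => hst (hp hv)

/-- The set of vertices with nonzero barycentric coordinate. -/
noncomputable def Realization.supp (p : Realization K) : Finset V :=
  Finset.univ.filter fun v => p.1 v ≠ 0

lemma Realization.mem_supp {p : Realization K} {v : V} : v ∈ p.supp ↔ p.1 v ≠ 0 := by
  simp [Realization.supp]

lemma Realization.mem_closedFace_supp (p : Realization K) : p ∈ closedFace K p.supp := by
  rw [mem_closedFace_iff]
  intro v hv
  simpa [Realization.mem_supp] using hv

lemma Realization.supp_subset {p : Realization K} {s : Finset V} (hp : p ∈ closedFace K s) :
    p.supp ⊆ s := by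
  intro v hv
  by_contra h
  exact Realization.mem_supp.1 hv (mem_closedFace_iff.1 hp v h)

lemma Realization.supp_nonempty (p : Realization K) : p.supp.Nonempty := by
  by_contra h
  rw [Finset.not_nonempty_iff_eq_empty] at h
  have h0 : ∀ v, p.1 v = 0 := fun v => by
    by_contra hv
    have : v ∈ p.supp := Realization.mem_supp.2 hv
    simp [h] at this
  have := p.sum_eq_one
  simp [h0] at this

lemma Realization.supp_mem (p : Realization K) : p.supp ∈ K.faces := by
  obtain ⟨s, hs, hps⟩ := p.2.2
  exact mem_faces_of_subset K hs (Realization.supp_subset hps) p.supp_nonempty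

variable [DecidableEq V]

lemma vertexPoint_mem_closedFace {v : V} (hv : {v} ∈ K.faces) {s : Finset V} (hs : v ∈ s) :
    vertexPoint K v hv ∈ closedFace K s := by
  rw [mem_closedFace_iff]
  intro u hu
  exact Pi.single_eq_of_ne (fun h => hu (by rwa [h])) _

lemma eq_vertexPoint_of_mem_closedFace {v : V} (hv : {v} ∈ K.faces) {p : Realization K}
    (hp : p ∈ closedFace K {v}) : p = vertexPoint K v hv := by
  rw [mem_closedFace_iff] at hp
  have hsum := p.sum_eq_one
  rw [Finset.sum_eq_single v (fun u _ hu => hp u (by simpa using hu)) (by simp)] at hsum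
  apply Subtype.ext
  funext u
  by_cases huv : u = v
  · subst huv; simpa [vertexPoint] using hsum
  · rw [hp u (by simpa using huv)]; simp [vertexPoint, huv]

lemma apply_add_apply_of_mem_closedFace {x y : V} (hxy : x ≠ y) {p : Realization K}
    (hp : p ∈ closedFace K {x, y}) : p.1 x + p.1 y = 1 := by
  rw [mem_closedFace_iff] at hp
  rw [← p.sum_eq_one, ← Finset.sum_pair hxy]
  exact Finset.sum_subset (Finset.subset_univ _) fun u _ hu => hp u hu

lemma mem_closedFace_inter {s t : Finset V} {p : Realization K} (hs : p ∈ closedFace K s)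
    (ht : p ∈ closedFace K t) : p ∈ closedFace K (s ∩ t) := by
  rw [mem_closedFace_iff] at *
  intro v hv
  by_cases h : v ∈ s
  · exact ht v fun h' => hv (Finset.mem_inter.2 ⟨h, h'⟩)
  · exact hs v h

/-- Every face at the vertex `a` has points arbitrarily close to `a` with support this face. -/
lemma exists_supp_eq_of_mem_nhds {a : V} (ha : {a} ∈ K.faces) {s : Finset V} (hs : s ∈ K.faces)
    (has : a ∈ s) {W : Set (Realization K)} (hW : W ∈ 𝓝 (vertexPoint K a ha)) :
    ∃ q ∈ W, q.supp = s := by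
  have hc : (0 : ℝ) < s.card := by exact_mod_cast Finset.card_pos.2 ⟨a, has⟩
  -- The barycentre of `s` is moved towards `a`.
  set q : ℝ → V → ℝ := fun t v => (1 - t) * (Pi.single a (1 : ℝ) : V → ℝ) v +
    t * (if v ∈ s then (s.card : ℝ)⁻¹ else 0) with hq
  have hsingle0 : ∀ v, 0 ≤ (Pi.single a (1 : ℝ) : V → ℝ) v := fun v => by
    by_cases h : v = a
    · subst h; simp
    · simp [h]
  have hmem : ∀ t ∈ Icc (0 : ℝ) 1, q t ∈ stdSimplex ℝ V ∧
      ∃ s ∈ K.faces, Function.support (q t) ⊆ (s : Set V) := by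
    intro t ht
    refine ⟨⟨fun v => ?_, ?_⟩, s, hs, fun v hv => ?_⟩
    · have h1 : (0 : ℝ) ≤ if v ∈ s then (s.card : ℝ)⁻¹ else 0 := by split_ifs <;> positivity
      have h2 : 0 ≤ 1 - t := by linarith [ht.2]
      exact add_nonneg (mul_nonneg h2 (hsingle0 v)) (mul_nonneg ht.1 h1)
    · simp only [hq]
      rw [Finset.sum_add_distrib, ← Finset.mul_sum, ← Finset.mul_sum, Finset.sum_pi_single',
        Finset.sum_ite_mem]
      simp [hc.ne']
    · by_contra hvs
      have hvs' : v ∉ s := hvs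
      apply hv
      have hva : v ≠ a := fun h => hvs' (h ▸ has)
      simp [hq, hvs', hva]
  set Q : Icc (0 : ℝ) 1 → Realization K := fun t => ⟨q t, hmem t t.2⟩
  have hQ : Continuous Q := by
    refine Continuous.subtype_mk ?_ _
    refine continuous_pi fun v => ?_
    simp only [hq]
    fun_prop
  have hQ0 : Q 0 = vertexPoint K a ha := by
    apply Subtype.ext
    funext v
    simp [Q, hq, vertexPoint]
  have hev : ∀ᶠ t in 𝓝 (0 : Icc (0 : ℝ) 1), Q t ∈ W :=
    hQ.continuousAt.eventually (by rw [hQ0]; exact hW)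
  obtain ⟨ε, hε, hball⟩ := Metric.eventually_nhds_iff_ball.1 hev
  set t : Icc (0 : ℝ) 1 := ⟨min (ε / 2) 1, le_min (by positivity) zero_le_one, min_le_right _ _⟩
  have ht0 : (0 : ℝ) < t := lt_min (by positivity) one_pos
  refine ⟨Q t, hball t ?_, ?_⟩
  · rw [mem_ball, Subtype.dist_eq, Real.dist_eq]
    have : (t : ℝ) ≤ ε / 2 := min_le_left _ _
    simp only [Icc.coe_zero, sub_zero]
    rw [abs_of_pos ht0]
    linarith
  · ext v
    rw [Realization.mem_supp]
    constructor
    · intro hv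
      by_contra hvs
      have hva : v ≠ a := fun h => hvs (h ▸ has)
      exact hv (by simp [Q, hq, hvs, hva])
    · intro hv
      have h2 : (0 : ℝ) ≤ 1 - t := by linarith [t.2.2]
      have : 0 < q t v := by
        simp only [hq, if_pos hv]
        have := mul_nonneg h2 (hsingle0 v)
        have : 0 < (t : ℝ) * (s.card : ℝ)⁻¹ := by positivity
        linarith
      exact this.ne'

end Realizations

section Link

/-- The punctured disk is the radial image of the punctured plane. -/
lemma isPreconnected_ball_diff_singleton {ρ : ℝ} (hρ : 0 < ρ) :
    IsPreconnected (ball (0 : Plane) ρ \ {0}) := by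
  have hrank : 1 < Module.rank ℝ Plane := by
    rw [← Module.finrank_eq_rank]; simp
  have h := (isConnected_compl_singleton_of_one_lt_rank hrank (0 : Plane)).isPreconnected
  have hc : Continuous fun y : Plane => (ρ / (1 + ‖y‖)) • y :=
    (continuous_const.div (continuous_const.add continuous_norm) fun y =>
      (by positivity : (1 : ℝ) + ‖y‖ ≠ 0)).smul continuous_id
  convert! h.image _ hc.continuousOn using 1
  ext z
  constructor
  · rintro ⟨hz, hz0⟩
    rw [mem_ball_zero_iff] at hz
    have hpos : 0 < ρ - ‖z‖ := by linarith
    refine ⟨(ρ - ‖z‖)⁻¹ • z, ?_, ?_⟩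
    · simp only [mem_compl_iff, mem_singleton_iff] at hz0 ⊢
      exact smul_ne_zero (inv_ne_zero hpos.ne') hz0
    · simp only [norm_smul, norm_inv, Real.norm_of_nonneg hpos.le, smul_smul]
      have : ρ / (1 + (ρ - ‖z‖)⁻¹ * ‖z‖) * (ρ - ‖z‖)⁻¹ = 1 := by
        field_simp
        ring_nf
      rw [this, one_smul]
  · rintro ⟨y, hy, rfl⟩
    have hy' : y ≠ 0 := hy
    constructor
    · rw [mem_ball_zero_iff, norm_smul, Real.norm_of_nonneg (by positivity), div_mul_eq_mul_div,
        div_lt_iff₀ (by positivity)]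
      nlinarith [norm_nonneg y]
    · exact smul_ne_zero (by positivity) hy'

variable {S : Type*} [MetricSpace S] {r : ℝ} {V : Type*} [Fintype V] [DecidableEq V]
  {K : PreAbstractSimplicialComplex V}

/-- The link of a vertex in a triangulated surface is connected, because small punctured disks
about the vertex are connected. -/
lemma IsFlatSpace.link_connected (hS : IsFlatSpace S r) (f : Realization K ≃ₜ S) {a : V}
    (ha : {a} ∈ K.faces) (X : Set V)
    (hX : ∀ x ∈ X, ∀ y, y ≠ a → {a, x, y} ∈ K.faces → y ∈ X) (x : V) (hxX : x ∈ X) (hxa : x ≠ a)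
    (hx : {a, x} ∈ K.faces) (y : V) (hya : y ≠ a) (hy : {a, y} ∈ K.faces) : y ∈ X := by
  by_contra hyX
  obtain ⟨χ, p₀, hp₀, hχ₀⟩ := hS.disk (f (vertexPoint K a ha))
  obtain ⟨χ, hχ0, hχ⟩ : ∃ χ : Plane → S, χ 0 = f (vertexPoint K a ha) ∧ IsIsometricDisk χ 0 r :=
    ⟨_, by simpa using hp₀, hχ₀.comp_affine (q := 0) (LinearIsometryEquiv.refl ℝ Plane)⟩
  have hstar : IsOpen {p : Realization K | 0 < p.1 a} :=
    isOpen_lt continuous_const (Realization.continuous_apply a)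
  have hopen : IsOpen (f '' {p : Realization K | 0 < p.1 a}) := f.isOpenMap _ hstar
  obtain ⟨ρ', hρ', hsub⟩ := Metric.isOpen_iff.1 hopen (χ 0)
    (by rw [hχ0]; exact ⟨_, show (0 : ℝ) < (Pi.single a 1 : V → ℝ) a by simp, rfl⟩)
  set ρ := min ρ' r
  have hρ : 0 < ρ := lt_min hρ' hS.pos
  have hdisk := hχ.mono (q := 0) hρ (by simp [ρ])
  have hcont : ContinuousOn χ (ball 0 ρ) := fun z hz =>
    (hdisk.isLocallyIsometricAt hz).continuousAt.continuousWithinAt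
  have hpre : IsPreconnected (χ '' (ball (0 : Plane) ρ \ {0})) :=
    (isPreconnected_ball_diff_singleton hρ).image _ (hcont.mono sdiff_subset)
  set D := χ '' (ball (0 : Plane) ρ \ {0})
  have hD : D = ball (χ 0) ρ \ {χ 0} := by
    have h1 : χ '' (ball (0 : Plane) ρ \ {0}) = χ '' ball 0 ρ \ χ '' {0} :=
      hdisk.injOn.image_sdiff_subset (by simpa using hρ)
    rw [show D = _ from h1, hdisk.image_eq, image_singleton]
  set A₁ : Set (Realization K) :=
    {p | ∃ s, (s ∈ K.faces ∧ a ∈ s ∧ ∀ z ∈ s, z ≠ a → z ∈ X) ∧ p ∈ closedFace K s}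
  set A₂ : Set (Realization K) :=
    {p | ∃ s, (s ∈ K.faces ∧ a ∈ s ∧ ∀ z ∈ s, z ≠ a → z ∉ X) ∧ p ∈ closedFace K s}
  have hclosed₁ : IsClosed (f '' A₁) := f.isClosedMap _ (isClosed_setOf_exists_closedFace _)
  have hclosed₂ : IsClosed (f '' A₂) := f.isClosedMap _ (isClosed_setOf_exists_closedFace _)
  have hcover : D ⊆ f '' A₁ ∪ f '' A₂ := by
    intro z hz
    rw [hD] at hz
    obtain ⟨p, hp, rfl⟩ := hsub (ball_subset_ball (min_le_left _ _) hz.1)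
    have hpa : a ∈ p.supp := Realization.mem_supp.2 (ne_of_gt hp)
    by_cases hmeet : ∃ z ∈ p.supp, z ≠ a ∧ z ∈ X
    · obtain ⟨z, hz, hza, hzX⟩ := hmeet
      refine Or.inl ⟨p, ⟨p.supp, ⟨p.supp_mem, hpa, fun z' hz' hza' => ?_⟩,
        p.mem_closedFace_supp⟩, rfl⟩
      refine hX z hzX z' hza' (mem_faces_of_subset K p.supp_mem ?_ (by simp))
      intro u hu
      simp only [Finset.mem_insert, Finset.mem_singleton] at hu
      rcases hu with rfl | rfl | rfl <;> assumption
    · push Not at hmeet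
      exact Or.inr ⟨p, ⟨p.supp, ⟨p.supp_mem, hpa, hmeet⟩, p.mem_closedFace_supp⟩, rfl⟩
  have hball : f ⁻¹' ball (χ 0) ρ ∈ 𝓝 (vertexPoint K a ha) :=
    f.continuous.continuousAt.preimage_mem_nhds (by rw [hχ0]; exact ball_mem_nhds _ hρ)
  have hne : ∀ z, z ≠ a → {a, z} ∈ K.faces → ∃ q : Realization K, q.supp = {a, z} ∧ f q ∈ D := by
    intro z hza hz
    obtain ⟨q, hq, hqs⟩ := exists_supp_eq_of_mem_nhds ha hz (by simp) hball
    refine ⟨q, hqs, ?_⟩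
    rw [hD]
    refine ⟨hq, fun h => ?_⟩
    rw [mem_singleton_iff, hχ0] at h
    have hqv := f.injective h
    have hzq : z ∈ q.supp := by rw [hqs]; simp
    rw [Realization.mem_supp, hqv] at hzq
    exact hzq (by simp [vertexPoint, hza])
  obtain ⟨q₁, hq₁, hq₁D⟩ := hne x hxa hx
  obtain ⟨q₂, hq₂, hq₂D⟩ := hne y hya hy
  have h1 : (D ∩ f '' A₁).Nonempty := ⟨f q₁, hq₁D, q₁, ⟨_, ⟨hx, by simp, fun z hz hza => by
    simp only [Finset.mem_insert, Finset.mem_singleton] at hz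
    rwa [hz.resolve_left hza]⟩, hq₁ ▸ q₁.mem_closedFace_supp⟩, rfl⟩
  have h2 : (D ∩ f '' A₂).Nonempty := ⟨f q₂, hq₂D, q₂, ⟨_, ⟨hy, by simp, fun z hz hza => by
    simp only [Finset.mem_insert, Finset.mem_singleton] at hz
    rwa [hz.resolve_left hza]⟩, hq₂ ▸ q₂.mem_closedFace_supp⟩, rfl⟩
  obtain ⟨z, hzD, ⟨p, ⟨s, ⟨hs, -, hs'⟩, hps⟩, rfl⟩, ⟨p', ⟨t, ⟨ht, -, ht'⟩, hpt⟩, hpp'⟩⟩ :=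
    isPreconnected_closed_iff.1 hpre _ _ hclosed₁ hclosed₂ hcover h1 h2
  rw [f.injective hpp'] at hpt
  have hpv : p = vertexPoint K a ha := by
    apply eq_vertexPoint_of_mem_closedFace
    refine closedFace_mono ?_ (mem_closedFace_inter hps hpt)
    intro u hu
    rw [Finset.mem_inter] at hu
    rw [Finset.mem_singleton]
    by_contra hua
    exact ht' u hu.2 hua (hs' u hu.1 hua)
  rw [hD, hpv, ← hχ0] at hzD
  exact hzD.2 rfl

end Link

end FlatSurface

/-! ### Star-shaped neighbourhoods of a vertex -/

namespace FlatSurface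

open Set Metric Filter

section Rays

variable {S : Type*} [MetricSpace S] {r R : ℝ} {ψ : Plane → S}

/-- A unique shortest path that starts at the centre of the exponential map lifts to a segment. -/
lemma IsFlatSpace.exists_segment_eq_trace (hS : IsFlatSpace S r)
    (hψ : ∀ p ∈ ball (0 : Plane) R, IsIsometricDisk ψ p r) {q : S} {A : Set S}
    (hR : dist (ψ 0) q < R) (hne : ψ 0 ≠ q) (hA : IsUniqueShortestPathTrace (ψ 0) q A) :
    ∃ v : Plane, v ≠ 0 ∧ ψ v = q ∧ segment ℝ 0 v ⊆ ball 0 R ∧ ψ '' segment ℝ 0 v = A ∧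
      ∀ y ∈ segment ℝ 0 v, dist (ψ 0) (ψ y) = ‖y‖ := by
  obtain ⟨c, hc0, hc1, hc⟩ := hS.exists_isGeodesic (ψ 0) q
  obtain ⟨e, he, hce⟩ := exists_eq_exp_of_isGeodesic hS.pos hψ hc dist_nonneg hR hc0
  set D := dist (ψ 0) q with hD
  have hDpos : 0 < D := dist_pos.2 hne
  have hseg : segment ℝ 0 (D • e) = (fun t : ℝ => t • e) '' Icc 0 D := by
    rw [segment_eq_image]
    ext y
    constructor
    · rintro ⟨θ, hθ, rfl⟩
      exact ⟨θ * D, ⟨mul_nonneg hθ.1 hDpos.le, mul_le_of_le_one_left hDpos.le hθ.2⟩, by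
        simp [smul_smul]⟩
    · rintro ⟨t, ht, rfl⟩
      exact ⟨t / D, ⟨div_nonneg ht.1 hDpos.le, div_le_one_of_le₀ ht.2 hDpos.le⟩, by
        simp [smul_smul, div_mul_cancel₀ _ hDpos.ne']⟩
  have hdist : ∀ t ∈ Icc 0 D, dist (ψ 0) (c t) = t := fun t ht => by
    rw [← hc0, hc 0 ⟨le_rfl, hDpos.le⟩ t ht, zero_sub, abs_neg, abs_of_nonneg ht.1]
  refine ⟨D • e, ?_, ?_, ?_, ?_, ?_⟩
  · rw [← norm_ne_zero_iff, norm_smul, he, mul_one, Real.norm_of_nonneg hDpos.le]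
    exact hDpos.ne'
  · rw [← hce D ⟨hDpos.le, le_rfl⟩, hc1]
  · rw [hseg]
    rintro _ ⟨t, ht, rfl⟩
    rw [mem_ball_zero_iff, norm_smul, he, mul_one, Real.norm_of_nonneg ht.1]
    exact ht.2.trans_lt hR
  · obtain ⟨hA, hinj⟩ := hS.isUniqueShortestPathTrace_iff.1 hA
    rw [hA, hseg, image_image]
    ext y
    constructor
    · rintro ⟨t, ht, rfl⟩
      simp only
      rw [← hce t ht]
      exact hc.mem_metricInterval hc0 hc1 ht
    · intro hy
      have ht : dist (ψ 0) y ∈ Icc 0 D := ⟨dist_nonneg, by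
        have : dist (ψ 0) y + dist y q = D := hy
        linarith [dist_nonneg (x := y) (y := q)]⟩
      refine ⟨_, ht, ?_⟩
      simp only
      rw [← hce _ ht]
      exact hinj (hc.mem_metricInterval hc0 hc1 ht) hy (hdist _ ht)
  · rw [hseg]
    rintro _ ⟨t, ht, rfl⟩
    simp only
    rw [← hce t ht, hdist t ht, norm_smul, he, mul_one, Real.norm_of_nonneg ht.1]

/-- Near its starting point, a unique shortest path is a straight ray. -/
lemma IsFlatSpace.exists_ray_eq_trace (hS : IsFlatSpace S r) {v : Plane}
    (hψ : IsIsometricDisk ψ v r) {q : S} {A : Set S}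
    (hA : IsUniqueShortestPathTrace (ψ v) q A) :
    ∃ e : Plane, ‖e‖ = 1 ∧ (∀ p ∈ ball v r, ψ p ∈ A → p = v + ‖p - v‖ • e) ∧
      ∀ t ∈ Icc 0 (dist (ψ v) q), t < r → ψ (v + t • e) ∈ A := by
  obtain ⟨c, hc0, hc1, hc⟩ := hS.exists_isGeodesic (ψ v) q
  obtain ⟨hA, hinj⟩ := hS.isUniqueShortestPathTrace_iff.1 hA
  obtain ⟨e, he, hce⟩ := hψ.exists_eq_of_isGeodesic hc ⟨le_rfl, dist_nonneg⟩ hc0 hS.pos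
  have hce' : ∀ t ∈ Icc 0 (dist (ψ v) q), t < r → c t = ψ (v + t • e) := fun t ht htr => by
    have := hce t ht (by rwa [sub_zero, abs_of_nonneg ht.1])
    rwa [sub_zero] at this
  refine ⟨e, he, fun p hp hpA => ?_, fun t ht htr => ?_⟩
  · rw [hA] at hpA
    have hd : dist (ψ v) (ψ p) = ‖p - v‖ := by
      rw [hψ.dist_eq v (mem_ball_self hS.pos) p hp, dist_comm, dist_eq_norm]
    have hpr : ‖p - v‖ < r := by rwa [mem_ball_iff_norm] at hp
    have ht : ‖p - v‖ ∈ Icc 0 (dist (ψ v) q) := ⟨norm_nonneg _, by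
      have : dist (ψ v) (ψ p) + dist (ψ p) q = dist (ψ v) q := hpA
      linarith [dist_nonneg (x := ψ p) (y := q)]⟩
    have hcp : c ‖p - v‖ = ψ p := by
      refine hinj (hc.mem_metricInterval hc0 hc1 ht) hpA ?_
      rw [hd, ← hc0, hc 0 ⟨le_rfl, dist_nonneg⟩ _ ht, zero_sub, abs_neg, abs_of_nonneg ht.1]
    refine hψ.injOn hp ?_ ?_
    · rw [mem_ball_iff_norm, add_sub_cancel_left, norm_smul, he, mul_one, norm_norm]
      exact hpr
    · rw [← hce' _ ht hpr, hcp]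
  · rw [hA, ← hce' t ht htr]
    exact hc.mem_metricInterval hc0 hc1 ht

end Rays

section StarChart

lemma right_mem_faces {V : Type*} [DecidableEq V] {K : PreAbstractSimplicialComplex V}
    {x y : V} (h : {x, y} ∈ K.faces) : {y} ∈ K.faces :=
  mem_faces_of_subset K h (by simp) (by simp)

variable {S : Type*} [MetricSpace S] {r R : ℝ} {ψ : Plane → S}
  {V : Type*} [Fintype V] [DecidableEq V] {K : PreAbstractSimplicialComplex V}
  {f : Realization K ≃ₜ S} {a : V}

/-- The link of the vertex `a`. -/
def link {V : Type*} [Fintype V] (K : PreAbstractSimplicialComplex V) (a : V) :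
    Set (Realization K) :=
  {p | p.1 a = 0 ∧ ∃ s, (s ∈ K.faces ∧ a ∈ s) ∧ p ∈ closedFace K s}

lemma isClosed_link {V : Type*} [Fintype V] {K : PreAbstractSimplicialComplex V} {a : V} :
    IsClosed (link K a) :=
  (isClosed_eq (Realization.continuous_apply a) continuous_const).inter
    (isClosed_setOf_exists_closedFace _)

/-- The spikes `v z` are the lifts of the edges at the vertex `a` to the plane, where `z` ranges
over the neighbours of `a`, and the exponential map `ψ` is injective on the neighbourhood `E` of
these spikes. -/
structure IsSpikeChart (f : Realization K ≃ₜ S) (ha : {a} ∈ K.faces) (r R : ℝ) (ψ : Plane → S)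
    (E : Set Plane) (v : V → Plane) : Prop where
  isIsometricDisk : ∀ p ∈ ball (0 : Plane) R, IsIsometricDisk ψ p r
  map_zero : ψ 0 = f (vertexPoint K a ha)
  isOpen : IsOpen E
  subset : E ⊆ ball 0 R
  injOn : InjOn ψ E
  ne_zero : ∀ z, z ≠ a → {a, z} ∈ K.faces → v z ≠ 0
  segment_subset : ∀ z, z ≠ a → {a, z} ∈ K.faces → segment ℝ 0 (v z) ⊆ E
  image_segment : ∀ z, z ≠ a → {a, z} ∈ K.faces →
    ψ '' segment ℝ 0 (v z) = f '' closedFace K {a, z}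
  map_spike : ∀ z, z ≠ a → {a, z} ∈ K.faces → ∀ hz, ψ (v z) = f (vertexPoint K z hz)

lemma vertexPoint_injective {x y : V} {hx : {x} ∈ K.faces} {hy : {y} ∈ K.faces}
    (h : vertexPoint K x hx = vertexPoint K y hy) : x = y := by
  by_contra hxy
  have := congrFun (congrArg Subtype.val h) x
  simp [vertexPoint, hxy] at this

/-- Two different edges at a vertex meet in this vertex only. -/
lemma eq_vertexPoint_of_mem_edges {x y z : V} (hx : {x} ∈ K.faces)
    (hyz : y ≠ z) {p : Realization K} (h1 : p ∈ closedFace K {x, y})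
    (h2 : p ∈ closedFace K {x, z}) : p = vertexPoint K x hx := by
  apply eq_vertexPoint_of_mem_closedFace
  refine closedFace_mono ?_ (mem_closedFace_inter h1 h2)
  intro u hu
  simp only [Finset.mem_inter, Finset.mem_insert, Finset.mem_singleton] at hu ⊢
  rcases hu.1 with h | rfl
  · exact h
  · exact hu.2.resolve_right hyz

lemma eq_of_mem_segment_of_norm_eq {v x y : Plane} (hx : x ∈ segment ℝ 0 v)
    (hy : y ∈ segment ℝ 0 v) (h : ‖x‖ = ‖y‖) : x = y := by
  rw [segment_eq_image] at hx hy
  obtain ⟨s, hs, rfl⟩ := hx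
  obtain ⟨t, ht, rfl⟩ := hy
  simp only [smul_zero, zero_add, norm_smul, Real.norm_of_nonneg hs.1,
    Real.norm_of_nonneg ht.1] at h ⊢
  rcases eq_or_ne v 0 with rfl | hv
  · simp
  · rw [mul_right_cancel₀ (norm_ne_zero_iff.2 hv) h]

/-- The exponential map is injective on the union of the spikes, since edges at `a` meet only in
`a`, and hence on a neighbourhood of this compact set. -/
lemma exists_isSpikeChart (hS : IsFlatSpace S r) [CompactSpace S]
    (hf : IsUniqueShortestPathEmbedding K f) (ha : {a} ∈ K.faces) :
    ∃ R ψ E v, IsSpikeChart f ha r R ψ E v := by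
  obtain ⟨R, hR⟩ : ∃ R, ∀ x y : S, dist x y < R := by
    obtain ⟨R, hR⟩ := Metric.isBounded_iff.1 (isCompact_univ (X := S)).isBounded
    exact ⟨R + 1, fun x y => (hR (mem_univ x) (mem_univ y)).trans_lt (by linarith)⟩
  obtain ⟨ψ, hψ0, hψ⟩ := hS.exists_exp (f (vertexPoint K a ha)) R
  have hv : ∀ z, ∃ v : Plane, z ≠ a → {a, z} ∈ K.faces → v ≠ 0 ∧
      (∀ hz, ψ v = f (vertexPoint K z hz)) ∧ segment ℝ 0 v ⊆ ball 0 R ∧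
      ψ '' segment ℝ 0 v = f '' closedFace K {a, z} ∧
      ∀ y ∈ segment ℝ 0 v, dist (ψ 0) (ψ y) = ‖y‖ := by
    intro z
    by_cases hz : z ≠ a ∧ {a, z} ∈ K.faces
    · have hu := hf a z ha (right_mem_faces hz.2) hz.1.symm hz.2
      rw [← hψ0] at hu
      obtain ⟨v, h1, h2, h3, h4, h5⟩ := hS.exists_segment_eq_trace hψ (hR _ _) (by
        rw [hψ0]
        exact fun h => hz.1 (vertexPoint_injective (f.injective h)).symm) hu
      exact ⟨v, fun _ _ => ⟨h1, fun _ => h2, h3, h4, h5⟩⟩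
    · exact ⟨0, fun h1 h2 => absurd ⟨h1, h2⟩ hz⟩
  choose v hv using hv
  set I : Set V := {z | z ≠ a ∧ {a, z} ∈ K.faces}
  set P := ⋃ z ∈ I, segment ℝ 0 (v z)
  have hcompact : IsCompact P := (Set.toFinite I).isCompact_biUnion fun z _ => by
    rw [segment_eq_image]
    exact isCompact_Icc.image (by fun_prop)
  have hPR : P ⊆ ball 0 R := iUnion₂_subset fun z hz => (hv z hz.1 hz.2).2.2.1
  have hinj : InjOn ψ P := by
    intro x hx y hy hxy
    obtain ⟨z, hz, hx⟩ := mem_iUnion₂.1 hx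
    obtain ⟨z', hz', hy⟩ := mem_iUnion₂.1 hy
    obtain ⟨-, -, -, h4, h5⟩ := hv z hz.1 hz.2
    obtain ⟨-, -, -, h4', h5'⟩ := hv z' hz'.1 hz'.2
    by_cases hzz : z = z'
    · subst hzz
      exact eq_of_mem_segment_of_norm_eq hx hy (by rw [← h5 x hx, ← h5 y hy, hxy])
    · obtain ⟨q, hq, hqx⟩ : ψ x ∈ f '' closedFace K {a, z} := h4 ▸ mem_image_of_mem ψ hx
      obtain ⟨q', hq', hqy⟩ : ψ y ∈ f '' closedFace K {a, z'} := h4' ▸ mem_image_of_mem ψ hy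
      have hqq : q = q' := f.injective (by rw [hqx, hqy, hxy])
      have hqa := eq_vertexPoint_of_mem_edges ha hzz hq (hqq ▸ hq')
      have h0 : ψ x = ψ 0 := by rw [← hqx, hqa, hψ0]
      have hx0 : ‖x‖ = 0 := by rw [← h5 x hx, h0, dist_self]
      have hy0 : ‖y‖ = 0 := by rw [← h5' y hy, ← hxy, h0, dist_self]
      rw [norm_eq_zero.1 hx0, norm_eq_zero.1 hy0]
  have hcont := continuousOn_exp hψ hS.pos
  obtain ⟨E, hE, hEinj⟩ := hinj.exists_mem_nhdsSet hcompact
    (fun x hx => hcont.continuousAt (isOpen_ball.mem_nhds (hPR hx)))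
    (fun x hx => ⟨ball x r, ball_mem_nhds x hS.pos, (hψ x (hPR hx)).injOn⟩)
  have hsub : P ⊆ interior E := subset_interior_iff_mem_nhdsSet.2 hE
  refine ⟨R, ψ, interior E ∩ ball 0 R, v, ⟨hψ, hψ0, isOpen_interior.inter isOpen_ball,
    inter_subset_right, hEinj.mono (inter_subset_left.trans interior_subset),
    fun z h1 h2 => (hv z h1 h2).1, fun z h1 h2 => ?_, fun z h1 h2 => (hv z h1 h2).2.2.2.1,
    fun z h1 h2 => (hv z h1 h2).2.1⟩⟩
  have : segment ℝ 0 (v z) ⊆ P := subset_iUnion₂_of_subset z ⟨h1, h2⟩ subset_rfl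
  exact subset_inter (this.trans hsub) (this.trans hPR)

namespace IsSpikeChart

variable {ha : {a} ∈ K.faces} {E : Set Plane} {v : V → Plane}

lemma continuousAt (h : IsSpikeChart f ha r R ψ E v) (hS : IsFlatSpace S r) {p : Plane}
    (hp : p ∈ E) : ContinuousAt ψ p :=
  (continuousOn_exp h.isIsometricDisk hS.pos).continuousAt (isOpen_ball.mem_nhds (h.subset hp))

lemma spike_mem (h : IsSpikeChart f ha r R ψ E v) {z : V} (hza : z ≠ a)
    (hz : {a, z} ∈ K.faces) : v z ∈ E :=
  h.segment_subset z hza hz (right_mem_segment ℝ 0 (v z))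

/-- A spike does not contain the tip of another spike. -/
lemma notMem_segment (h : IsSpikeChart f ha r R ψ E v) {z x : V} (hza : z ≠ a)
    (hz : {a, z} ∈ K.faces) (hxa : x ≠ a) (hx : {a, x} ∈ K.faces) (hzx : z ≠ x) :
    v x ∉ segment ℝ 0 (v z) := by
  intro hmem
  obtain ⟨q, hq, hqx⟩ : ψ (v x) ∈ f '' closedFace K {a, z} :=
    h.image_segment z hza hz ▸ mem_image_of_mem ψ hmem
  rw [h.map_spike x hxa hx (right_mem_faces hx)] at hqx
  have hqx := f.injective hqx
  have := mem_closedFace_iff.1 hq x (by simp [hxa, hzx.symm])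
  rw [hqx] at this
  simp [vertexPoint] at this

/-- Different spikes have different directions. -/
lemma direction_ne (h : IsSpikeChart f ha r R ψ E v) {z x : V} (hza : z ≠ a)
    (hz : {a, z} ∈ K.faces) (hxa : x ≠ a) (hx : {a, x} ∈ K.faces) (hzx : z ≠ x) :
    v x ≠ (‖v x‖ / ‖v z‖) • v z := by
  intro heq
  have hz0 := norm_pos_iff.2 (h.ne_zero z hza hz)
  have hx0 := norm_pos_iff.2 (h.ne_zero x hxa hx)
  rcases le_total ‖v x‖ ‖v z‖ with hle | hle
  · refine h.notMem_segment hza hz hxa hx hzx ?_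
    rw [segment_eq_image]
    exact ⟨‖v x‖ / ‖v z‖, ⟨by positivity, div_le_one_of_le₀ hle hz0.le⟩, by
      simp only [smul_zero, zero_add]; exact heq.symm⟩
  · refine h.notMem_segment hxa hx hza hz hzx.symm ?_
    rw [segment_eq_image]
    refine ⟨‖v z‖ / ‖v x‖, ⟨by positivity, div_le_one_of_le₀ hle hx0.le⟩, ?_⟩
    simp only [smul_zero, zero_add]
    have := congrArg (fun u => (‖v z‖ / ‖v x‖) • u) heq
    simp only [smul_smul] at this
    rwa [div_mul_div_cancel₀ hx0.ne', div_self hz0.ne', one_smul] at this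

/-- The link of `a` meets an edge at `a` only in the other end of the edge. -/
lemma compl_link_mem_nhds (h : IsSpikeChart f ha r R ψ E v) (hS : IsFlatSpace S r) {z : V}
    (hza : z ≠ a) (hz : {a, z} ∈ K.faces) {y : Plane} (hy : y ∈ segment ℝ 0 (v z))
    (hyz : y ≠ v z) : (ψ ⁻¹' (f '' link K a))ᶜ ∈ 𝓝 y := by
  have hyE := h.segment_subset z hza hz hy
  refine (h.continuousAt hS hyE).preimage_mem_nhds
    ((f.isClosedMap _ isClosed_link).isOpen_compl.mem_nhds ?_)
  rintro ⟨q, hq, hqy⟩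
  obtain ⟨q', hq', hqy'⟩ : ψ y ∈ f '' closedFace K {a, z} :=
    h.image_segment z hza hz ▸ mem_image_of_mem ψ hy
  have hqq : q = q' := f.injective (by rw [hqy, hqy'])
  subst hqq
  have hqz : q = vertexPoint K z (right_mem_faces hz) := by
    apply eq_vertexPoint_of_mem_closedFace
    rw [mem_closedFace_iff] at hq' ⊢
    intro u hu
    by_cases hua : u = a
    · rw [hua]; exact hq.1
    · exact hq' u (by simpa [hua] using hu)
  apply hyz
  apply h.injOn hyE (h.spike_mem hza hz)
  rw [h.map_spike z hza hz (right_mem_faces hz), ← hqz, hqy]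

/-- Near the tip of a spike, the link of `a` consists of straight rays, and none of them runs back
along the spike. -/
lemma exists_cone (h : IsSpikeChart f ha r R ψ E v) (hS : IsFlatSpace S r)
    (hf : IsUniqueShortestPathEmbedding K f) (hcard : ∀ s ∈ K.faces, s.card ≤ 3) {z : V}
    (hza : z ≠ a) (hz : {a, z} ∈ K.faces) :
    ∃ ρ > 0, ∃ κ > 0, ∀ p ∈ ψ ⁻¹' (f '' link K a) ∩ ball (v z) ρ, p ≠ v z →
      ∀ t ∈ Icc (0 : ℝ) 1, κ * t ≤ ‖p - (1 - t) • v z‖ := by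
  have hzK := right_mem_faces hz
  have hvE := h.spike_mem hza hz
  have hψz := h.map_spike z hza hz hzK
  have hdisk := h.isIsometricDisk _ (h.subset hvE)
  have hray : ∀ x, x ≠ z → x ≠ a → {z, x} ∈ K.faces → ∃ κ > 0, ∀ p ∈ ball (v z) r,
      ψ p ∈ f '' closedFace K {z, x} → ∀ t, 0 ≤ t → κ * t ≤ ‖p - (1 - t) • v z‖ := by
    intro x hxz hxa hx
    have hxK := right_mem_faces hx
    have hu := hf z x hzK hxK hxz.symm hx
    rw [← hψz] at hu
    obtain ⟨e, he, he1, he2⟩ := hS.exists_ray_eq_trace hdisk hu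
    have hv0 := norm_pos_iff.2 (h.ne_zero z hza hz)
    have hd : 0 < dist (ψ (v z)) (f (vertexPoint K x hxK)) := by
      rw [dist_pos, hψz]
      exact fun h => hxz (vertexPoint_injective (f.injective h)).symm
    obtain ⟨κ, hκ, hκe⟩ := exists_lt_norm_ray_sub he (h.ne_zero z hza hz) (by
      -- Otherwise the edges `{z, x}` and `{z, a}` would have more than the vertex `z` in common.
      intro hneg
      set t := min (min (r / 2) ‖v z‖) (dist (ψ (v z)) (f (vertexPoint K x hxK)))
      have ht : 0 < t := lt_min (lt_min (by linarith [hS.pos]) hv0) hd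
      have htr : t < r := by
        have : t ≤ r / 2 := (min_le_left _ _).trans (min_le_left _ _)
        linarith [hS.pos]
      have hmem1 := he2 t ⟨ht.le, min_le_right _ _⟩ htr
      have hte : v z + t • e = (1 - t / ‖v z‖) • v z := by
        have : e = -(‖v z‖⁻¹ • v z) := by
          rw [← smul_neg, ← hneg, smul_smul, inv_mul_cancel₀ hv0.ne', one_smul]
        rw [this, sub_smul, one_smul, div_eq_mul_inv, ← smul_smul, smul_neg, sub_eq_add_neg]
      have hseg : v z + t • e ∈ segment ℝ 0 (v z) := by
        rw [hte, segment_eq_image]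
        have : t / ‖v z‖ ≤ 1 :=
          div_le_one_of_le₀ ((min_le_left _ _).trans (min_le_right _ _)) hv0.le
        exact ⟨1 - t / ‖v z‖, ⟨by linarith, by linarith [div_pos ht hv0]⟩, by simp⟩
      obtain ⟨q, hq, hqt⟩ := hmem1
      obtain ⟨q', hq', hqt'⟩ : ψ (v z + t • e) ∈ f '' closedFace K {a, z} :=
        h.image_segment z hza hz ▸ mem_image_of_mem ψ hseg
      have hqq : q = q' := f.injective (by rw [hqt, hqt'])
      rw [← hqq, Finset.pair_comm] at hq'
      have := eq_vertexPoint_of_mem_edges hzK hxa hq hq'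
      rw [this, ← hψz] at hqt
      have := h.injOn hvE (h.segment_subset z hza hz hseg) hqt
      have h0 : t • e = 0 := by simpa using this.symm
      rw [← norm_eq_zero, norm_smul, he, mul_one, Real.norm_of_nonneg ht.le] at h0
      exact ht.ne' h0)
    refine ⟨κ, hκ, fun p hp hpA t ht => ?_⟩
    have := hκe ‖p - v z‖ (norm_nonneg _) t ht
    rwa [← he1 p hp hpA] at this
  have hκ : ∃ κ > 0, ∀ x, x ≠ z → x ≠ a → {z, x} ∈ K.faces → ∀ p ∈ ball (v z) r,
      ψ p ∈ f '' closedFace K {z, x} → ∀ t, 0 ≤ t → κ * t ≤ ‖p - (1 - t) • v z‖ := by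
    have hev : ∀ᶠ κ in 𝓝[>] (0 : ℝ), ∀ x, x ≠ z → x ≠ a → {z, x} ∈ K.faces →
        ∀ p ∈ ball (v z) r, ψ p ∈ f '' closedFace K {z, x} → ∀ t, 0 ≤ t →
          κ * t ≤ ‖p - (1 - t) • v z‖ := by
      rw [eventually_all]
      intro x
      by_cases hx : x ≠ z ∧ x ≠ a ∧ {z, x} ∈ K.faces
      · obtain ⟨κ, hκ, hκx⟩ := hray x hx.1 hx.2.1 hx.2.2
        filter_upwards [Ioc_mem_nhdsGT hκ] with κ' hκ' _ _ _ p hp hpA t ht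
        exact (mul_le_mul_of_nonneg_right hκ'.2 ht).trans (hκx p hp hpA t ht)
      · exact Eventually.of_forall fun κ h1 h2 h3 => absurd ⟨h1, h2, h3⟩ hx
    obtain ⟨κ, h1, h2⟩ := (hev.and self_mem_nhdsWithin).exists
    exact ⟨κ, h2, h1⟩
  obtain ⟨κ, hκ, hκx⟩ := hκ
  -- Close to the tip, only the faces that contain `z` matter; as faces have at most three vertices,
  -- such a face meets the link of `a` in an edge from `z` to some `x`.
  set M : Set (Realization K) := {p | ∃ s, (s ∈ K.faces ∧ z ∉ s) ∧ p ∈ closedFace K s}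
  have hM : ψ ⁻¹' (f '' M)ᶜ ∈ 𝓝 (v z) := by
    refine (h.continuousAt hS hvE).preimage_mem_nhds
      ((f.isClosedMap _ (isClosed_setOf_exists_closedFace _)).isOpen_compl.mem_nhds ?_)
    rw [hψz]
    rintro ⟨q, ⟨s, ⟨-, hzs⟩, hqs⟩, hqz⟩
    have := mem_closedFace_iff.1 hqs z hzs
    rw [f.injective hqz] at this
    simp [vertexPoint] at this
  obtain ⟨ρ, hρ, hsub⟩ := Metric.mem_nhds_iff.1
    (inter_mem (inter_mem hM (h.isOpen.mem_nhds hvE)) (ball_mem_nhds (v z) hS.pos))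
  refine ⟨ρ, hρ, κ, hκ, ?_⟩
  rintro p ⟨⟨q, ⟨hqa, s, ⟨hs, has⟩, hqs⟩, hqp⟩, hpρ⟩ hpz t ht
  obtain ⟨⟨hpM, hpE⟩, hpr⟩ := hsub hpρ
  have hzs : z ∈ s := by
    by_contra hzs
    exact hpM ⟨q, ⟨s, ⟨hs, hzs⟩, hqs⟩, hqp⟩
  have hqe : q ∈ closedFace K (s.erase a) := by
    rw [mem_closedFace_iff] at hqs ⊢
    intro u hu
    by_cases hua : u = a
    · rw [hua, hqa]
    · exact hqs u fun hus => hu (Finset.mem_erase.2 ⟨hua, hus⟩)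
  have hcard2 : ((s.erase a).erase z).card ≤ 1 := by
    rw [Finset.card_erase_of_mem (Finset.mem_erase.2 ⟨hza, hzs⟩), Finset.card_erase_of_mem has]
    have := hcard s hs
    omega
  obtain ⟨x, hx⟩ : ((s.erase a).erase z).Nonempty := by
    by_contra hempty
    rw [Finset.not_nonempty_iff_eq_empty] at hempty
    apply hpz
    apply h.injOn hpE hvE
    rw [hψz, ← hqp]
    congr 1
    apply eq_vertexPoint_of_mem_closedFace
    refine closedFace_mono (fun u hu => ?_) hqe
    by_contra huz
    have : u ∈ (s.erase a).erase z := Finset.mem_erase.2 ⟨by simpa using huz, hu⟩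
    simp [hempty] at this
  have hx' := hx
  simp only [Finset.mem_erase] at hx'
  refine hκx x hx'.1 hx'.2.1 (mem_faces_of_subset K hs ?_ (by simp)) p hpr ⟨q, ?_, hqp⟩ t ht.1
  · intro u hu
    simp only [Finset.mem_insert, Finset.mem_singleton] at hu
    rcases hu with rfl | rfl
    · exact hzs
    · exact hx'.2.2
  · refine closedFace_mono (fun u hu => ?_) hqe
    by_cases huz : u = z
    · simp [huz]
    · simp [Finset.card_le_one.1 hcard2 u (Finset.mem_erase.2 ⟨huz, hu⟩) x hx]

end IsSpikeChart

/-- A gauge `N` whose unit ball is a thin neighbourhood of the spikes; in this neighbourhood, the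
exponential map is injective and stays inside the open star of the vertex `a`. -/
structure IsStarGauge (f : Realization K ≃ₜ S) (ha : {a} ∈ K.faces) (r R : ℝ) (ψ : Plane → S)
    (E : Set Plane) (v : V → Plane) (N : Plane → ℝ) (C : ℝ) : Prop
    extends IsSpikeChart f ha r R ψ E v where
  pos : 0 < C
  smul : ∀ p, ∀ t : ℝ, 0 ≤ t → N (t • p) = t * N p
  le_add : ∀ p q, N p ≤ N q + C * ‖p - q‖
  spike : ∀ z, z ≠ a → {a, z} ∈ K.faces → N (v z) = 1
  mem_of_le : ∀ p, N p ≤ 1 → p ∈ E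
  star : ∀ p, N p < 1 → 0 < (f.symm (ψ p)).1 a

/-- A thin neighbourhood of the spikes meets the link of `a` at most in the tips of the spikes, so
that its interior, which is connected, stays inside the open star of `a`. -/
lemma exists_isStarGauge (hS : IsFlatSpace S r) [CompactSpace S]
    (hf : IsUniqueShortestPathEmbedding K f) (hcard : ∀ s ∈ K.faces, s.card ≤ 3)
    (ha : {a} ∈ K.faces) (hne : ∃ z, z ≠ a ∧ {a, z} ∈ K.faces) :
    ∃ R ψ E v N C, IsStarGauge f ha r R ψ E v N C := by
  obtain ⟨R, ψ, E, v, h⟩ := exists_isSpikeChart hS hf ha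
  have : Nonempty {z // z ≠ a ∧ {a, z} ∈ K.faces} := ⟨⟨hne.choose, hne.choose_spec⟩⟩
  obtain ⟨N, C, hC, hsmul, hadd, hspike, hE, hlink⟩ :=
    exists_starGauge (v := fun z : {z // z ≠ a ∧ {a, z} ∈ K.faces} => v z)
      (fun z => h.ne_zero z z.2.1 z.2.2)
      (fun z x hzx => h.direction_ne z.2.1 z.2.2 x.2.1 x.2.2 fun he => hzx (Subtype.ext he))
      h.isOpen (fun z => h.segment_subset z z.2.1 z.2.2)
      (fun z y hy hyz => h.compl_link_mem_nhds hS z.2.1 z.2.2 hy hyz)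
      (fun z => h.exists_cone hS hf hcard z.2.1 z.2.2)
  refine ⟨R, ψ, E, v, N, C, ⟨h, hC, hsmul, hadd, fun z h1 h2 => hspike ⟨z, h1, h2⟩, hE, ?_⟩⟩
  intro p hp
  by_contra hpa
  have hpa0 : (f.symm (ψ p)).1 a = 0 := le_antisymm (not_lt.1 hpa) (Realization.nonneg _ a)
  have hN0 : N 0 = 0 := by simpa using hsmul 0 0 le_rfl
  set D : Set Plane := {q | N q < 1}
  have hDpre : IsPreconnected D := by
    refine isPreconnected_of_forall 0 fun y hy => ⟨segment ℝ 0 y, ?_, left_mem_segment ℝ 0 y,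
      right_mem_segment ℝ 0 y, (convex_segment 0 y).isPreconnected⟩
    rw [segment_eq_image]
    rintro _ ⟨t, ht, rfl⟩
    simp only [smul_zero, zero_add, D, mem_ofPred_eq]
    rw [hsmul _ _ ht.1]
    have : N y < 1 := hy
    rcases le_total (N y) 0 with h0 | h0 <;> nlinarith [ht.1, ht.2]
  have hDE : D ⊆ E := fun q hq => hE q (le_of_lt hq)
  have hpre : IsPreconnected (ψ '' D) :=
    hDpre.image _ ((continuousOn_exp h.isIsometricDisk hS.pos).mono (hDE.trans h.subset))
  -- The closed star and the complement of the open star meet in the link.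
  set St : Set (Realization K) := {q | ∃ s, (s ∈ K.faces ∧ a ∈ s) ∧ q ∈ closedFace K s}
  set O : Set (Realization K) := {q | q.1 a = 0}
  obtain ⟨_, ⟨p', hp', rfl⟩, ⟨q, hq, hqp⟩, ⟨q', hq', hqp'⟩⟩ :=
    isPreconnected_closed_iff.1 hpre (f '' St) (f '' O)
    (f.isClosedMap _ (isClosed_setOf_exists_closedFace _))
    (f.isClosedMap _ (isClosed_eq (Realization.continuous_apply a) continuous_const))
    (by
      rintro y -
      by_cases hy : (f.symm y).1 a = 0
      · exact Or.inr ⟨f.symm y, hy, f.apply_symm_apply y⟩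
      · exact Or.inl ⟨f.symm y, ⟨_, ⟨Realization.supp_mem _, Realization.mem_supp.2 hy⟩,
          Realization.mem_closedFace_supp _⟩, f.apply_symm_apply y⟩)
    ⟨ψ 0, mem_image_of_mem ψ (by simp [D, hN0]), vertexPoint K a ha,
      ⟨{a}, ⟨ha, by simp⟩, vertexPoint_mem_closedFace ha (by simp)⟩, h.map_zero.symm⟩
    ⟨ψ p, mem_image_of_mem ψ hp, f.symm (ψ p), hpa0, f.apply_symm_apply _⟩
  have hqq : q = q' := f.injective (by rw [hqp, hqp'])
  obtain ⟨z, hz⟩ := hlink p' (le_of_lt hp') ⟨q, ⟨hqq ▸ hq', hq⟩, hqp⟩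
  have h1 : N p' < 1 := hp'
  rw [hz, hspike z] at h1
  exact lt_irrefl _ h1

end StarChart

end FlatSurface

/-! ### The two sides of the contracted vertex -/

namespace FlatSurface

open Set Metric Filter

section Sides

variable {V : Type*} [Fintype V] [DecidableEq V] {T : PreAbstractSimplicialComplex V} {a b : V}

/-- The point `q` of the contraction lies in a face that comes from a face of `T` at `a`. -/
def OnLeft (T : PreAbstractSimplicialComplex V) (a b : V) (q : Realization (contract T a b)) :
    Prop :=
  ∃ t, (t ∈ T.faces ∧ a ∈ t ∧ b ∉ t) ∧ q ∈ closedFace (contract T a b) t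

/-- The point `q` of the contraction lies in a face that comes from a face of `T` at `b`. -/
def OnRight (T : PreAbstractSimplicialComplex V) (a b : V) (q : Realization (contract T a b)) :
    Prop :=
  ∃ t, (t ∈ (contract T a b).faces ∧ a ∈ t ∧ insert b (t.erase a) ∈ T.faces) ∧
    q ∈ closedFace (contract T a b) t

lemma onLeft_iff (hab : a ≠ b) {q : Realization (contract T a b)} (hq : 0 < q.1 a) :
    OnLeft T a b q ↔ q.supp ∈ T.faces := by
  have haq : a ∈ q.supp := Realization.mem_supp.2 hq.ne'
  constructor
  · rintro ⟨t, ⟨ht, -, -⟩, hqt⟩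
    exact mem_faces_of_subset T ht (Realization.supp_subset hqt) ⟨a, haq⟩
  · intro h
    exact ⟨q.supp, ⟨h, haq, notMem_of_mem_contract hab q.supp_mem⟩, q.mem_closedFace_supp⟩

lemma onRight_iff {q : Realization (contract T a b)} (hq : 0 < q.1 a) :
    OnRight T a b q ↔ insert b (q.supp.erase a) ∈ T.faces := by
  have haq : a ∈ q.supp := Realization.mem_supp.2 hq.ne'
  constructor
  · rintro ⟨t, ⟨-, -, ht⟩, hqt⟩
    exact mem_faces_of_subset T ht (Finset.insert_subset_insert _
      (Finset.erase_subset_erase _ (Realization.supp_subset hqt))) (by simp)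
  · intro h
    exact ⟨q.supp, ⟨q.supp_mem, haq, h⟩, q.mem_closedFace_supp⟩

lemma onLeft_or_onRight (hab : a ≠ b) {q : Realization (contract T a b)} (hq : 0 < q.1 a) :
    OnLeft T a b q ∨ OnRight T a b q := by
  rw [onLeft_iff hab hq, onRight_iff hq]
  exact mem_or_mem_of_mem_contract q.supp_mem (Realization.mem_supp.2 hq.ne')

lemma isClosed_onLeft : IsClosed {q | OnLeft T a b q} := isClosed_setOf_exists_closedFace _

lemma isClosed_onRight : IsClosed {q | OnRight T a b q} := isClosed_setOf_exists_closedFace _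

end Sides

section Sectors

variable {S : Type*} [MetricSpace S] {r R C : ℝ} {ψ : Plane → S} {E : Set Plane} {N : Plane → ℝ}
  {V : Type*} [Fintype V] [DecidableEq V]

namespace IsStarGauge

section

variable {K : PreAbstractSimplicialComplex V} {f : Realization K ≃ₜ S} {a : V} {ha : {a} ∈ K.faces}
  {v : V → Plane}

lemma map_origin (h : IsStarGauge f ha r R ψ E v N C) : N 0 = 0 := by
  simpa using h.smul 0 0 le_rfl

lemma norm_le (h : IsStarGauge f ha r R ψ E v N C) (p : Plane) : N p ≤ C * ‖p‖ := by
  simpa [h.map_origin] using h.le_add p 0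

lemma continuous (h : IsStarGauge f ha r R ψ E v N C) : Continuous N := by
  refine (LipschitzWith.of_le_add_mul (K := ⟨C, h.pos.le⟩) fun p q => ?_).continuous
  rw [dist_eq_norm]
  exact h.le_add p q

lemma spike_smul (h : IsStarGauge f ha r R ψ E v N C) {z : V} (hza : z ≠ a)
    (hz : {a, z} ∈ K.faces) {t : ℝ} (ht : 0 ≤ t) : N (t • v z) = t := by
  rw [h.smul _ _ ht, h.spike z hza hz, mul_one]

/-- The points of a spike correspond to the points of an edge. -/
lemma symm_map_mem_closedFace (h : IsStarGauge f ha r R ψ E v N C) {z : V} (hza : z ≠ a)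
    (hz : {a, z} ∈ K.faces) {t : ℝ} (ht : t ∈ Icc (0 : ℝ) 1) :
    f.symm (ψ (t • v z)) ∈ closedFace K {a, z} := by
  have : t • v z ∈ segment ℝ 0 (v z) := by
    rw [segment_eq_image]
    exact ⟨t, ht, by simp⟩
  obtain ⟨q, hq, hqt⟩ : ψ (t • v z) ∈ f '' closedFace K {a, z} :=
    h.image_segment z hza hz ▸ mem_image_of_mem ψ this
  rwa [← hqt, f.symm_apply_apply]

lemma exists_eq_map_smul (h : IsStarGauge f ha r R ψ E v N C) {z : V} (hza : z ≠ a)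
    (hz : {a, z} ∈ K.faces) {q : Realization K} (hq : q ∈ closedFace K {a, z}) :
    ∃ t ∈ Icc (0 : ℝ) 1, t • v z ∈ E ∧ f q = ψ (t • v z) := by
  obtain ⟨y, hy, hyq⟩ : f q ∈ ψ '' segment ℝ 0 (v z) :=
    h.image_segment z hza hz ▸ mem_image_of_mem f hq
  have hyE := h.segment_subset z hza hz hy
  rw [segment_eq_image] at hy
  obtain ⟨t, ht, rfl⟩ := hy
  simp only [smul_zero, zero_add] at hyq hyE
  exact ⟨t, ht, hyE, hyq.symm⟩

end

variable {T : PreAbstractSimplicialComplex V} {a b : V} {f : Realization (contract T a b) ≃ₜ S}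
  {ha : {a} ∈ (contract T a b).faces} {v : V → Plane}

/-- The part of the unit ball of the gauge above the two rays is connected. -/
lemma isPreconnected_above (h : IsStarGauge f ha r R ψ E v N C) {β x y : Plane} {l : Plane → ℝ}
    (hl : IsHeight β x y l) : IsPreconnected {p | N p < 1 ∧ 0 < l p} := by
  rcases Set.eq_empty_or_nonempty {p | N p < 1 ∧ 0 < l p} with hempty | ⟨p₀, hp₀⟩
  · rw [hempty]; exact isPreconnected_empty
  set ρ := 1 / C
  have hρ : 0 < ρ := one_div_pos.2 h.pos
  have hball : ball (0 : Plane) ρ ∩ {p | 0 < l p} ⊆ {p | N p < 1 ∧ 0 < l p} := by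
    rintro p ⟨hp, hlp⟩
    refine ⟨(h.norm_le p).trans_lt ?_, hlp⟩
    rw [mem_ball_zero_iff, lt_div_iff₀ h.pos] at hp
    linarith
  have hray : ∀ p, N p < 1 → 0 < l p → (fun t : ℝ => t • p) '' Ioc 0 1 ⊆
      {p | N p < 1 ∧ 0 < l p} := by
    rintro p hp hlp _ ⟨t, ht, rfl⟩
    refine ⟨?_, ?_⟩
    · rw [h.smul _ _ ht.1.le]
      rcases le_total (N p) 0 with h0 | h0 <;> nlinarith [ht.1, ht.2]
    · rw [hl.smul _ _ ht.1.le]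
      exact mul_pos ht.1 hlp
  have hsmall : ∀ p, 0 < l p → ∃ t ∈ Ioc (0 : ℝ) 1, t • p ∈ ball (0 : Plane) ρ ∩ {p | 0 < l p} := by
    intro p hp
    refine ⟨min 1 (ρ / (2 * (‖p‖ + 1))), ⟨by positivity, min_le_left _ _⟩, ?_, ?_⟩
    · rw [mem_ball_zero_iff, norm_smul, Real.norm_of_nonneg (by positivity)]
      calc min 1 (ρ / (2 * (‖p‖ + 1))) * ‖p‖ ≤ ρ / (2 * (‖p‖ + 1)) * ‖p‖ := by
            gcongr; exact min_le_right _ _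
        _ < ρ := by
            rw [div_mul_eq_mul_div, div_lt_iff₀ (by positivity)]
            nlinarith [norm_nonneg p]
    · show 0 < l _
      rw [hl.smul _ _ (by positivity)]
      positivity
  obtain ⟨t₀, -, ht₀⟩ := hsmall p₀ hp₀.2
  refine isPreconnected_of_forall (t₀ • p₀) fun p hp => ?_
  obtain ⟨t, ht, htp⟩ := hsmall p hp.2
  refine ⟨(fun t : ℝ => t • p) '' Ioc 0 1 ∪ (ball (0 : Plane) ρ ∩ {p | 0 < l p}),
    union_subset (hray p hp.1 hp.2) hball, Or.inr ht₀, Or.inl ⟨1, by simp, by simp⟩, ?_⟩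
  exact IsPreconnected.union (t • p) ⟨t, ht, rfl⟩ htp
    (isPreconnected_Ioc.image _ (by fun_prop)) (hl.isPreconnected hρ)

/-- The points over the two rays lie on the edges `{a, c}` and `{a, d}`. -/
lemma symm_map_mem_of_height_eq_zero {K : PreAbstractSimplicialComplex V} {f : Realization K ≃ₜ S}
    {ha : {a} ∈ K.faces} (h : IsStarGauge f ha r R ψ E v N C) {c d : V} (hca : c ≠ a)
    (hc : {a, c} ∈ K.faces) (hda : d ≠ a) (hd : {a, d} ∈ K.faces) {β : Plane} {l : Plane → ℝ}
    (hl : IsHeight β (v c) (v d) l) {p : Plane} (hp : N p ≤ 1) (hlp : l p = 0) :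
    f.symm (ψ p) ∈ closedFace K {a, c} ∨ f.symm (ψ p) ∈ closedFace K {a, d} := by
  obtain ⟨t, ht, rfl | rfl⟩ := (hl.eq_zero_iff p).1 hlp
  · rw [h.spike_smul hca hc ht] at hp
    exact Or.inl (h.symm_map_mem_closedFace hca hc ⟨ht, hp⟩)
  · rw [h.spike_smul hda hd ht] at hp
    exact Or.inr (h.symm_map_mem_closedFace hda hd ⟨ht, hp⟩)

lemma height_eq_zero {K : PreAbstractSimplicialComplex V} {f : Realization K ≃ₜ S}
    {ha : {a} ∈ K.faces} (h : IsStarGauge f ha r R ψ E v N C) {c d : V} (hca : c ≠ a)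
    (hc : {a, c} ∈ K.faces) (hda : d ≠ a) (hd : {a, d} ∈ K.faces) {β : Plane} {l : Plane → ℝ}
    (hl : IsHeight β (v c) (v d) l) {p : Plane} (hp : N p ≤ 1)
    (hq : f.symm (ψ p) ∈ closedFace K {a, c} ∨ f.symm (ψ p) ∈ closedFace K {a, d}) : l p = 0 := by
  rw [hl.eq_zero_iff]
  rcases hq with hq | hq
  · obtain ⟨t, ht, htE, htq⟩ := h.exists_eq_map_smul hca hc hq
    rw [f.apply_symm_apply] at htq
    exact ⟨t, ht.1, Or.inl (h.injOn (h.mem_of_le p hp) htE htq)⟩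
  · obtain ⟨t, ht, htE, htq⟩ := h.exists_eq_map_smul hda hd hq
    rw [f.apply_symm_apply] at htq
    exact ⟨t, ht.1, Or.inr (h.injOn (h.mem_of_le p hp) htE htq)⟩

/-- Near the vertex `a`, each of the two sides of the pair of edges `{a, c}` and `{a, d}` is made
of faces of one kind. -/
lemma not_onLeft_or_not_onRight (h : IsStarGauge f ha r R ψ E v N C) (hS : IsFlatSpace S r)
    (hab : a ≠ b) {c d : V} (hca : c ≠ a) (hc : {a, c} ∈ (contract T a b).faces) (hda : d ≠ a)
    (hd : {a, d} ∈ (contract T a b).faces)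
    (hmeet : ∀ s ∈ T.faces, a ∈ s → b ∉ s → insert b (s.erase a) ∈ T.faces →
      s ⊆ {a, c} ∨ s ⊆ {a, d}) {β : Plane} {l : Plane → ℝ} (hl : IsHeight β (v c) (v d) l) :
    (∀ p, N p < 1 → 0 < l p → ¬ OnLeft T a b (f.symm (ψ p))) ∨
      ∀ p, N p < 1 → 0 < l p → ¬ OnRight T a b (f.symm (ψ p)) := by
  by_contra hcon
  push Not at hcon
  obtain ⟨⟨p₁, hp₁, hl₁, hL⟩, p₂, hp₂, hl₂, hR⟩ := hcon
  have hpre : IsPreconnected (ψ '' {p | N p < 1 ∧ 0 < l p}) := (h.isPreconnected_above hl).image _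
    ((continuousOn_exp h.isIsometricDisk hS.pos).mono
      fun p hp => h.subset (h.mem_of_le p (le_of_lt hp.1)))
  obtain ⟨_, ⟨p, ⟨hp, hlp⟩, rfl⟩, ⟨q, hq, hqp⟩, ⟨q', hq', hqp'⟩⟩ :=
    isPreconnected_closed_iff.1 hpre _ _ (f.isClosedMap _ isClosed_onLeft)
      (f.isClosedMap _ isClosed_onRight)
    (by
      rintro _ ⟨p, ⟨hp, -⟩, rfl⟩
      rcases onLeft_or_onRight hab (h.star p hp) with hq | hq
      · exact Or.inl ⟨_, hq, f.apply_symm_apply _⟩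
      · exact Or.inr ⟨_, hq, f.apply_symm_apply _⟩)
    ⟨ψ p₁, ⟨p₁, ⟨hp₁, hl₁⟩, rfl⟩, _, hL, f.apply_symm_apply _⟩
    ⟨ψ p₂, ⟨p₂, ⟨hp₂, hl₂⟩, rfl⟩, _, hR, f.apply_symm_apply _⟩
  have hqq : q = f.symm (ψ p) := by rw [← hqp, f.symm_apply_apply]
  have hqq' : q' = f.symm (ψ p) := by rw [← hqp', f.symm_apply_apply]
  rw [hqq] at hq
  rw [hqq'] at hq'
  have hstar := h.star p hp
  refine hlp.ne' (h.height_eq_zero hca hc hda hd hl hp.le ?_)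
  exact (hmeet _ ((onLeft_iff hab hstar).1 hq) (Realization.mem_supp.2 hstar.ne')
    (notMem_of_mem_contract hab (Realization.supp_mem _)) ((onRight_iff hstar).1 hq')).imp
    (fun hs => closedFace_mono hs (Realization.mem_closedFace_supp _))
    (fun hs => closedFace_mono hs (Realization.mem_closedFace_supp _))

/-- Every face at `a` has points in its relative interior that lie in the unit ball of the gauge. -/
lemma exists_symm_map_supp_eq (h : IsStarGauge f ha r R ψ E v N C) (hS : IsFlatSpace S r)
    {s : Finset V} (hs : s ∈ (contract T a b).faces) (has : a ∈ s) :
    ∃ p, N p < 1 ∧ (f.symm (ψ p)).supp = s := by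
  have hsub : {p | N p < 1} ⊆ ball (0 : Plane) R :=
    fun p hp => h.subset (h.mem_of_le p (le_of_lt hp))
  have hopen : IsOpen (ψ '' {p | N p < 1}) := isOpen_image_exp h.isIsometricDisk hS.pos
    (isOpen_lt h.continuous continuous_const) hsub
  obtain ⟨q, ⟨p, hp, hpq⟩, hqs⟩ := exists_supp_eq_of_mem_nhds ha hs has
    (f.continuous.continuousAt.preimage_mem_nhds (hopen.mem_nhds
      ⟨0, by simp [h.map_origin], h.map_zero⟩))
  exact ⟨p, hp, by rw [hpq, f.symm_apply_apply, hqs]⟩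

/-- The two edges that are doubled when the vertex `a` of the contraction is split separate the
faces that come from faces of `T` at `a` from those that come from faces at `b`. -/
lemma exists_separating_height (h : IsStarGauge f ha r R ψ E v N C) (hS : IsFlatSpace S r)
    (hT : ContractionData T a b) :
    ∃ c d β l, c ≠ a ∧ c ≠ b ∧ d ≠ a ∧ d ≠ b ∧ {a, b, c} ∈ T.faces ∧ {a, b, d} ∈ T.faces ∧
      (∀ s ∈ T.faces, a ∈ s → b ∉ s → insert b (s.erase a) ∈ T.faces →
        s ⊆ {a, c} ∨ s ⊆ {a, d}) ∧ IsHeight β (v c) (v d) l ∧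
      (∀ p, N p < 1 → 0 < l p → ¬ OnLeft T a b (f.symm (ψ p))) ∧
      ∀ p, N p < 1 → l p < 0 → ¬ OnRight T a b (f.symm (ψ p)) := by
  obtain ⟨c, d, hcd, hca, hcb, hda, hdb, hc, hd, -, hmeet, ⟨s, hs, has, hsT⟩, s', hs', has',
    hsT'⟩ := hT.exists_apexes
  have hab := hT.ne
  have hedge : ∀ z, z ≠ a → z ≠ b → {a, b, z} ∈ T.faces → {a, z} ∈ T.faces ∧ {b, z} ∈ T.faces ∧
      {a, z} ∈ (contract T a b).faces := by
    intro z hza hzb hz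
    have h1 : {a, z} ∈ T.faces := mem_faces_of_subset T hz (by intro z; simp; tauto) (by simp)
    exact ⟨h1, mem_faces_of_subset T hz (Finset.subset_insert _ _) (by simp),
      mem_contract_of_notMem h1 (by simp [hab.symm, hzb.symm])⟩
  obtain ⟨hacT, hbcT, hac⟩ := hedge c hca hcb hc
  obtain ⟨hadT, hbdT, had⟩ := hedge d hda hdb hd
  obtain ⟨β, l, hl⟩ := exists_isHeight (h.ne_zero c hca hac) (h.ne_zero d hda had)
    (h.direction_ne hca hac hda had hcd)
  -- There are faces of both kinds near the vertex.
  have hleft : ∃ p, N p < 1 ∧ l p ≠ 0 ∧ ¬ OnRight T a b (f.symm (ψ p)) := by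
    obtain ⟨p, hp, hps⟩ := h.exists_symm_map_supp_eq hS hs' has'
    refine ⟨p, hp, fun hlp => hsT' ?_, fun hR => hsT' ?_⟩
    · rcases h.symm_map_mem_of_height_eq_zero hca hac hda had hl hp.le hlp with hq | hq
      · have := Realization.supp_subset hq
        rw [hps] at this
        refine mem_faces_of_subset T hbcT (Finset.insert_subset (by simp) fun u hu => ?_) (by simp)
        obtain ⟨hua, hu⟩ := Finset.mem_erase.1 hu
        have := this hu
        simp only [Finset.mem_insert, Finset.mem_singleton] at this ⊢
        tauto
      · have := Realization.supp_subset hq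
        rw [hps] at this
        refine mem_faces_of_subset T hbdT (Finset.insert_subset (by simp) fun u hu => ?_) (by simp)
        obtain ⟨hua, hu⟩ := Finset.mem_erase.1 hu
        have := this hu
        simp only [Finset.mem_insert, Finset.mem_singleton] at this ⊢
        tauto
    · rw [← hps]
      exact (onRight_iff (h.star p hp)).1 hR
  have hright : ∃ p, N p < 1 ∧ l p ≠ 0 ∧ ¬ OnLeft T a b (f.symm (ψ p)) := by
    obtain ⟨p, hp, hps⟩ := h.exists_symm_map_supp_eq hS hs has
    refine ⟨p, hp, fun hlp => hsT ?_, fun hL => hsT ?_⟩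
    · rcases h.symm_map_mem_of_height_eq_zero hca hac hda had hl hp.le hlp with hq | hq
      · have := Realization.supp_subset hq
        rw [hps] at this
        exact mem_faces_of_subset T hacT this ⟨a, has⟩
      · have := Realization.supp_subset hq
        rw [hps] at this
        exact mem_faces_of_subset T hadT this ⟨a, has⟩
    · rw [← hps]
      exact (onLeft_iff hab (h.star p hp)).1 hL
  obtain ⟨p₁, hp₁, hl₁, hR₁⟩ := hleft
  obtain ⟨p₂, hp₂, hl₂, hL₂⟩ := hright
  have hL₁ := (onLeft_or_onRight hab (h.star p₁ hp₁)).resolve_right hR₁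
  have hR₂ := (onLeft_or_onRight hab (h.star p₂ hp₂)).resolve_left hL₂
  have habove := h.not_onLeft_or_not_onRight hS hab hca hac hda had hmeet hl
  have hbelow := h.not_onLeft_or_not_onRight hS hab hca hac hda had hmeet hl.neg
  simp only [Left.neg_pos_iff] at hbelow
  rcases habove with h1 | h1
  · refine ⟨c, d, β, l, hca, hcb, hda, hdb, hc, hd, hmeet, hl, h1, ?_⟩
    refine hbelow.resolve_left fun h2 => ?_
    exact hl₁.lt_or_gt.elim (fun hlt => h2 p₁ hp₁ hlt hL₁) (fun hgt => h1 p₁ hp₁ hgt hL₁)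
  · refine ⟨c, d, -β, fun p => -l p, hca, hcb, hda, hdb, hc, hd, hmeet, hl.neg, ?_, ?_⟩
    · simp only [Left.neg_pos_iff]
      refine hbelow.resolve_right fun h2 => ?_
      exact hl₂.lt_or_gt.elim (fun hlt => h2 p₂ hp₂ hlt hR₂) (fun hgt => h1 p₂ hp₂ hgt hR₂)
    · simp only [Left.neg_neg_iff]
      exact h1

end IsStarGauge

end Sectors

end FlatSurface

/-! ### The collapsing map -/

namespace FlatSurface

open Set Metric Filter

section Collapse

variable {V : Type*} [Fintype V] {T : PreAbstractSimplicialComplex V} {a b : V}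

/-- The share of the vertex `b` in the coordinate of the collapsed point at `a`. -/
noncomputable def splitRatio (a b : V) (x : Realization T) : ℝ := x.1 b / (x.1 a + x.1 b)

lemma splitRatio_mem (x : Realization T) : splitRatio a b x ∈ Icc (0 : ℝ) 1 := by
  have ha := x.nonneg a
  have hb := x.nonneg b
  exact ⟨by unfold splitRatio; positivity, div_le_one_of_le₀ (by linarith) (by linarith)⟩

lemma splitRatio_eq_zero {x : Realization T} (h : x.1 b = 0) : splitRatio a b x = 0 := by
  simp [splitRatio, h]

variable [DecidableEq V]

/-- The map of the realization of `T` onto the realization of the contraction that is affine on the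
simplices and sends the vertex `b` to `a`. -/
def collapse (T : PreAbstractSimplicialComplex V) {a b : V} (hab : a ≠ b) (x : Realization T) :
    Realization (contract T a b) :=
  ⟨fun u => if u = a then x.1 a + x.1 b else if u = b then 0 else x.1 u, by
    refine ⟨⟨fun u => ?_, ?_⟩, x.supp.image (fun v => if v = b then a else v),
      ⟨x.supp, x.supp_mem, rfl⟩, fun u hu => ?_⟩
    · have ha := x.nonneg a
      have hb := x.nonneg b
      have hu := x.nonneg u
      dsimp only
      split_ifs <;> positivity
    · have hsplit : ∀ u, (if u = a then x.1 a + x.1 b else if u = b then 0 else x.1 u) =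
          x.1 u + ((if u = a then x.1 b else 0) - if u = b then x.1 b else 0) := by
        intro u
        by_cases hua : u = a
        · subst hua; simp [hab]
        · by_cases hub : u = b
          · subst hub; simp [hua]
          · simp [hua, hub]
      simp only [hsplit, Finset.sum_add_distrib, Finset.sum_sub_distrib]
      simp [x.sum_eq_one]
    · rw [Function.mem_support] at hu
      rw [Finset.mem_coe, Finset.mem_image]
      by_cases hua : u = a
      · subst hua
        rw [if_pos rfl] at hu
        by_cases hxu : x.1 u = 0
        · exact ⟨b, Realization.mem_supp.2 fun h => hu (by rw [hxu, h, add_zero]), if_pos rfl⟩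
        · exact ⟨u, Realization.mem_supp.2 hxu, if_neg hab⟩
      · rw [if_neg hua] at hu
        by_cases hub : u = b
        · exact absurd (if_pos hub) hu
        · rw [if_neg hub] at hu
          exact ⟨u, Realization.mem_supp.2 hu, if_neg hub⟩⟩

variable (hab : a ≠ b)

lemma collapse_left (x : Realization T) : (collapse T hab x).1 a = x.1 a + x.1 b := if_pos rfl

lemma collapse_apply (x : Realization T) {u : V} (hua : u ≠ a) (hub : u ≠ b) :
    (collapse T hab x).1 u = x.1 u := by
  simp [collapse, hua, hub]

lemma continuous_collapse : Continuous (collapse T hab) := by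
  refine Continuous.subtype_mk (continuous_pi fun u => ?_) _
  have ha := Realization.continuous_apply (K := T) a
  have hb := Realization.continuous_apply (K := T) b
  by_cases hua : u = a
  · simp only [hua, if_true]; exact ha.add hb
  · by_cases hub : u = b
    · simp only [hub, if_false, if_true, hab.symm]; exact continuous_const
    · simp only [hua, hub, if_false]; exact Realization.continuous_apply u

lemma eq_of_collapse_eq {x y : Realization T} (h : collapse T hab x = collapse T hab y)
    (hb : x.1 b = y.1 b) : x = y := by
  apply Subtype.ext
  funext u
  by_cases hub : u = b
  · rw [hub, hb]
  · by_cases hua : u = a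
    · have h1 := collapse_left hab x
      rw [h, collapse_left, hb] at h1
      rw [hua]
      linarith
    · rw [← collapse_apply hab x hua hub, h, collapse_apply hab y hua hub]

/-- The points over the point `q` of the contraction: the coordinate of `q` at `a` is distributed
to `a` and `b`, provided that the vertices in question span a face. -/
lemma exists_collapse_eq {q : Realization (contract T a b)} {s : ℝ} (hs : s ∈ Icc (0 : ℝ) 1)
    {t : Finset V} (ht : t ∈ T.faces) (hqt : ∀ u, u ≠ a → u ≠ b → q.1 u ≠ 0 → u ∈ t)
    (hat : q.1 a ≠ 0 → s ≠ 1 → a ∈ t) (hbt : q.1 a ≠ 0 → s ≠ 0 → b ∈ t) :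
    ∃ x : Realization T, collapse T hab x = q ∧ x.1 b = s * q.1 a ∧ x ∈ closedFace T t := by
  have hqb : q.1 b = 0 := by
    by_contra hqb
    exact notMem_of_mem_contract hab q.supp_mem (Realization.mem_supp.2 hqb)
  have hsupp : ∀ u, (if u = a then (1 - s) * q.1 a else if u = b then s * q.1 a else q.1 u) ≠ 0 →
      u ∈ t := by
    intro u hu
    by_cases hua : u = a
    · subst hua
      rw [if_pos rfl] at hu
      refine hat (right_ne_zero_of_mul hu) fun hs1 => left_ne_zero_of_mul hu (by rw [hs1, sub_self])
    · rw [if_neg hua] at hu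
      by_cases hub : u = b
      · subst hub
        rw [if_pos rfl] at hu
        exact hbt (right_ne_zero_of_mul hu) (left_ne_zero_of_mul hu)
      · rw [if_neg hub] at hu
        exact hqt u hua hub hu
  refine ⟨⟨fun u => if u = a then (1 - s) * q.1 a else if u = b then s * q.1 a else q.1 u,
    ⟨fun u => ?_, ?_⟩, t, ht, fun u hu => hsupp u hu⟩, ?_, ?_, fun u hu => hsupp u hu⟩
  · have h1 := q.nonneg a
    have h2 := q.nonneg u
    have h3 := hs.1
    have h4 : 0 ≤ 1 - s := by linarith [hs.2]
    dsimp only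
    split_ifs <;> positivity
  · have hsplit : ∀ u, (if u = a then (1 - s) * q.1 a else if u = b then s * q.1 a else q.1 u) =
        q.1 u + ((if u = b then s * q.1 a else 0) - if u = a then s * q.1 a else 0) := by
      intro u
      by_cases hua : u = a
      · subst hua; simp [hab]; ring
      · by_cases hub : u = b
        · subst hub; simp [hua, hqb]
        · simp [hua, hub]
    simp only [hsplit, Finset.sum_add_distrib, Finset.sum_sub_distrib]
    simp [q.sum_eq_one]
  · apply Subtype.ext
    funext u
    by_cases hua : u = a
    · subst hua; simp [collapse, hab.symm]; ring
    · by_cases hub : u = b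
      · subst hub; simp [collapse, hua, hqb]
      · simp [collapse, hua, hub]
  · simp [hab.symm]

lemma splitRatio_mul (x : Realization T) :
    splitRatio a b x * (collapse T hab x).1 a = x.1 b := by
  rw [collapse_left]
  rcases eq_or_ne (x.1 a + x.1 b) 0 with h | h
  · rw [h, mul_zero]
    linarith [x.nonneg a, x.nonneg b]
  · exact div_mul_cancel₀ _ h

lemma splitRatio_eq_one {x : Realization T} (h : x.1 a = 0)
    (hq : 0 < (collapse T hab x).1 a) : splitRatio a b x = 1 := by
  rw [collapse_left, h, zero_add] at hq
  rw [splitRatio, h, zero_add, div_self hq.ne']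

lemma continuousAt_splitRatio {x : Realization T} (hq : 0 < (collapse T hab x).1 a) :
    ContinuousAt (splitRatio (T := T) a b) x := by
  have ha := (Realization.continuous_apply (K := T) a).continuousAt (x := x)
  have hb := (Realization.continuous_apply (K := T) b).continuousAt (x := x)
  rw [collapse_left] at hq
  exact hb.div (ha.add hb) hq.ne'

/-- Points over faces that do not come from faces of `T` at `a` have no share at `a`. -/
lemma apply_left_eq_zero {x : Realization T} (h : ¬ OnLeft T a b (collapse T hab x)) :
    x.1 a = 0 := by
  by_contra hx
  refine h ⟨x.supp.erase b, ⟨mem_faces_of_subset T x.supp_mem (Finset.erase_subset _ _) ?_, ?_,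
    by simp⟩, ?_⟩
  · exact ⟨a, Finset.mem_erase.2 ⟨hab, Realization.mem_supp.2 hx⟩⟩
  · exact Finset.mem_erase.2 ⟨hab, Realization.mem_supp.2 hx⟩
  · rw [mem_closedFace_iff]
    intro u hu
    by_cases hua : u = a
    · exact absurd (Finset.mem_erase.2 ⟨hab, Realization.mem_supp.2 hx⟩) (hua ▸ hu)
    by_cases hub : u = b
    · simp [collapse, hub, hab.symm]
    · rw [collapse_apply hab x hua hub]
      by_contra hxu
      exact hu (Finset.mem_erase.2 ⟨hub, Realization.mem_supp.2 hxu⟩)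

/-- Points over faces that do not come from faces of `T` at `b` have no share at `b`. -/
lemma apply_right_eq_zero {x : Realization T} (h : ¬ OnRight T a b (collapse T hab x)) :
    x.1 b = 0 := by
  by_contra hx
  have hbx : b ∈ x.supp := Realization.mem_supp.2 hx
  have ha : a ∈ x.supp.image (fun v => if v = b then a else v) :=
    Finset.mem_image.2 ⟨b, hbx, if_pos rfl⟩
  refine h ⟨x.supp.image (fun v => if v = b then a else v), ⟨⟨x.supp, x.supp_mem, rfl⟩,
    ha, mem_faces_of_subset T x.supp_mem ?_ (by simp)⟩, ?_⟩
  · refine Finset.insert_subset hbx fun u hu => ?_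
    obtain ⟨hua, hu⟩ := Finset.mem_erase.1 hu
    obtain ⟨y, hy, rfl⟩ := Finset.mem_image.1 hu
    split_ifs at hua ⊢ with hyb
    · exact absurd rfl hua
    · exact hy
  · rw [mem_closedFace_iff]
    intro u hu
    by_cases hua : u = a
    · rw [hua] at hu
      exact absurd ha hu
    by_cases hub : u = b
    · simp [collapse, hub, hab.symm]
    · rw [collapse_apply hab x hua hub]
      by_contra hxu
      exact hu (Finset.mem_image.2 ⟨u, Realization.mem_supp.2 hxu, if_neg hub⟩)

lemma collapse_mem_closedFace {x : Realization T} {s : Finset V} (hx : x ∈ closedFace T s)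
    (hb : b ∉ s) : collapse T hab x ∈ closedFace (contract T a b) s := by
  rw [mem_closedFace_iff] at hx ⊢
  intro u hu
  by_cases hua : u = a
  · subst hua; rw [collapse_left, hx u hu, hx b hb, add_zero]
  · by_cases hub : u = b
    · simp [collapse, hub, hab.symm]
    · rw [collapse_apply hab x hua hub, hx u hu]

lemma collapse_mem_closedFace_insert {x : Realization T} {s : Finset V}
    (hx : x ∈ closedFace T (insert b s)) :
    collapse T hab x ∈ closedFace (contract T a b) (insert a s) := by
  rw [mem_closedFace_iff] at hx ⊢
  intro u hu
  rw [Finset.mem_insert, not_or] at hu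
  by_cases hub : u = b
  · simp [collapse, hub, hab.symm]
  · rw [collapse_apply hab x hu.1 hub, hx u (by simp [hub, hu.2])]

end Collapse

end FlatSurface

/-! ### Splitting a vertex -/

namespace FlatSurface

open Set Metric Filter

section Splitting

variable {S : Type*} [MetricSpace S] {r R C : ℝ} {ψ : Plane → S} {E : Set Plane} {N : Plane → ℝ}
  {V : Type*} [Fintype V] [DecidableEq V] {T : PreAbstractSimplicialComplex V} {a b : V}
  {f : Realization (contract T a b) ≃ₜ S} {ha : {a} ∈ (contract T a b).faces} {v : V → Plane}
  {c d : V} {β : Plane} {l : Plane → ℝ}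

/-- The data needed for splitting the vertex `a` of the contraction: `β` is the position of `b`
relative to `a`, and `c`, `d` are the apexes of the two triangles at the edge `{a, b}`. The faces
that come from faces at `b` are those on the side of the vector `β`. -/
structure IsSplitting (f : Realization (contract T a b) ≃ₜ S)
    (ha : {a} ∈ (contract T a b).faces) (r R : ℝ) (ψ : Plane → S) (E : Set Plane) (v : V → Plane)
    (N : Plane → ℝ) (C : ℝ) (c d : V) (β : Plane) (l : Plane → ℝ) : Prop
    extends IsStarGauge f ha r R ψ E v N C where
  ne : a ≠ b
  left_ne : c ≠ a
  left_ne' : c ≠ b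
  right_ne : d ≠ a
  right_ne' : d ≠ b
  left_mem : {a, b, c} ∈ T.faces
  right_mem : {a, b, d} ∈ T.faces
  meet : ∀ s ∈ T.faces, a ∈ s → b ∉ s → insert b (s.erase a) ∈ T.faces → s ⊆ {a, c} ∨ s ⊆ {a, d}
  height : IsHeight β (v c) (v d) l
  above : ∀ p, N p < 1 → 0 < l p → ¬ OnLeft T a b (f.symm (ψ p))
  below : ∀ p, N p < 1 → l p < 0 → ¬ OnRight T a b (f.symm (ψ p))
  small : C * ‖β‖ < 1

/-- The function by which the points of the unit ball of the gauge `N` are shifted. -/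
def bump (N : Plane → ℝ) (p : Plane) : ℝ := max (1 - N p) 0

lemma bump_nonneg (N : Plane → ℝ) (p : Plane) : 0 ≤ bump N p := le_max_right _ _

lemma bump_of_le {p : Plane} (hp : N p ≤ 1) : bump N p = 1 - N p := max_eq_left (by linarith)

lemma bump_eq_zero {p : Plane} (hp : 1 ≤ N p) : bump N p = 0 := max_eq_right (by linarith)

lemma gauge_lt_of_shift_lt {p β : Plane} {s : ℝ} (hp : N (p + (s * bump N p) • β) < 1) :
    N p < 1 := by
  by_contra hge
  rw [bump_eq_zero (not_lt.1 hge), mul_zero, zero_smul, add_zero] at hp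
  exact hge hp

open Classical in
/-- The map of the realization of `T` to the surface that splits the vertex `a` of the contraction:
near this vertex, a point over `p` is shifted by a multiple of `β` which depends on the share of the
vertex `b` in its coordinates. -/
noncomputable def splitMap (f : Realization (contract T a b) ≃ₜ S) (ψ : Plane → S) (E : Set Plane)
    (N : Plane → ℝ) (β : Plane) (hab : a ≠ b) (x : Realization T) : S :=
  if f (collapse T hab x) ∈ ψ '' E then
    ψ (Function.invFunOn ψ E (f (collapse T hab x)) +
      (splitRatio a b x * bump N (Function.invFunOn ψ E (f (collapse T hab x)))) • β)
  else f (collapse T hab x)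

/-- The inverse of the exponential map is continuous where it is defined. -/
lemma IsSpikeChart.continuousOn_invFunOn {K : PreAbstractSimplicialComplex V}
    {f : Realization K ≃ₜ S} {ha : {a} ∈ K.faces} (h : IsSpikeChart f ha r R ψ E v)
    (hS : IsFlatSpace S r) : ContinuousOn (Function.invFunOn ψ E) (ψ '' E) := by
  rintro _ ⟨p, hp, rfl⟩
  have hinv : ∀ q ∈ E, Function.invFunOn ψ E (ψ q) = q := fun q hq => h.injOn.leftInvOn_invFunOn hq
  rw [ContinuousWithinAt, hinv p hp]
  intro W hW
  obtain ⟨O, hOW, hO, hpO⟩ := _root_.mem_nhds_iff.1 hW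
  have hopen : IsOpen (ψ '' (O ∩ E)) := isOpen_image_exp h.isIsometricDisk hS.pos
    (hO.inter h.isOpen) (inter_subset_right.trans h.subset)
  have hnear : ψ '' (O ∩ E) ∈ 𝓝[ψ '' E] ψ p :=
    mem_nhdsWithin_of_mem_nhds (hopen.mem_nhds ⟨p, ⟨hpO, hp⟩, rfl⟩)
  refine mem_map.2 (mem_of_superset hnear ?_)
  rintro _ ⟨q, ⟨hqO, hqE⟩, rfl⟩
  rw [mem_preimage, hinv q hqE]
  exact hOW hqO

namespace IsSplitting

variable (h : IsSplitting f ha r R ψ E v N C c d β l)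
include h

lemma splitMap_eq {x : Realization T} {p : Plane} (hp : p ∈ E)
    (hx : f (collapse T h.ne x) = ψ p) :
    splitMap f ψ E N β h.ne x = ψ (p + (splitRatio a b x * bump N p) • β) := by
  rw [splitMap, hx, if_pos ⟨p, hp, rfl⟩, h.injOn.leftInvOn_invFunOn hp]

/-- Outside the unit ball of the gauge, nothing is shifted. -/
lemma splitMap_eq_collapse {x : Realization T}
    (hx : ∀ p, N p < 1 → f (collapse T h.ne x) ≠ ψ p) :
    splitMap f ψ E N β h.ne x = f (collapse T h.ne x) := by
  by_cases hmem : f (collapse T h.ne x) ∈ ψ '' E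
  · obtain ⟨p, hp, hpx⟩ := hmem
    rw [h.splitMap_eq hp hpx.symm, bump_eq_zero (not_lt.1 fun hlt => hx p hlt hpx.symm), mul_zero,
      zero_smul, add_zero, hpx]
  · rw [splitMap, if_neg hmem]

lemma splitMap_eq_of_apply_eq_zero {x : Realization T} (hx : x.1 b = 0) :
    splitMap f ψ E N β h.ne x = f (collapse T h.ne x) := by
  by_cases hmem : f (collapse T h.ne x) ∈ ψ '' E
  · obtain ⟨p, hp, hpx⟩ := hmem
    rw [h.splitMap_eq hp hpx.symm, splitRatio_eq_zero hx, zero_mul, zero_smul, add_zero, hpx]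
  · rw [splitMap, if_neg hmem]

lemma gauge_add_smul_le (p : Plane) {t : ℝ} (ht : 0 ≤ t) :
    N (p + t • β) ≤ N p + C * ‖β‖ * t := by
  have := h.le_add (p + t • β) p
  rw [add_sub_cancel_left, norm_smul, Real.norm_of_nonneg ht] at this
  linarith

/-- The bump function decreases at a rate less than `1` in the direction of `β`, which keeps the
shift along `β` monotone. -/
lemma bump_le (p : Plane) (t : ℝ) (ht : 0 ≤ t) :
    bump N p ≤ bump N (p + t • β) + C * ‖β‖ * t := by
  have h0 : 0 ≤ C * ‖β‖ * t := mul_nonneg (mul_nonneg h.pos.le (norm_nonneg _)) ht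
  refine max_le ?_ (add_nonneg (bump_nonneg _ _) h0)
  have := le_max_left (1 - N (p + t • β)) 0
  have := h.gauge_add_smul_le p ht
  unfold bump
  linarith

lemma continuous_bump : Continuous (bump N) :=
  (continuous_const.sub h.continuous).max continuous_const

/-- The shifted points stay in the unit ball of the gauge. -/
lemma gauge_shift_lt {p : Plane} (hp : N p < 1) {s : ℝ} (hs : s ∈ Icc (0 : ℝ) 1) :
    N (p + (s * bump N p) • β) < 1 := by
  rw [bump_of_le hp.le]
  have h1 : 0 ≤ s * (1 - N p) := mul_nonneg hs.1 (by linarith)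
  have h2 : s * (1 - N p) ≤ 1 - N p := mul_le_of_le_one_left (by linarith) hs.2
  have h3 := h.gauge_add_smul_le p h1
  have h4 : C * ‖β‖ * (s * (1 - N p)) ≤ C * ‖β‖ * (1 - N p) :=
    mul_le_mul_of_nonneg_left h2 (mul_nonneg h.pos.le (norm_nonneg _))
  nlinarith [h.small]

lemma shift_mem {p : Plane} (hp : p ∈ E) {s : ℝ} (hs : s ∈ Icc (0 : ℝ) 1) :
    p + (s * bump N p) • β ∈ E := by
  rcases lt_or_ge (N p) 1 with hlt | hge
  · exact h.mem_of_le _ (h.gauge_shift_lt hlt hs).le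
  · rwa [bump_eq_zero hge, mul_zero, zero_smul, add_zero]

lemma isCompact_unitBall : IsCompact {p | N p ≤ 1} :=
  Metric.isCompact_of_isClosed_isBounded (isClosed_le h.continuous continuous_const)
    (isBounded_ball.subset fun _ hp => h.subset (h.mem_of_le _ hp))

lemma collapse_pos {x : Realization T} {p : Plane} (hp : N p < 1)
    (hx : f (collapse T h.ne x) = ψ p) : 0 < (collapse T h.ne x).1 a := by
  have := h.star p hp
  rwa [← hx, f.symm_apply_apply] at this

/-- Near the vertex, the shift depends continuously on the point, although the share of `b` is
discontinuous on the link of the vertex: there the bump function vanishes. -/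
lemma continuous_splitMap (hS : IsFlatSpace S r) : Continuous (splitMap f ψ E N β h.ne) := by
  have hfc : Continuous fun x : Realization T => f (collapse T h.ne x) :=
    f.continuous.comp (continuous_collapse h.ne)
  have hψc := continuousOn_exp h.isIsometricDisk hS.pos
  rw [continuous_iff_continuousAt]
  intro x
  by_cases hx : f (collapse T h.ne x) ∈ ψ '' E
  · have hopen : IsOpen (ψ '' E) := isOpen_image_exp h.isIsometricDisk hS.pos h.isOpen h.subset
    have hev : ∀ᶠ y in 𝓝 x, f (collapse T h.ne y) ∈ ψ '' E :=
      hfc.continuousAt.eventually (hopen.mem_nhds hx)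
    set inv : Realization T → Plane := fun y => Function.invFunOn ψ E (f (collapse T h.ne y))
    have hinv : ContinuousAt inv x := ContinuousAt.comp (g := Function.invFunOn ψ E)
      ((h.continuousOn_invFunOn hS).continuousAt (hopen.mem_nhds hx)) hfc.continuousAt
    obtain ⟨p, hp, hpx⟩ := hx
    have hinvx : inv x = p := by
      simp only [inv, ← hpx]
      exact h.injOn.leftInvOn_invFunOn hp
    have hbump : ContinuousAt (fun y => bump N (inv y)) x :=
      h.continuous_bump.continuousAt.comp hinv
    have hσ : ContinuousAt (fun y => splitRatio a b y * bump N (inv y)) x := by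
      rcases lt_or_ge (N p) 1 with hlt | hge
      · exact (continuousAt_splitRatio h.ne (h.collapse_pos hlt hpx.symm)).mul hbump
      · have h0 : bump N (inv x) = 0 := by rw [hinvx, bump_eq_zero hge]
        rw [ContinuousAt, h0, mul_zero]
        rw [ContinuousAt, h0] at hbump
        exact squeeze_zero
          (fun y => mul_nonneg (splitRatio_mem y).1 (bump_nonneg _ _))
          (fun y => mul_le_of_le_one_left (bump_nonneg _ _) (splitRatio_mem y).2) hbump
    have hshift : ContinuousAt
        (fun y => inv y + (splitRatio a b y * bump N (inv y)) • β) x :=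
      hinv.add (hσ.smul continuousAt_const)
    have hmem : inv x + (splitRatio a b x * bump N (inv x)) • β ∈ ball (0 : Plane) R :=
      h.subset (h.shift_mem (hinvx ▸ hp) (splitRatio_mem x))
    refine (ContinuousAt.comp (g := ψ)
      (f := fun y => inv y + (splitRatio a b y * bump N (inv y)) • β)
      (hψc.continuousAt (isOpen_ball.mem_nhds hmem))
      hshift).congr (hev.mono fun y hy => ?_)
    rw [splitMap, if_pos hy]
    rfl
  · have hclosed : IsClosed (ψ '' {p | N p ≤ 1}) := (h.isCompact_unitBall.image_of_continuousOn
      (hψc.mono fun p hp => h.subset (h.mem_of_le p hp))).isClosed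
    have hev : ∀ᶠ y in 𝓝 x, f (collapse T h.ne y) ∈ (ψ '' {p | N p ≤ 1})ᶜ :=
      hfc.continuousAt.eventually (hclosed.isOpen_compl.mem_nhds
        fun ⟨p, hp, hpx⟩ => hx ⟨p, h.mem_of_le p hp, hpx⟩)
    refine hfc.continuousAt.congr (hev.mono fun y hy => ?_)
    exact (h.splitMap_eq_collapse fun p hp hpy => hy ⟨p, hp.le, hpy.symm⟩).symm

lemma left_edge_mem : {a, c} ∈ (contract T a b).faces :=
  mem_contract_of_notMem (mem_faces_of_subset T h.left_mem (by intro z; simp; tauto) (by simp))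
    (by simp [h.ne.symm, h.left_ne'.symm])

lemma right_edge_mem : {a, d} ∈ (contract T a b).faces :=
  mem_contract_of_notMem (mem_faces_of_subset T h.right_mem (by intro z; simp; tauto) (by simp))
    (by simp [h.ne.symm, h.right_ne'.symm])

/-- Above the two rays, everything belongs to `b`. -/
lemma splitRatio_of_pos {x : Realization T} {p : Plane} (hp : N p < 1)
    (hx : f (collapse T h.ne x) = ψ p) (hl : 0 < l p) : splitRatio a b x = 1 := by
  have := h.above p hp hl
  rw [← hx, f.symm_apply_apply] at this
  exact splitRatio_eq_one h.ne (apply_left_eq_zero h.ne this) (h.collapse_pos hp hx)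

/-- Below the two rays, everything belongs to `a`. -/
lemma splitRatio_of_neg {x : Realization T} {p : Plane} (hp : N p < 1)
    (hx : f (collapse T h.ne x) = ψ p) (hl : l p < 0) : splitRatio a b x = 0 := by
  have := h.below p hp hl
  rw [← hx, f.symm_apply_apply] at this
  exact splitRatio_eq_zero (apply_right_eq_zero h.ne this)

/-- A point of the open star of `a` that belongs to faces of both kinds lies on the edge `{a, c}`
or on the edge `{a, d}`, and hence in the unit ball of the gauge. -/
lemma exists_gauge_lt {q : Realization (contract T a b)} (hq : 0 < q.1 a)
    (hL : OnLeft T a b q) (hR : OnRight T a b q) :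
    ∃ p, N p < 1 ∧ f q = ψ p := by
  have hedge : ∀ z, z ≠ a → {a, z} ∈ (contract T a b).faces →
      q ∈ closedFace (contract T a b) {a, z} → ∃ p, N p < 1 ∧ f q = ψ p := by
    intro z hza hz hqz
    obtain ⟨t, ht, -, hqt⟩ := h.exists_eq_map_smul hza hz hqz
    refine ⟨t • v z, ?_, hqt⟩
    rw [h.spike_smul hza hz ht.1]
    refine lt_of_le_of_ne ht.2 fun ht1 => ?_
    rw [ht1, one_smul, h.map_spike z hza hz (right_mem_faces hz)] at hqt
    rw [f.injective hqt] at hq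
    simp [vertexPoint, hza] at hq
  rcases h.meet _ ((onLeft_iff h.ne hq).1 hL) (Realization.mem_supp.2 hq.ne')
    (notMem_of_mem_contract h.ne q.supp_mem) ((onRight_iff hq).1 hR) with hs | hs
  · exact hedge c h.left_ne h.left_edge_mem (closedFace_mono hs q.mem_closedFace_supp)
  · exact hedge d h.right_ne h.right_edge_mem (closedFace_mono hs q.mem_closedFace_supp)

/-- Points that are shifted are told apart by the monotonicity of the shift along `β`; for the other
points, the share of `b` is determined by the face which contains the collapsed point. -/
lemma injective_splitMap : Function.Injective (splitMap f ψ E N β h.ne) := by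
  intro x y hxy
  by_cases hx : ∃ p, N p < 1 ∧ f (collapse T h.ne x) = ψ p
  · obtain ⟨p, hp, hpx⟩ := hx
    rw [h.splitMap_eq (h.mem_of_le p hp.le) hpx] at hxy
    have hps := h.gauge_shift_lt hp (splitRatio_mem (a := a) (b := b) x)
    by_cases hy : ∃ p, N p < 1 ∧ f (collapse T h.ne y) = ψ p
    · obtain ⟨q, hq, hqy⟩ := hy
      rw [h.splitMap_eq (h.mem_of_le q hq.le) hqy] at hxy
      have hqs := h.gauge_shift_lt hq (splitRatio_mem (a := a) (b := b) y)
      obtain ⟨rfl, hs⟩ := h.height.shift_injective h.small (bump_nonneg N) h.bump_le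
        (splitRatio_mem x) (splitRatio_mem y) (h.splitRatio_of_pos hp hpx)
        (h.splitRatio_of_neg hp hpx) (h.splitRatio_of_pos hq hqy) (h.splitRatio_of_neg hq hqy)
        (h.injOn (h.mem_of_le _ hps.le) (h.mem_of_le _ hqs.le) hxy)
      have hbump : bump N p ≠ 0 := by
        rw [bump_of_le hp.le]
        exact (sub_pos.2 hp).ne'
      have hcol : collapse T h.ne x = collapse T h.ne y := f.injective (by rw [hpx, hqy])
      refine eq_of_collapse_eq h.ne hcol ?_
      rw [← splitRatio_mul h.ne x, ← splitRatio_mul h.ne y, mul_right_cancel₀ hbump hs, hcol]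
    · push Not at hy
      rw [h.splitMap_eq_collapse hy] at hxy
      exact absurd hxy.symm (hy _ hps)
  · push Not at hx
    rw [h.splitMap_eq_collapse hx] at hxy
    by_cases hy : ∃ p, N p < 1 ∧ f (collapse T h.ne y) = ψ p
    · obtain ⟨q, hq, hqy⟩ := hy
      rw [h.splitMap_eq (h.mem_of_le q hq.le) hqy] at hxy
      exact absurd hxy (hx _ (h.gauge_shift_lt hq (splitRatio_mem (a := a) (b := b) y)))
    · push Not at hy
      rw [h.splitMap_eq_collapse hy] at hxy
      have hcol := f.injective hxy
      refine eq_of_collapse_eq h.ne hcol ?_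
      have hx0 := x.nonneg a
      have hx1 := x.nonneg b
      have hy0 := y.nonneg a
      have hy1 := y.nonneg b
      have hca := congrArg (fun q => q.1 a) hcol
      simp only [collapse_left] at hca
      rcases (Realization.nonneg (collapse T h.ne x) a).eq_or_lt with h0 | hpos
      · rw [collapse_left] at h0
        linarith
      · by_cases hL : OnLeft T a b (collapse T h.ne x)
        · have hR : ¬ OnRight T a b (collapse T h.ne x) := fun hR => by
            obtain ⟨p, hp, hpx⟩ := h.exists_gauge_lt hpos hL hR
            exact hx p hp hpx
          rw [apply_right_eq_zero h.ne hR, apply_right_eq_zero h.ne (hcol ▸ hR)]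
        · have h1 := apply_left_eq_zero h.ne hL
          have h2 := apply_left_eq_zero (x := y) h.ne (hcol ▸ hL)
          linarith

lemma surjective_splitMap : Function.Surjective (splitMap f ψ E N β h.ne) := by
  intro y
  by_cases hy : ∃ p, N p < 1 ∧ y = ψ p
  · obtain ⟨p₀, hp₀, rfl⟩ := hy
    obtain ⟨p, s, hs, hs1, hs0, hp⟩ :=
      h.height.shift_surjective (bump_nonneg N) h.continuous_bump p₀
    have hpN : N p < 1 := gauge_lt_of_shift_lt (by rwa [hp])
    set q := f.symm (ψ p) with hq
    have hfq : f q = ψ p := f.apply_symm_apply _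
    have hqa : 0 < q.1 a := h.star p hpN
    have haq : a ∈ q.supp := Realization.mem_supp.2 hqa.ne'
    obtain ⟨t, ht, hqt, hat, hbt⟩ : ∃ t ∈ T.faces, (∀ u, u ≠ a → u ≠ b → q.1 u ≠ 0 → u ∈ t) ∧
        (s ≠ 1 → a ∈ t) ∧ (s ≠ 0 → b ∈ t) := by
      rcases lt_trichotomy (l p) 0 with hl | hl | hl
      · have := (onLeft_or_onRight h.ne hqa).resolve_right (h.below p hpN hl)
        exact ⟨_, (onLeft_iff h.ne hqa).1 this, fun u _ _ hu => Realization.mem_supp.2 hu,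
          fun _ => haq, fun h => absurd (hs0 hl) h⟩
      · rcases h.symm_map_mem_of_height_eq_zero h.left_ne h.left_edge_mem h.right_ne
          h.right_edge_mem h.height hpN.le hl with hqe | hqe
        · refine ⟨_, h.left_mem, fun u hua _ hu => ?_, by simp, by simp⟩
          have := Realization.supp_subset hqe (Realization.mem_supp.2 hu)
          simp only [Finset.mem_insert, Finset.mem_singleton] at this ⊢
          tauto
        · refine ⟨_, h.right_mem, fun u hua _ hu => ?_, by simp, by simp⟩
          have := Realization.supp_subset hqe (Realization.mem_supp.2 hu)
          simp only [Finset.mem_insert, Finset.mem_singleton] at this ⊢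
          tauto
      · have := (onLeft_or_onRight h.ne hqa).resolve_left (h.above p hpN hl)
        exact ⟨_, (onRight_iff hqa).1 this,
          fun u hua _ hu => by simp [hua, Realization.mem_supp.2 hu],
          fun h => absurd (hs1 hl) h, fun _ => Finset.mem_insert_self _ _⟩
    obtain ⟨x, hx, hxb, -⟩ := exists_collapse_eq h.ne hs ht hqt (fun _ => hat) (fun _ => hbt)
    refine ⟨x, ?_⟩
    have hxs : splitRatio a b x = s := by
      have := splitRatio_mul h.ne x
      rw [hxb, hx] at this
      exact mul_right_cancel₀ hqa.ne' this
    rw [h.splitMap_eq (h.mem_of_le p hpN.le) (by rw [hx, hfq]), hxs, hp]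
  · push Not at hy
    set q := f.symm y with hq
    have hfq : f q = y := f.apply_symm_apply _
    obtain ⟨s, hs, t, ht, hqt, hat, hbt⟩ : ∃ s ∈ Icc (0 : ℝ) 1, ∃ t ∈ T.faces,
        (∀ u, u ≠ a → u ≠ b → q.1 u ≠ 0 → u ∈ t) ∧ (q.1 a ≠ 0 → s ≠ 1 → a ∈ t) ∧
        (q.1 a ≠ 0 → s ≠ 0 → b ∈ t) := by
      by_cases haq : a ∈ q.supp
      · rcases mem_or_mem_of_mem_contract q.supp_mem haq with hs | hs
        · exact ⟨0, by simp, _, hs, fun u _ _ hu => Realization.mem_supp.2 hu, fun _ _ => haq,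
            fun _ h => absurd rfl h⟩
        · exact ⟨1, by simp, _, hs, fun u hua _ hu => by simp [hua, Realization.mem_supp.2 hu],
            fun _ h => absurd rfl h, fun _ _ => Finset.mem_insert_self _ _⟩
      · have hqa : q.1 a = 0 := by rwa [Realization.mem_supp, not_not] at haq
        exact ⟨0, by simp, _, mem_of_mem_contract_of_notMem q.supp_mem haq,
          fun u _ _ hu => Realization.mem_supp.2 hu, fun h => absurd hqa h, fun h => absurd hqa h⟩
    obtain ⟨x, hx, -, -⟩ := exists_collapse_eq h.ne hs ht hqt hat hbt
    refine ⟨x, ?_⟩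
    rw [h.splitMap_eq_collapse, hx, hfq]
    rw [hx, hfq]
    exact hy

end IsSplitting
end Splitting

end FlatSurface

/-! ### The edges of the split triangulation -/

namespace FlatSurface

open Set Metric Filter

section Edges

variable {S : Type*} [MetricSpace S] {r R C : ℝ} {ψ : Plane → S} {E : Set Plane} {N : Plane → ℝ}
  {V : Type*} [Fintype V] [DecidableEq V] {T : PreAbstractSimplicialComplex V} {a b : V}
  {f : Realization (contract T a b) ≃ₜ S} {ha : {a} ∈ (contract T a b).faces} {v : V → Plane}
  {c d : V} {β : Plane} {l : Plane → ℝ}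

lemma metricInterval_comm (p q : S) : metricInterval p q = metricInterval q p := by
  ext z
  simp only [metricInterval, mem_ofPred_eq]
  rw [dist_comm p z, dist_comm z q, dist_comm p q, add_comm]

lemma IsFlatSpace.isUniqueShortestPathTrace_comm (hS : IsFlatSpace S r) {p q : S} {A : Set S}
    (h : IsUniqueShortestPathTrace p q A) : IsUniqueShortestPathTrace q p A := by
  rw [hS.isUniqueShortestPathTrace_iff] at h ⊢
  rw [metricInterval_comm q p]
  refine ⟨h.1, fun x hx y hy hxy => h.2 hx hy ?_⟩
  have hx' : dist p x + dist x q = dist p q := hx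
  have hy' : dist p y + dist y q = dist p q := hy
  rw [dist_comm q x, dist_comm q y] at hxy
  linarith

namespace IsSplitting

variable (h : IsSplitting f ha r R ψ E v N C c d β l)
include h

/-- Faces that do not contain `b` are not moved. -/
lemma image_closedFace {s : Finset V} (hs : s ∈ T.faces) (hb : b ∉ s) :
    splitMap f ψ E N β h.ne '' closedFace T s = f '' closedFace (contract T a b) s := by
  ext y
  constructor
  · rintro ⟨x, hx, rfl⟩
    exact ⟨_, collapse_mem_closedFace h.ne hx hb,
      (h.splitMap_eq_of_apply_eq_zero (mem_closedFace_iff.1 hx b hb)).symm⟩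
  · rintro ⟨q, hq, rfl⟩
    have hqs : ∀ u, q.1 u ≠ 0 → u ∈ s := fun u hu => by
      by_contra hus
      exact hu (mem_closedFace_iff.1 hq u hus)
    obtain ⟨x, hx, hxb, hxs⟩ := exists_collapse_eq h.ne (q := q) (s := 0) (by simp) hs
      (fun u _ _ => hqs u) (fun hqa _ => hqs a hqa) (fun _ h0 => absurd rfl h0)
    exact ⟨x, hxs, by rw [h.splitMap_eq_of_apply_eq_zero (by rw [hxb, zero_mul]), hx]⟩

lemma splitMap_vertexPoint {x : V} (hx : {x} ∈ T.faces) (hxb : x ≠ b)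
    (hx' : {x} ∈ (contract T a b).faces) :
    splitMap f ψ E N β h.ne (vertexPoint T x hx) = f (vertexPoint (contract T a b) x hx') := by
  rw [h.splitMap_eq_of_apply_eq_zero (by simp [vertexPoint, hxb.symm])]
  congr 1
  exact eq_vertexPoint_of_mem_closedFace hx' (collapse_mem_closedFace h.ne
    (vertexPoint_mem_closedFace hx (by simp)) (by simp [hxb.symm]))

lemma collapse_eq_of_mem_edge {x : Realization T} (hx : x ∈ closedFace T {a, b}) :
    collapse T h.ne x = vertexPoint (contract T a b) a ha := by
  apply eq_vertexPoint_of_mem_closedFace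
  rw [Finset.pair_comm] at hx
  have := collapse_mem_closedFace_insert h.ne hx
  simpa using this

/-- The edge `{a, b}` is drawn as the radial segment from `0` to `β`. -/
lemma splitMap_of_mem_edge {x : Realization T} (hx : x ∈ closedFace T {a, b}) :
    splitMap f ψ E N β h.ne x = ψ (x.1 b • β) := by
  have hcol := h.collapse_eq_of_mem_edge hx
  have h0 : N 0 ≤ 1 := by rw [h.map_origin]; exact zero_le_one
  rw [h.splitMap_eq (h.mem_of_le 0 h0) (by rw [hcol, h.map_zero]), bump_of_le h0, h.map_origin,
    sub_zero, mul_one, zero_add]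
  have := splitRatio_mul h.ne x
  rw [hcol] at this
  simp only [vertexPoint, Pi.single_eq_same, mul_one] at this
  rw [this]

lemma image_edge (hab : {a, b} ∈ T.faces) :
    splitMap f ψ E N β h.ne '' closedFace T {a, b} = ψ '' segment ℝ 0 β := by
  ext y
  constructor
  · rintro ⟨x, hx, rfl⟩
    rw [h.splitMap_of_mem_edge hx]
    refine mem_image_of_mem ψ ?_
    rw [segment_eq_image]
    refine ⟨x.1 b, ⟨x.nonneg b, ?_⟩, by simp⟩
    linarith [apply_add_apply_of_mem_closedFace h.ne hx, x.nonneg a]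
  · rintro ⟨z, hz, rfl⟩
    rw [segment_eq_image] at hz
    obtain ⟨s, hs, rfl⟩ := hz
    obtain ⟨x, hx, hxb, hxe⟩ := exists_collapse_eq h.ne (q := vertexPoint (contract T a b) a ha)
      hs hab (fun u hua _ hu => absurd (by simp [vertexPoint, hua]) hu) (by simp) (by simp)
    refine ⟨x, hxe, ?_⟩
    rw [h.splitMap_of_mem_edge hxe, hxb]
    simp [vertexPoint]

lemma splitMap_vertexPoint_right (hb : {b} ∈ T.faces) :
    splitMap f ψ E N β h.ne (vertexPoint T b hb) = ψ β := by
  rw [h.splitMap_of_mem_edge (vertexPoint_mem_closedFace hb (by simp))]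
  simp [vertexPoint]

/-- On an edge from `b` to `z`, the points over the spike `v z` are moved onto the segment from `β`
to `v z`. -/
lemma splitMap_of_collapse_eq {z : V} (hza : z ≠ a) (hz : {a, z} ∈ (contract T a b).faces)
    {x : Realization T} (hx : x.1 a = 0) {t : ℝ} (ht : t ∈ Icc (0 : ℝ) 1) (htE : t • v z ∈ E)
    (hxt : f (collapse T h.ne x) = ψ (t • v z)) :
    splitMap f ψ E N β h.ne x = ψ ((1 - t) • β + t • v z) := by
  have hN := h.spike_smul hza hz ht.1
  rw [h.splitMap_eq htE hxt, bump_of_le (hN.trans_le ht.2), hN, add_comm]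
  rcases ht.2.eq_or_lt with rfl | hlt
  · simp
  · rw [splitRatio_eq_one h.ne hx (h.collapse_pos (hN.trans_lt hlt) hxt), one_mul]

lemma image_closedFace_right {z : V} (hza : z ≠ a) (hzb : z ≠ b) (hz : {b, z} ∈ T.faces) :
    splitMap f ψ E N β h.ne '' closedFace T {b, z} = ψ '' segment ℝ β (v z) := by
  have hzK : {a, z} ∈ (contract T a b).faces :=
    insert_mem_contract hz (by simpa using hzb.symm)
  ext y
  constructor
  · rintro ⟨x, hx, rfl⟩
    obtain ⟨t, ht, htE, hxt⟩ :=
      h.exists_eq_map_smul hza hzK (collapse_mem_closedFace_insert h.ne hx)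
    have hxa : x.1 a = 0 := mem_closedFace_iff.1 hx a (by simp [h.ne, hza.symm])
    rw [h.splitMap_of_collapse_eq hza hzK hxa ht htE hxt]
    refine mem_image_of_mem ψ ?_
    rw [segment_eq_image]
    exact ⟨t, ht, rfl⟩
  · rintro ⟨p, hp, rfl⟩
    rw [segment_eq_image] at hp
    obtain ⟨t, ht, rfl⟩ := hp
    have hqe := h.symm_map_mem_closedFace hza hzK ht
    rw [mem_closedFace_iff] at hqe
    obtain ⟨x, hx, hxb, hxe⟩ := exists_collapse_eq h.ne (q := f.symm (ψ (t • v z))) (s := 1)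
      (by simp) hz
      (fun u hua _ hu => by
        by_contra hut
        simp only [Finset.mem_insert, Finset.mem_singleton, not_or] at hut
        exact hu (hqe u (by simp [hua, hut.2])))
      (fun _ h1 => absurd rfl h1) (by simp)
    refine ⟨x, hxe, ?_⟩
    have hxa : x.1 a = 0 := mem_closedFace_iff.1 hxe a (by simp [h.ne, hza.symm])
    have htE : t • v z ∈ E := h.mem_of_le _ ((h.spike_smul hza hzK ht.1).trans_le ht.2)
    exact h.splitMap_of_collapse_eq hza hzK hxa ht htE (by rw [hx, f.apply_symm_apply])

/-- The map `splitMap` draws all edges as unique shortest paths, provided that this is true for the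
segments that replace the spikes at `b`. -/
lemma isUniqueShortestPathTrace_edge (hS : IsFlatSpace S r)
    (hf : IsUniqueShortestPathEmbedding (contract T a b) f) (hβ : ‖β‖ < r)
    (hstable : ∀ z, z ≠ a → {a, z} ∈ (contract T a b).faces →
      IsUniqueShortestPathTrace (ψ β) (ψ (v z)) (ψ '' segment ℝ β (v z)))
    (x y : V) (hx : {x} ∈ T.faces) (hy : {y} ∈ T.faces) (hxy : x ≠ y) (he : {x, y} ∈ T.faces) :
    IsUniqueShortestPathTrace (splitMap f ψ E N β h.ne (vertexPoint T x hx))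
      (splitMap f ψ E N β h.ne (vertexPoint T y hy))
      (splitMap f ψ E N β h.ne '' closedFace T {x, y}) := by
  have hright : ∀ z (hb : {b} ∈ T.faces) (hz : {z} ∈ T.faces), b ≠ z → {b, z} ∈ T.faces →
      IsUniqueShortestPathTrace (splitMap f ψ E N β h.ne (vertexPoint T b hb))
        (splitMap f ψ E N β h.ne (vertexPoint T z hz))
        (splitMap f ψ E N β h.ne '' closedFace T {b, z}) := by
    intro z hb hz hbz he
    rw [h.splitMap_vertexPoint_right hb]
    by_cases hza : z = a
    · subst hza
      rw [Finset.pair_comm] at he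
      rw [Finset.pair_comm b z, h.image_edge he, h.splitMap_vertexPoint hz h.ne ha, ← h.map_zero]
      have hR : (0 : Plane) ∈ ball (0 : Plane) R := h.subset (h.mem_of_le 0 (by
        rw [h.map_origin]; exact zero_le_one))
      exact hS.isUniqueShortestPathTrace_comm
        (hS.isUniqueShortestPathTrace_of_norm_lt (h.isIsometricDisk 0 hR) hβ)
    · have hzK : {a, z} ∈ (contract T a b).faces :=
        insert_mem_contract he (by simpa using hbz)
      rw [h.image_closedFace_right hza hbz.symm he,
        h.splitMap_vertexPoint hz hbz.symm (right_mem_faces hzK),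
        ← h.map_spike z hza hzK (right_mem_faces hzK)]
      exact hstable z hza hzK
  by_cases hxb : x = b
  · subst hxb
    exact hright y hx hy hxy he
  by_cases hyb : y = b
  · subst hyb
    rw [Finset.pair_comm] at he ⊢
    exact hS.isUniqueShortestPathTrace_comm (hright x hy hx hxy.symm he)
  · have hmem : ∀ {s : Finset V}, s ∈ T.faces → b ∉ s → s ∈ (contract T a b).faces :=
      mem_contract_of_notMem
    have hxK := hmem hx (by simpa using Ne.symm hxb)
    have hyK := hmem hy (by simpa using Ne.symm hyb)
    have hb : b ∉ ({x, y} : Finset V) := by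
      simp [Ne.symm hxb, Ne.symm hyb]
    rw [h.image_closedFace he hb, h.splitMap_vertexPoint hx hxb hxK,
      h.splitMap_vertexPoint hy hyb hyK]
    exact hf x y hxK hyK hxy (hmem he hb)

end IsSplitting

/-- A unique shortest path embedding of the contraction can be split at the vertex `a`, inside any
neighbourhood of the image of `a`. -/
theorem exists_isUniqueShortestPathEmbedding [CompactSpace S] [CompactSpace (Realization T)]
    (hS : IsFlatSpace S r) (hT : ContractionData T a b)
    (hcard : ∀ s ∈ (contract T a b).faces, s.card ≤ 3)
    (hf : IsUniqueShortestPathEmbedding (contract T a b) f)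
    {U : Set S} (hU : U ∈ 𝓝 (f (vertexPoint (contract T a b) a ha))) :
    ∃ g : Realization T ≃ₜ S, IsUniqueShortestPathEmbedding T g ∧ g '' closedFace T {a, b} ⊆ U ∧
      ∀ (x : V) (hx : {x} ∈ T.faces) (hx' : {x} ∈ (contract T a b).faces), x ≠ a → x ≠ b →
        g (vertexPoint T x hx) = f (vertexPoint (contract T a b) x hx') := by
  have hne : ∃ z, z ≠ a ∧ {a, z} ∈ (contract T a b).faces := by
    obtain ⟨c, -, -, hca, hcb, -, -, hc, -⟩ := hT.exists_apexes
    exact ⟨c, hca, mem_contract_of_notMem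
      (mem_faces_of_subset T hc (by intro z; simp; tauto) (by simp))
      (by simp [hT.ne.symm, hcb.symm])⟩
  obtain ⟨R, ψ, E, v, N, C, h⟩ := exists_isStarGauge hS hf hcard ha hne
  obtain ⟨c, d, β₀, l, hca, hcb, hda, hdb, hc, hd, hmeet, hl, habove, hbelow⟩ :=
    h.exists_separating_height hS hT
  have h0E : (0 : Plane) ∈ E := h.mem_of_le 0 (by rw [h.map_origin]; exact zero_le_one)
  -- Every sufficiently short vector in the direction of `β₀` will do.
  have hev : ∀ᶠ β in 𝓝 (0 : Plane), C * ‖β‖ < 1 ∧ ‖β‖ < r ∧ ψ '' segment ℝ 0 β ⊆ U ∧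
      ∀ z, z ≠ a → {a, z} ∈ (contract T a b).faces →
        IsUniqueShortestPathTrace (ψ β) (ψ (v z)) (ψ '' segment ℝ β (v z)) := by
    refine Filter.Eventually.and ?_ (Filter.Eventually.and ?_ (Filter.Eventually.and ?_ ?_))
    · have hcont : Continuous fun β : Plane => C * ‖β‖ := by fun_prop
      exact hcont.continuousAt.eventually (gt_mem_nhds (by simp))
    · exact continuous_norm.continuousAt.eventually (gt_mem_nhds (by simpa using hS.pos))
    · have hpre : ψ ⁻¹' U ∈ 𝓝 (0 : Plane) :=
        (h.continuousAt hS h0E).preimage_mem_nhds (by rwa [h.map_zero])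
      obtain ⟨δ, hδ, hsub⟩ := Metric.mem_nhds_iff.1 hpre
      filter_upwards [ball_mem_nhds (0 : Plane) hδ] with β hβ
      rw [image_subset_iff]
      exact ((convex_ball (0 : Plane) δ).segment_subset (mem_ball_self hδ) hβ).trans hsub
    · rw [eventually_all]
      intro z
      by_cases hz : z ≠ a ∧ {a, z} ∈ (contract T a b).faces
      · have hzK := right_mem_faces hz.2
        have hu := hf a z ha hzK hz.1.symm hz.2
        rw [← h.map_zero, ← h.map_spike z hz.1 hz.2 hzK, ← h.image_segment z hz.1 hz.2] at hu
        exact (hS.eventually_isUniqueShortestPathTrace h.isIsometricDisk h.isOpen h.subset h.injOn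
          (h.segment_subset z hz.1 hz.2) hu).mono fun β hβ _ _ => hβ
      · exact Eventually.of_forall fun β h1 h2 => absurd ⟨h1, h2⟩ hz
  have hcont : Tendsto (fun ε : ℝ => ε • β₀) (𝓝[>] 0) (𝓝 0) := by
    have : Continuous fun ε : ℝ => ε • β₀ := by fun_prop
    have := this.tendsto 0
    rw [zero_smul] at this
    exact this.mono_left nhdsWithin_le_nhds
  obtain ⟨ε, ⟨hsmall, hr, hsegU, hstable⟩, hε⟩ :=
    ((hcont.eventually hev).and self_mem_nhdsWithin).exists
  have hε : 0 < ε := hε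
  have hsplit : IsSplitting f ha r R ψ E v N C c d (ε • β₀) (fun p => l p / ε) :=
    ⟨h, hT.ne, hca, hcb, hda, hdb, hc, hd, hmeet, hl.const_smul hε,
      fun p hp hlp => habove p hp ((div_pos_iff_of_pos_right hε).1 hlp),
      fun p hp hlp => hbelow p hp (by rwa [div_lt_iff₀ hε, zero_mul] at hlp), hsmall⟩
  set g : Realization T ≃ₜ S := Continuous.homeoOfEquivCompactToT2
    (f := Equiv.ofBijective _ ⟨hsplit.injective_splitMap, hsplit.surjective_splitMap⟩)
    (hsplit.continuous_splitMap hS)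
  refine ⟨g, hsplit.isUniqueShortestPathTrace_edge hS hf hr hstable, ?_, fun x hx hx' hxa hxb =>
    hsplit.splitMap_vertexPoint hx hxb hx'⟩
  exact (hsplit.image_edge hT.mem).trans_subset hsegU

end Edges

end FlatSurface

theorem mainTheorem12
    {S : Type*} [MetricSpace S] [CompactSpace S] [ConnectedSpace S]
    [ChartedSpace FlatSurface.Plane S] [IsManifold (𝓡 2) ∞ S]
    [Bundle.RiemannianBundle (fun x : S => TangentSpace (𝓡 2) x)]
    [IsContMDiffRiemannianBundle (𝓡 2) ∞ FlatSurface.Plane (fun x : S => TangentSpace (𝓡 2) x)]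
    [IsRiemannianManifold (𝓡 2) S] (hflat : FlatSurface.IsFlat S)
    {V : Type*} [Fintype V] [DecidableEq V] (T : PreAbstractSimplicialComplex V)
    (hT : FlatSurface.IsTriangulation T S)
    (a b : V) (he : FlatSurface.IsContractibleEdge T S a b) :
    ((∃ f : FlatSurface.Realization (FlatSurface.contract T a b) ≃ₜ S,
        FlatSurface.IsUniqueShortestPathEmbedding (FlatSurface.contract T a b) f) →
      ∃ g : FlatSurface.Realization T ≃ₜ S, FlatSurface.IsUniqueShortestPathEmbedding T g) ∧
    ∀ f : FlatSurface.Realization (FlatSurface.contract T a b) ≃ₜ S,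
      FlatSurface.IsUniqueShortestPathEmbedding (FlatSurface.contract T a b) f →
      ∀ U ∈ 𝓝 (f (FlatSurface.vertexPoint (FlatSurface.contract T a b) a
        (FlatSurface.singleton_mem_contract he.mem))),
      ∃ g : FlatSurface.Realization T ≃ₜ S, FlatSurface.IsUniqueShortestPathEmbedding T g ∧
        g '' FlatSurface.closedFace T {a, b} ⊆ U ∧
        ∀ (x : V) (hx : {x} ∈ T.faces) (hx' : {x} ∈ (FlatSurface.contract T a b).faces),
          x ≠ a → x ≠ b →
          g (FlatSurface.vertexPoint T x hx) =
            f (FlatSurface.vertexPoint (FlatSurface.contract T a b) x hx') := by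
  obtain ⟨r, hS⟩ := FlatSurface.exists_isFlatSpace hflat
  obtain ⟨e⟩ := hT.homeomorphic
  have : CompactSpace (FlatSurface.Realization T) := e.symm.compactSpace
  have main := fun (f : FlatSurface.Realization (FlatSurface.contract T a b) ≃ₜ S)
      (hf : FlatSurface.IsUniqueShortestPathEmbedding (FlatSurface.contract T a b) f) (U : Set S)
      (hU : U ∈ 𝓝 (f (FlatSurface.vertexPoint (FlatSurface.contract T a b) a
        (FlatSurface.singleton_mem_contract he.mem)))) =>
    FlatSurface.exists_isUniqueShortestPathEmbedding hS
      ⟨he.ne, he.mem, hT.two_triangles, he.contract.two_triangles,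
        hS.link_connected f (FlatSurface.singleton_mem_contract he.mem)⟩
      he.contract.card_le hf hU
  refine ⟨?_, main⟩
  rintro ⟨f, hf⟩
  obtain ⟨g, hg, -⟩ := main f hf Set.univ Filter.univ_mem
  exact ⟨g, hg⟩
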